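/- All matroids are finite. For a matroid $M$ on $E$ with rank function $r$ put $\lambda(X)=r(X)+r(E-X)-r(M)+1$ for $X\subseteq E$. Call $X$ **$k$-separating**, and the unordered partition $(X,E-X)$ a **$k$-separation**, if $\lambda(X)\le k$. For $k\ge 2$, $M$ is **loosely vertically $k$-connected** if every $(k-1)$-separation $(X,Y)$ has $r(X)\le k-2$ or $r(Y)\le k-2$; it is **strictly $k$-connected** if, for $1\le l<k$, every $l$-separation $(X,Y)$ has $|X|<l$ or $|Y|<l$. A **tangle of order $k$** is a collection $\mathcal T$ of subsets of $E$ such that $\lambda(A)<k$ for all $A\in\mathcal T$; for every $(k-1)$-separation $(A,E-A)$, $A\in\mathcal T$ or $E-A\in\mathcal T$; no three members of $\mathcal T$ have union $E$; and $E-\{e\}\notin\mathcal T$ for all $e\in E$. Fix such a $\mathcal T$. A set is **weak** if it is contained in a member of $\mathcal T$, and **strong** otherwise; a partition is strong if all its parts are. A strong $k$-separating set $X$ is **fully closed** if $\lambda(X\cup Y)>k$ for every non-empty weak $Y\subseteq E-X$, and $\mathrm{fcl}(X)$ is the intersection of all fully closed $k$-separating sets containing $X$. Strong $k$-separations $(X,Y)$,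 $(X',Y')$ are **equivalent** if $\{\mathrm{fcl}(X),\mathrm{fcl}(Y)\}=\{\mathrm{fcl}(X'),\mathrm{fcl}(Y')\}$. A $k$-separation is **non-sequential** if for neither side $Z$ it holds that $E-Z$ is strong and $\mathrm{fcl}(E-Z)=E$. (Non-sequential $k$-separations are strong.) A **$k$-flower** is a strong partition $(P_1,\dots,P_n)$ of $E$, $n\ge1$, in which all $P_i$ and $P_i\cup P_{i+1}$ (indices modulo $n$) are $k$-separating; it **displays** the $k$-separations $(X,E-X)$ for which $X$ is a union of petals $P_i$. It is a **$k$-anemone** if all non-empty unions of petals are $k$-separating, and a **$k$-daisy** if the $k$-separating non-empty unions are exactly those of petals with cyclically consecutive indices. Two $k$-flowers are equivalent if each non-sequential $k$-separation displayed by either is equivalent to a non-sequential $k$-separation displayed by the other; the **order** of a $k$-flower is the least number of petals of a $k$-flower equivalent to it. A petal $P_i$ is **loose** if $P_i\subseteq\mathrm{fcl}(P_j)$ for some $j\ne i$, where $i,j$ are required to be cyclically consecutive unless the flower is an anemone. Let $T$ be a finite tree, some of whose vertices (the **bag vertices**) are labelled by subsets of $E$ (**bags**, possibly empty) that together partition $E$,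 each bag labelling one vertex. An edge $e$ displays the partition of $E$ into two sets induced by the components of $T\backslash e$, and a non-bag vertex $v$ displays the partition induced by the components of $T-v$. A $k$-separation is **displayed by $T$** if it is displayed by an edge, or by the $k$-flower displayed by a non-bag vertex. A strong $k$-separation **conforms** with $T$ if it is equivalent to a $k$-separation displayed by $T$ or to a $k$-separation one of whose sides is contained in a bag. $T$ is a **partial $k$-tree** for $\mathcal T$ if: 1. each edge displays a strong $k$-separation, which is non-sequential if both ends of the edge are bag vertices; 2. each non-bag vertex is labelled $D$ or $A$, and a cyclic order is given on the edges at each vertex labelled $D$; 3. the partition displayed by a vertex labelled $A$ is a $k$-anemone, and the partition displayed by a vertex labelled $D$, in the corresponding cyclic order, is a $k$-daisy; in both cases of order at least three and without loose petals; 4. every non-sequential $k$-separation conforms with $T$. Write $T\preccurlyeq T'$ if each non-sequential $k$-separation displayed by $T$ is equivalent to a non-sequential $k$-separation displayed by $T'$. A partial $k$-tree $T$ is **maximal** if $T\preccurlyeq T'$ implies $T'\preccurlyeq T$ for all partial $k$-trees $T'$. **Corollary 6.3.** Let $k\ge 2$, and let $M$ be a matroid on $E$ such that either $M$ is loosely vertically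 $k$-connected and $r(M)\ge\max\{8k-15,2\}$, or $M$ is strictly $k$-connected and $|E|\ge\max\{8k-15,2\}$. Then $M$ has exactly one tangle $\mathcal T_k$ of order $k$, and if $T$ is a maximal partial $k$-tree for $\mathcal T_k$, then every $k$-separation of $M$ that is non-sequential with respect to $\mathcal T_k$ is equivalent to some $k$-separation displayed by $T$. -/

import Mathlib

open Set

namespace TangleTree

universe u

variable {α : Type u}

/-! ### Connectivity systems and the connectivity function of a matroid -/

/-- A connectivity system `(E, lam)`: a finite set `E` with an integer-valued, symmetric and
submodular function on the subsets of `E` (the values of `lam` on other sets are never used). -/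
structure ConnSystem (α : Type u) where
  E : Set α
  finite_E : E.Finite
  lam : Set α → ℤ
  symmetric : ∀ X ⊆ E, lam X = lam (E \ X)
  submodular : ∀ X ⊆ E, ∀ Y ⊆ E, lam (X ∪ Y) + lam (X ∩ Y) ≤ lam X + lam Y

/-- The rank of a set in a finite matroid, as an integer. -/
noncomputable def rank (M : Matroid α) (X : Set α) : ℤ := ((M.eRk X).toNat : ℤ)

theorem rank_submodular (M : Matroid α) [M.Finite] (X Y : Set α) :
    rank M (X ∪ Y) + rank M (X ∩ Y) ≤ rank M X + rank M Y := by
  have h := M.eRk_inter_add_eRk_union_le X Y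
  have ne : ∀ Z : Set α, M.eRk Z ≠ ⊤ := fun Z =>
    Matroid.eRk_ne_top_iff.2 (Matroid.RankFinite.isRkFinite Z)
  have h2 : (M.eRk (X ∩ Y)).toNat + (M.eRk (X ∪ Y)).toNat
      ≤ (M.eRk X).toNat + (M.eRk Y).toNat := by
    rw [← ENat.toNat_add (ne _) (ne _), ← ENat.toNat_add (ne _) (ne _)]
    exact ENat.toNat_le_toNat h (by simp [ne])
  unfold rank
  omega

/-- The connectivity system `(E(M), lam_M)` of a finite matroid, where
`lam_M(X) = r(X) + r(E - X) - r(M) + 1`. -/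
noncomputable def matroidConn (M : Matroid α) [M.Finite] : ConnSystem α where
  E := M.E
  finite_E := M.ground_finite
  lam X := rank M X + rank M (M.E \ X) - rank M M.E + 1
  symmetric X hX := by
    rw [sdiff_sdiff_cancel_left hX]
    ring
  submodular X _ Y _ := by
    have h1 := rank_submodular M X Y
    have h2 := rank_submodular M (M.E \ X) (M.E \ Y)
    have e1 : M.E \ X ∪ M.E \ Y = M.E \ (X ∩ Y) := by
      ext x; simp only [mem_union, mem_sdiff, mem_inter_iff]; tauto
    have e2 : (M.E \ X) ∩ (M.E \ Y) = M.E \ (X ∪ Y) := by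
      ext x; simp only [mem_union, mem_sdiff, mem_inter_iff]; tauto
    rw [e1, e2] at h2
    linarith

/-- `M` is loosely vertically `k`-connected: for each `(k-1)`-separation `(X, Y)` of `M`, either
`r(X) ≤ k - 2` or `r(Y) ≤ k - 2`. -/
def LooselyVerticallyConnected (M : Matroid α) [M.Finite] (k : ℕ) : Prop :=
  ∀ X ⊆ M.E, (matroidConn M).lam X ≤ (k : ℤ) - 1 →
    rank M X ≤ (k : ℤ) - 2 ∨ rank M (M.E \ X) ≤ (k : ℤ) - 2

/-- `M` is (strictly, i.e. Tutte) `k`-connected: for no positive `l < k` is there an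
`l`-separation `(X, Y)` of `M` with `|X|, |Y| ≥ l`. -/
def StrictlyConnected (M : Matroid α) [M.Finite] (k : ℕ) : Prop :=
  ∀ l : ℕ, 1 ≤ l → l < k → ∀ X ⊆ M.E, (matroidConn M).lam X ≤ (l : ℤ) →
    X.ncard < l ∨ (M.E \ X).ncard < l

/-! ### Separations and tangles -/

/-- `X` is `k`-separating. The `k`-separation `(X, E - X)`, an unordered partition, is represented
throughout by either of the sets `X` and `E - X`. -/
def ConnSystem.KSep (K : ConnSystem α) (k : ℕ) (X : Set α) : Prop :=
  X ⊆ K.E ∧ K.lam X ≤ (k : ℤ)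

/-- `𝒯` is a tangle of order `k` in `K`. -/
structure IsTangle (K : ConnSystem α) (k : ℕ) (𝒯 : Set (Set α)) : Prop where
  subset_ground : ∀ A ∈ 𝒯, A ⊆ K.E
  lam_lt : ∀ A ∈ 𝒯, K.lam A < (k : ℤ)
  mem_or_compl_mem : ∀ A ⊆ K.E, K.lam A ≤ (k : ℤ) - 1 → A ∈ 𝒯 ∨ K.E \ A ∈ 𝒯
  union_ne : ∀ A ∈ 𝒯, ∀ B ∈ 𝒯, ∀ C ∈ 𝒯, A ∪ B ∪ C ≠ K.E
  compl_singleton_notMem : ∀ e ∈ K.E, K.E \ {e} ∉ 𝒯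

/-- `𝒯`-weak sets are the sets contained in a member of `𝒯`. -/
def Weak (𝒯 : Set (Set α)) (X : Set α) : Prop := ∃ A ∈ 𝒯, X ⊆ A

/-- `𝒯`-strong sets. -/
def Strong (𝒯 : Set (Set α)) (X : Set α) : Prop := ¬ Weak 𝒯 X

/-! ### Full closure, equivalence, sequential separations -/

section Separations

variable (K : ConnSystem α) (k : ℕ) (𝒯 : Set (Set α))

/-- The `𝒯`-strong `k`-separating set `X` is fully closed with respect to `𝒯`. -/
def FullyClosed (X : Set α) : Prop :=
  K.KSep k X ∧ Strong 𝒯 X ∧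
    ∀ Y ⊆ K.E \ X, Y.Nonempty → Weak 𝒯 Y → ¬ K.KSep k (X ∪ Y)

/-- The full closure of `X` with respect to `𝒯`: the intersection of all fully closed
`k`-separating sets that contain `X`. -/
def fcl (X : Set α) : Set α := ⋂₀ {F | FullyClosed K k 𝒯 F ∧ X ⊆ F}

/-- `(X, E - X)` is a `𝒯`-strong `k`-separation. -/
def StrongSep (X : Set α) : Prop :=
  K.KSep k X ∧ Strong 𝒯 X ∧ Strong 𝒯 (K.E \ X)

/-- The `𝒯`-strong `k`-separations `(X, E - X)` and `(Y, E - Y)` are `𝒯`-equivalent, that is, the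
unordered pairs formed by the full closures of their two sides are equal. -/
def EquivSep (X Y : Set α) : Prop :=
  StrongSep K k 𝒯 X ∧ StrongSep K k 𝒯 Y ∧
    ((fcl K k 𝒯 X = fcl K k 𝒯 Y ∧ fcl K k 𝒯 (K.E \ X) = fcl K k 𝒯 (K.E \ Y)) ∨
      (fcl K k 𝒯 X = fcl K k 𝒯 (K.E \ Y) ∧ fcl K k 𝒯 (K.E \ X) = fcl K k 𝒯 Y))

/-- The `k`-separating set `X` is `𝒯`-sequential. -/
def SequentialSet (X : Set α) : Prop :=
  K.KSep k X ∧ Strong 𝒯 (K.E \ X) ∧ fcl K k 𝒯 (K.E \ X) = K.E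

/-- `(X, E - X)` is a `k`-separation that is non-sequential with respect to `𝒯`. -/
def NonSequentialSep (X : Set α) : Prop :=
  K.KSep k X ∧ ¬ (SequentialSet K k 𝒯 X ∨ SequentialSet K k 𝒯 (K.E \ X))

/-- The set of all non-sequential `k`-separating sets with `𝒯`-strong complements. -/
def nonSequentialSets : Set (Set α) :=
  {X | K.KSep k X ∧ ¬ SequentialSet K k 𝒯 X ∧ Strong 𝒯 (K.E \ X)}

end Separations

/-- `(X, E - X)` is a `(k, 𝒮)`-separation. -/
def SSep (K : ConnSystem α) (k : ℕ) (𝒮 : Set (Set α)) (X : Set α) : Prop :=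
  K.KSep k X ∧ X ∈ 𝒮 ∧ K.E \ X ∈ 𝒮

/-! ### Flowers -/

/-- The successor of `i` in the cyclic order on `Fin n`. -/
def cycSucc {n : ℕ} (i : Fin n) : Fin n := ⟨(i.val + 1) % n, Nat.mod_lt _ i.pos⟩

/-- `I` consists of consecutive elements of the cyclic order on `Fin n`. -/
def Consecutive {n : ℕ} (I : Set (Fin n)) : Prop :=
  ∃ (a : Fin n) (l : ℕ), I = {i | ∃ j < l, i.val = (a.val + j) % n}

/-- `P_I`, the union of the petals with index in `I`. -/
def petalUnion {n : ℕ} (P : Fin n → Set α) (I : Set (Fin n)) : Set α := ⋃ i ∈ I, P i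

section Flowers

variable (K : ConnSystem α) (k : ℕ) (𝒯 𝒮 : Set (Set α))

/-- `(P_1, …, P_n)` is a `k`-flower in `𝒯`. -/
structure IsFlower {n : ℕ} (P : Fin n → Set α) : Prop where
  pos : 0 < n
  disjoint : Pairwise fun i j => Disjoint (P i) (P j)
  union_eq : (⋃ i, P i) = K.E
  strong : ∀ i, Strong 𝒯 (P i)
  kSep : ∀ i, K.KSep k (P i)
  kSep_succ : ∀ i, K.KSep k (P i ∪ P (cycSucc i))

/-- `P` is a `k`-anemone in `𝒯`. -/
def IsAnemone {n : ℕ} (P : Fin n → Set α) : Prop :=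
  IsFlower K k 𝒯 P ∧ ∀ I : Set (Fin n), I.Nonempty → K.KSep k (petalUnion P I)

/-- `P` is a `k`-daisy in `𝒯`. -/
def IsDaisy {n : ℕ} (P : Fin n → Set α) : Prop :=
  IsFlower K k 𝒯 P ∧
    ∀ I : Set (Fin n), I.Nonempty → (K.KSep k (petalUnion P I) ↔ Consecutive I)

/-- The `k`-separation `(X, E - X)` is displayed by the flower `P`. -/
def FlowerDisplays {n : ℕ} (P : Fin n → Set α) (X : Set α) : Prop :=
  K.KSep k X ∧ ∃ I : Set (Fin n), X = petalUnion P I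

/-- The quasi-order on `k`-flowers: each `(k, 𝒮)`-separation displayed by `P` is `𝒯`-equivalent to
a `(k, 𝒮)`-separation displayed by `Q`. -/
def FlowerLE {m n : ℕ} (P : Fin m → Set α) (Q : Fin n → Set α) : Prop :=
  ∀ X, SSep K k 𝒮 X → FlowerDisplays K k P X →
    ∃ Y, SSep K k 𝒮 Y ∧ FlowerDisplays K k Q Y ∧ EquivSep K k 𝒯 X Y

/-- The `𝒮`-order of a flower `P`: the minimum number of petals of a `k`-flower that is equivalent
to `P` with respect to `𝒮`. -/
noncomputable def sOrder {n : ℕ} (P : Fin n → Set α) : ℕ :=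
  sInf {m | ∃ Q : Fin m → Set α,
    IsFlower K k 𝒯 Q ∧ FlowerLE K k 𝒯 𝒮 P Q ∧ FlowerLE K k 𝒯 𝒮 Q P}

/-- The petal `P i` of the flower `P` is `𝒯`-loose: it lies in the full closure of another petal
`P j` that is consecutive to it up to labels. The petals of an anemone may be permuted
arbitrarily, so that any two of them are consecutive up to labels; otherwise `i` and `j` have to be
neighbours in the cyclic order. -/
def LoosePetal {n : ℕ} (P : Fin n → Set α) (i : Fin n) : Prop :=
  ∃ j, j ≠ i ∧ (IsAnemone K k 𝒯 P ∨ j = cycSucc i ∨ i = cycSucc j) ∧ P i ⊆ fcl K k 𝒯 (P j)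

end Flowers

/-! ### Labelled trees -/

/-- A vertex of a labelled tree either is a bag vertex, labelled by a bag, or it is a non-bag
vertex, labelled `D` (daisy) or `A` (anemone). -/
inductive VertexLabel (α : Type u) : Type u
  | bag (B : Set α)
  | D
  | A

/-- The set that a vertex contributes: its bag, if it is a bag vertex. -/
def VertexLabel.toSet : VertexLabel α → Set α
  | .bag B => B
  | .D => ∅
  | .A => ∅

/-- The vertex is a bag vertex. -/
def VertexLabel.IsBag (x : VertexLabel α) : Prop := ∃ B, x = .bag B

/-- A finite tree with a family of bags that partitions `E`, each bag labelling a vertex. Bags may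
be empty. -/
structure LabelledTree (E : Set α) where
  V : Type
  finite_V : Finite V
  graph : SimpleGraph V
  isTree : graph.IsTree
  label : V → VertexLabel α
  disjoint : Pairwise fun v w => Disjoint (label v).toSet (label w).toSet
  union_eq : (⋃ v, (label v).toSet) = E

namespace LabelledTree

variable {E : Set α} (T : LabelledTree E)

/-- The union of the bags that label vertices in `U`. -/
def bagUnion (U : Set T.V) : Set α := ⋃ v ∈ U, (T.label v).toSet

/-- For an edge `vw`: the subset of `E` displayed by the component of `T \ vw` that contains `w`.
The partition displayed by the edge is `(edgeSide w v, edgeSide v w)`. -/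
def edgeSide (v w : T.V) : Set α :=
  T.bagUnion {x | (T.graph.deleteEdges {s(v, w)}).Reachable w x}

/-- For a neighbour `w` of a vertex `v`: the subset of `E` displayed by the component of `T - v`
that contains `w`, i.e. the component of the vertices joined to `w` by a walk avoiding `v`. -/
def branch (v w : T.V) : Set α :=
  T.bagUnion {x | ∃ p : T.graph.Walk w x, v ∉ p.support}

/-- The partition of `E` displayed by a non-bag vertex `v`, listed in the cyclic order given by an
enumeration `e` of the neighbours of `v` (equivalently, of the edges incident with `v`). -/
def petals (v : T.V) {n : ℕ} (e : Fin n ≃ T.graph.neighborSet v) : Fin n → Set α :=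
  fun i => T.branch v (e i)

end LabelledTree

section Trees

variable (K : ConnSystem α) (k : ℕ) (𝒯 𝒮 : Set (Set α))

/-- The `k`-separation `(X, E - X)` is displayed by `T`: it is displayed by an edge or by a
`k`-flower vertex. (Which separations a flower displays does not depend on the order of its
petals.) -/
def TreeDisplays (T : LabelledTree K.E) (X : Set α) : Prop :=
  K.KSep k X ∧
    ((∃ v w, T.graph.Adj v w ∧ X = T.edgeSide v w) ∨
      ∃ v, ¬ (T.label v).IsBag ∧ ∃ (n : ℕ) (e : Fin n ≃ T.graph.neighborSet v),
        IsFlower K k 𝒯 (T.petals v e) ∧ FlowerDisplays K k (T.petals v e) X)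

/-- The `𝒯`-strong `k`-separation `(X, E - X)` conforms with `T`. -/
def Conforms (T : LabelledTree K.E) (X : Set α) : Prop :=
  (∃ Y, EquivSep K k 𝒯 X Y ∧ TreeDisplays K k 𝒯 T Y) ∨
    ∃ Y, EquivSep K k 𝒯 X Y ∧
      ∃ v B, T.label v = .bag B ∧ (Y ⊆ B ∨ K.E \ Y ⊆ B)

/-- `T` is a partial `(k, 𝒮)`-tree for `𝒯`. That each non-bag vertex is labelled `D` or `A` is
part of `VertexLabel`. The cyclic ordering of the edges incident with a vertex labelled `D` is
given by an enumeration of its neighbours; for a vertex labelled `A` the enumeration is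
immaterial. -/
structure IsPartialTree (T : LabelledTree K.E) : Prop where
  strongSep_edge : ∀ v w, T.graph.Adj v w → StrongSep K k 𝒯 (T.edgeSide v w)
  sSep_edge : ∀ v w, T.graph.Adj v w → (T.label v).IsBag → (T.label w).IsBag →
    SSep K k 𝒮 (T.edgeSide v w)
  anemone : ∀ v, T.label v = .A → ∃ (n : ℕ) (e : Fin n ≃ T.graph.neighborSet v),
    IsAnemone K k 𝒯 (T.petals v e) ∧ 3 ≤ sOrder K k 𝒯 𝒮 (T.petals v e) ∧
      ∀ i, ¬ LoosePetal K k 𝒯 (T.petals v e) i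
  daisy : ∀ v, T.label v = .D → ∃ (n : ℕ) (e : Fin n ≃ T.graph.neighborSet v),
    IsDaisy K k 𝒯 (T.petals v e) ∧ 3 ≤ sOrder K k 𝒯 𝒮 (T.petals v e) ∧
      ∀ i, ¬ LoosePetal K k 𝒯 (T.petals v e) i
  conforms : ∀ X, SSep K k 𝒮 X → Conforms K k 𝒯 T X

/-- The quasi-order on partial `(k, 𝒮)`-trees: each `(k, 𝒮)`-separation displayed by `T` is
`𝒯`-equivalent to a `(k, 𝒮)`-separation displayed by `T'`. -/
def TreeLE (T T' : LabelledTree K.E) : Prop :=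
  ∀ X, SSep K k 𝒮 X → TreeDisplays K k 𝒯 T X →
    ∃ Y, SSep K k 𝒮 Y ∧ TreeDisplays K k 𝒯 T' Y ∧ EquivSep K k 𝒯 X Y

/-- `T` is an `𝒮`-maximal partial `(k, 𝒮)`-tree for `𝒯`. -/
def IsMaximalPartialSTree (T : LabelledTree K.E) : Prop :=
  IsPartialTree K k 𝒯 𝒮 T ∧
    ∀ T' : LabelledTree K.E, IsPartialTree K k 𝒯 𝒮 T' →
      TreeLE K k 𝒯 𝒮 T T' → TreeLE K k 𝒯 𝒮 T' T

/-- `T` is a maximal partial `k`-tree for `𝒯`: the case where the `(k, 𝒮)`-separations are the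
non-sequential `k`-separations. -/
def IsMaximalPartialTree (T : LabelledTree K.E) : Prop :=
  IsMaximalPartialSTree K k 𝒯 (nonSequentialSets K k 𝒯) T

end Trees

end TangleTree

namespace TangleTree

universe u

variable {α : Type u}

/-! ### Tangles closed under subsets, and uncrossing -/

section

/-! Measure a set by its rank in the loosely vertical case and by its cardinality in the strict
case, and call it small if its measure is at most `k - 2`. The small sets form a tangle closed under
subsets, so weak means small, and `8 * (k - 2) < 8 * k - 15` shows that no eight weak sets cover `E`
(`IsSize.robustIdeal`). Every tangle of order `k` contains all small sets, by induction on their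
number of elements, and hence is this one (`RobustIdeal.eq_of_isTangle`). The argument about trees
uses only the properties collected in `RobustIdeal`. Its basic tool is uncrossing: a strong set with
strong complement has connectivity at least `k`, so submodularity makes unions and intersections of
`k`-separating sets `k`-separating.

Suppose a maximal partial tree `T` misses a non-sequential separation. By conformity some missed
separation has a side in a bag `B`; take such a side `X` with largest full closure. Among the
flowers that display a separation equivalent to `X` and keep `E \ B` within one petal, take one that
displays the most non-sequential classes and, subject to that, has the fewest petals
(`OptimalFlower`). Grafting it onto the vertex of `B`, as an edge for two petals and as a flower
vertex otherwise, gives a tree that displays all that `T` does and also the class of `X`. Once this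
tree is shown to be a partial tree, the maximality of `T` is contradicted
(`IsMaximalPartialTree.exists_treeDisplays`). Loose petals could be merged
(`IsFlower.exists_merge`), so there are none; every flower is an anemone or a daisy
(`IsFlower.isAnemone_or_isDaisy`); what remains is conformity.

The heart is `OptimalFlower.conforms`: a non-sequential `Z` avoiding `E \ B` is equivalent to a
displayed separation or to one with a side inside a petal. Otherwise choose `Z` in its class so that
it cuts as few petals as possible. A `k`-separating union of petals that contains a cut petal is
then cut into two strong or two weak pieces. If every cut petal is cut into strong pieces, the
flower can be refined to display `Z` (`Splittable.exists_refinement`), against optimality. If some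
petal is cut into weak pieces, then, since it is not loose, all petals but one lie in three blocks
each cut into two weak pieces. Either the exceptional petal is also cut into weak pieces and eight
weak sets cover `E`, or the flower displays nothing more than that one petal against the rest, and
`Z` refines this two-petal flower.

Conformity with the grafted tree needs one more argument, when the side inside a petal is `E \ Z`
and that petal reaches outside `B`. Then the full closure of `Z` contains that of `X`, and the
choice of `X` makes the two equivalent unless `T` displayed `Z` already (`IsExtension.conforms`). -/

/-- A tangle that is closed under taking subsets and no eight members of which cover the ground
set. The weak sets are then exactly the members. -/
structure RobustIdeal (K : ConnSystem α) (k : ℕ) (𝒯 : Set (Set α)) : Prop where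
  subset_ground : ∀ A ∈ 𝒯, A ⊆ K.E
  mono : ∀ A ∈ 𝒯, ∀ B ⊆ A, B ∈ 𝒯
  empty_mem : ∅ ∈ 𝒯
  lam_lt : ∀ A ∈ 𝒯, K.lam A < (k : ℤ)
  mem_or_compl_mem : ∀ A ⊆ K.E, K.lam A ≤ (k : ℤ) - 1 → A ∈ 𝒯 ∨ K.E \ A ∈ 𝒯
  not_cover : ∀ f : Fin 8 → Set α, (∀ i, f i ∈ 𝒯) → ¬ K.E ⊆ ⋃ i, f i

namespace RobustIdeal

variable {K : ConnSystem α} {k : ℕ} {𝒯 : Set (Set α)} (h : RobustIdeal K k 𝒯)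
include h

theorem weak_iff {X : Set α} : Weak 𝒯 X ↔ X ∈ 𝒯 :=
  ⟨fun ⟨A, hA, hX⟩ => h.mono A hA X hX, fun hX => ⟨X, hX, Subset.rfl⟩⟩

omit h in
theorem _root_.TangleTree.Weak.mono {X Y : Set α} (hY : Weak 𝒯 Y) (hXY : X ⊆ Y) : Weak 𝒯 X :=
  let ⟨A, hA, hYA⟩ := hY
  ⟨A, hA, hXY.trans hYA⟩

omit h in
theorem _root_.TangleTree.Strong.mono {X Y : Set α} (hX : Strong 𝒯 X) (hXY : X ⊆ Y) :
    Strong 𝒯 Y := fun hY => hX (hY.mono hXY)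

theorem weak_empty : Weak 𝒯 ∅ := h.weak_iff.2 h.empty_mem

theorem weak_subset {X : Set α} (hX : Weak 𝒯 X) : X ⊆ K.E := h.subset_ground X (h.weak_iff.1 hX)

theorem strong_nonempty {X : Set α} (hX : Strong 𝒯 X) : X.Nonempty := by
  rw [nonempty_iff_ne_empty]
  rintro rfl
  exact hX h.weak_empty

theorem not_cover_eight {A B C D A' B' C' D' : Set α} (hA : Weak 𝒯 A) (hB : Weak 𝒯 B)
    (hC : Weak 𝒯 C) (hD : Weak 𝒯 D) (hA' : Weak 𝒯 A') (hB' : Weak 𝒯 B') (hC' : Weak 𝒯 C')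
    (hD' : Weak 𝒯 D') : ¬ K.E ⊆ (A ∪ B ∪ C ∪ D) ∪ (A' ∪ B' ∪ C' ∪ D') := by
  intro hE
  refine h.not_cover ![A, B, C, D, A', B', C', D'] ?_ ?_
  · intro i
    rw [← h.weak_iff]
    fin_cases i <;> assumption
  · intro x hx
    rw [mem_iUnion]
    rcases hE hx with (((hx | hx) | hx) | hx) | (((hx | hx) | hx) | hx)
    exacts [⟨0, hx⟩, ⟨1, hx⟩, ⟨2, hx⟩, ⟨3, hx⟩, ⟨4, hx⟩, ⟨5, hx⟩, ⟨6, hx⟩, ⟨7, hx⟩]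

theorem not_cover_two {A B : Set α} (hA : Weak 𝒯 A) (hB : Weak 𝒯 B) : ¬ K.E ⊆ A ∪ B := by
  intro hE
  exact h.not_cover_eight hA hB hA hA hA hA hA hA (by grind)

theorem strong_ground : Strong 𝒯 K.E := fun hE => h.not_cover_two hE hE (by simp)

theorem strong_compl {X : Set α} (hX : Weak 𝒯 X) : Strong 𝒯 (K.E \ X) := fun hc =>
  h.not_cover_two hX hc (by grind)

omit h in
theorem _root_.TangleTree.ConnSystem.KSep.compl {X : Set α} (hX : K.KSep k X) :
    K.KSep k (K.E \ X) :=
  ⟨sdiff_subset, K.symmetric X hX.1 ▸ hX.2⟩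

theorem kSep_of_weak {X : Set α} (hX : Weak 𝒯 X) : K.KSep k X :=
  ⟨h.weak_subset hX, (h.lam_lt X (h.weak_iff.1 hX)).le⟩

theorem kSep_ground : K.KSep k K.E := by
  simpa using (h.kSep_of_weak h.weak_empty).compl

/-- A smaller connectivity would put one of the two sides into the tangle. This lower bound is what
makes every uncrossing below work. -/
theorem le_lam {X : Set α} (hXE : X ⊆ K.E) (hX : Strong 𝒯 X) (hX' : Strong 𝒯 (K.E \ X)) :
    (k : ℤ) ≤ K.lam X := by
  by_contra hlt
  rcases h.mem_or_compl_mem X hXE (by omega) with hm | hm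
  · exact hX (h.weak_iff.2 hm)
  · exact hX' (h.weak_iff.2 hm)

theorem kSep_union {X Y : Set α} (hX : K.KSep k X) (hY : K.KSep k Y) (hs : Strong 𝒯 (X ∩ Y))
    (hs' : Strong 𝒯 (K.E \ (X ∩ Y))) : K.KSep k (X ∪ Y) := by
  have h1 := K.submodular X hX.1 Y hY.1
  have h2 := h.le_lam (inter_subset_left.trans hX.1) hs hs'
  exact ⟨union_subset hX.1 hY.1, by linarith [hX.2, hY.2]⟩

theorem kSep_inter {X Y : Set α} (hX : K.KSep k X) (hY : K.KSep k Y) (hs : Strong 𝒯 (X ∪ Y))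
    (hs' : Strong 𝒯 (K.E \ (X ∪ Y))) : K.KSep k (X ∩ Y) := by
  have h1 := K.submodular X hX.1 Y hY.1
  have h2 := h.le_lam (union_subset hX.1 hY.1) hs hs'
  exact ⟨inter_subset_left.trans hX.1, by linarith [hX.2, hY.2]⟩

theorem kSep_diff {X Y : Set α} (hX : K.KSep k X) (hY : K.KSep k Y) (hs : Strong 𝒯 X)
    (hs' : Strong 𝒯 (Y \ X)) : K.KSep k (X \ Y) := by
  have hXE := hX.1
  have hYE := hY.1
  have := h.kSep_inter hX hY.compl (hs.mono subset_union_left) (hs'.mono (by grind))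
  rwa [show X ∩ (K.E \ Y) = X \ Y by grind] at this

/-! ### Full closures -/

theorem fullyClosed_ground : FullyClosed K k 𝒯 K.E := by
  refine ⟨h.kSep_ground, h.strong_ground, fun Y hY hne _ => ?_⟩
  simp only [sdiff_self, subset_empty_iff] at hY
  exact absurd hY hne.ne_empty

theorem strong_compl_of_fullyClosed {F : Set α} (hF : FullyClosed K k 𝒯 F) (hne : F ≠ K.E) :
    Strong 𝒯 (K.E \ F) := by
  intro hw
  have hFE := hF.1.1
  refine hF.2.2 (K.E \ F) Subset.rfl ?_ hw ?_
  · rw [nonempty_iff_ne_empty]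
    intro h0
    exact hne (Subset.antisymm hFE (sdiff_eq_empty.1 h0))
  · rw [union_sdiff_cancel hFE]
    exact h.kSep_ground

/-- Uncross `F` with `X ∪ Y`: their intersection contains the strong set `X`, so `F ∪ Y` is
`k`-separating, and `F` admits no weak enlargement. -/
theorem subset_of_fullyClosed {F X Y : Set α} (hF : FullyClosed K k 𝒯 F) (hXF : X ⊆ F)
    (hX : Strong 𝒯 X) (hXY : K.KSep k (X ∪ Y)) (hY : Weak 𝒯 Y) : Y ⊆ F := by
  have hFE := hF.1.1
  have hYE := h.weak_subset hY
  by_cases hne : F = K.E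
  · rwa [hne]
  have hs := h.strong_compl_of_fullyClosed hF hne
  have hu := h.kSep_union hF.1 hXY (hX.mono (by grind)) (hs.mono (by grind))
  rw [show F ∪ (X ∪ Y) = F ∪ (Y \ F) by grind] at hu
  by_contra hYF
  exact hF.2.2 (Y \ F) (by grind) (sdiff_nonempty.2 hYF) (hY.mono sdiff_subset) hu

omit h in
theorem _root_.TangleTree.subset_fcl (X : Set α) : X ⊆ fcl K k 𝒯 X :=
  subset_sInter fun _ hF => hF.2

omit h in
theorem _root_.TangleTree.fcl_subset_of_fullyClosed {X F : Set α} (hF : FullyClosed K k 𝒯 F)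
    (hX : X ⊆ F) : fcl K k 𝒯 X ⊆ F := sInter_subset_of_mem ⟨hF, hX⟩

omit h in
theorem _root_.TangleTree.fcl_mono {X Y : Set α} (hXY : X ⊆ Y) : fcl K k 𝒯 X ⊆ fcl K k 𝒯 Y :=
  subset_sInter fun _ hF => sInter_subset_of_mem ⟨hF.1, hXY.trans hF.2⟩

theorem fcl_subset_ground {X : Set α} (hX : X ⊆ K.E) : fcl K k 𝒯 X ⊆ K.E :=
  fcl_subset_of_fullyClosed h.fullyClosed_ground hX

theorem subset_fcl_of_weak {X Y : Set α} (hX : Strong 𝒯 X) (hY : Weak 𝒯 Y)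
    (hXY : K.KSep k (X ∪ Y)) : Y ⊆ fcl K k 𝒯 X :=
  subset_sInter fun _ hF => h.subset_of_fullyClosed hF.1 hF.2 hX hXY hY

/-- The full closure is reached by successively adjoining weak sets. -/
theorem fcl_induction {X : Set α} (hX : K.KSep k X) (hs : Strong 𝒯 X) (p : Set α → Prop)
    (h0 : p X) (step : ∀ Z Y, X ⊆ Z → Z ∪ Y ⊆ fcl K k 𝒯 X → K.KSep k Z → K.KSep k (Z ∪ Y) →
      Weak 𝒯 Y → p Z → p (Z ∪ Y)) :
    p (fcl K k 𝒯 X) ∧ FullyClosed K k 𝒯 (fcl K k 𝒯 X) := by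
  let C : Set (Set α) := {Z | X ⊆ Z ∧ Z ⊆ fcl K k 𝒯 X ∧ K.KSep k Z ∧ p Z}
  have hfin : C.Finite := K.finite_E.finite_subsets.subset fun Z hZ => hZ.2.2.1.1
  obtain ⟨Z, hZ⟩ := hfin.exists_maximal ⟨X, Subset.rfl, subset_fcl X, hX, h0⟩
  obtain ⟨hXZ, hZf, hZk, hpZ⟩ := hZ.prop
  have hclosed : FullyClosed K k 𝒯 Z := by
    refine ⟨hZk, hs.mono hXZ, fun Y hYE hne hY hk => ?_⟩
    -- A weak set that can be adjoined to `Z` lies in every fully closed set containing `X`, so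
    -- adjoining it stays in `C` and contradicts maximality.
    have hYf : Y ⊆ fcl K k 𝒯 X := subset_sInter fun F hF =>
      h.subset_of_fullyClosed hF.1 (hZf.trans (sInter_subset_of_mem hF)) (hs.mono hXZ) hk hY
    have hle := hZ.le_of_ge (y := Z ∪ Y) ⟨hXZ.trans subset_union_left, union_subset hZf hYf, hk,
      step Z Y hXZ (union_subset hZf hYf) hZk hk hY hpZ⟩ subset_union_left
    obtain ⟨y, hy⟩ := hne
    exact (hYE hy).2 (hle (Or.inr hy))
  have heq : fcl K k 𝒯 X = Z := Subset.antisymm (fcl_subset_of_fullyClosed hclosed hXZ) hZf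
  rw [heq]
  exact ⟨hpZ, hclosed⟩

theorem fullyClosed_fcl {X : Set α} (hX : K.KSep k X) (hs : Strong 𝒯 X) :
    FullyClosed K k 𝒯 (fcl K k 𝒯 X) :=
  (h.fcl_induction hX hs (fun _ => True) trivial fun _ _ _ _ _ _ _ _ => trivial).2

theorem fcl_eq_of_subset {X Y : Set α} (hX : K.KSep k X) (hs : Strong 𝒯 X) (hXY : X ⊆ Y)
    (hY : Y ⊆ fcl K k 𝒯 X) : fcl K k 𝒯 Y = fcl K k 𝒯 X :=
  Subset.antisymm (fcl_subset_of_fullyClosed (h.fullyClosed_fcl hX hs) hY) (fcl_mono hXY)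

theorem fcl_subset_fcl {X Y : Set α} (hX : K.KSep k X) (hs : Strong 𝒯 X)
    (hY : Y ⊆ fcl K k 𝒯 X) : fcl K k 𝒯 Y ⊆ fcl K k 𝒯 X :=
  fcl_subset_of_fullyClosed (h.fullyClosed_fcl hX hs) hY

/-- Each weak set adjoined on the way to `fcl X` can be adjoined back to what is left of the
complement, which stays strong throughout. Hence the full closure of one side determines that of the
other. -/
theorem fcl_compl_fcl {X : Set α} (hX : K.KSep k X) (hs : Strong 𝒯 X)
    (hne : fcl K k 𝒯 X ≠ K.E) :
    fcl K k 𝒯 (K.E \ fcl K k 𝒯 X) = fcl K k 𝒯 (K.E \ X) := by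
  have hsc := h.strong_compl_of_fullyClosed (h.fullyClosed_fcl hX hs) hne
  refine Subset.antisymm (fcl_mono (sdiff_subset_sdiff_right (subset_fcl X))) ?_
  refine (h.fcl_induction hX hs
    (fun Z => fcl K k 𝒯 (K.E \ X) ⊆ fcl K k 𝒯 (K.E \ Z)) Subset.rfl ?_).1
  intro Z Y hXZ hZf hZ hZY hY ih
  refine ih.trans ?_
  have hs' : Strong 𝒯 (K.E \ (Z ∪ Y)) := hsc.mono (sdiff_subset_sdiff_right hZf)
  apply h.fcl_subset_fcl hZY.compl hs'
  have hu : K.E \ (Z ∪ Y) ∪ (Y \ Z) = K.E \ Z := by have := hZY.1; grind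
  have := h.subset_fcl_of_weak hs' (hY.mono (sdiff_subset (t := Z))) (by rw [hu]; exact hZ.compl)
  have h2 := subset_fcl (K := K) (k := k) (𝒯 := 𝒯) (K.E \ (Z ∪ Y))
  rw [← hu]
  exact union_subset h2 this

/-! ### Non-sequential separations -/

omit h in
variable (K k 𝒯) in
/-- `(X, E - X)` is a non-sequential `k`-separation, in unfolded form. -/
structure _root_.TangleTree.NonSeq (X : Set α) : Prop where
  kSep : K.KSep k X
  strong : Strong 𝒯 X
  strong_compl : Strong 𝒯 (K.E \ X)
  fcl_ne : fcl K k 𝒯 X ≠ K.E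
  fcl_compl_ne : fcl K k 𝒯 (K.E \ X) ≠ K.E

/-- The point is that both sides are strong: a weak set can be adjoined to its complement in one
step, so it would be sequential. -/
theorem nonSeq_iff_nonSequentialSep {X : Set α} :
    NonSequentialSep K k 𝒯 X ↔ NonSeq K k 𝒯 X := by
  constructor
  · rintro ⟨hX, hn⟩
    have hXE := hX.1
    have hcc : K.E \ (K.E \ X) = X := sdiff_sdiff_cancel_left hXE
    have key : ∀ Y, K.KSep k Y → Weak 𝒯 Y → fcl K k 𝒯 (K.E \ Y) = K.E := by
      intro Y hY hw
      refine Subset.antisymm (h.fcl_subset_ground sdiff_subset) ?_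
      have hu : K.E \ Y ∪ Y = K.E := by have := hY.1; grind
      have := h.subset_fcl_of_weak (h.strong_compl hw) hw (by rw [hu]; exact h.kSep_ground)
      rw [← hu]
      exact union_subset (by rw [hu]; exact subset_fcl _) (by rw [hu]; exact this)
    have s1 : Strong 𝒯 X := fun hw =>
      hn (Or.inl ⟨hX, h.strong_compl hw, key X hX hw⟩)
    have s2 : Strong 𝒯 (K.E \ X) := fun hw =>
      hn (Or.inr ⟨hX.compl, h.strong_compl hw, key _ hX.compl hw⟩)
    exact ⟨hX, s1, s2, fun he => hn (Or.inr ⟨hX.compl, by rwa [hcc], by rwa [hcc]⟩),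
      fun he => hn (Or.inl ⟨hX, s2, he⟩)⟩
  · intro hX
    refine ⟨hX.kSep, ?_⟩
    rintro (hs | hs)
    · exact hX.fcl_compl_ne hs.2.2
    · have := hs.2.2
      rw [sdiff_sdiff_cancel_left hX.kSep.1] at this
      exact hX.fcl_ne this

theorem sSep_iff {X : Set α} : SSep K k (nonSequentialSets K k 𝒯) X ↔ NonSeq K k 𝒯 X := by
  constructor
  · rintro ⟨hX, h1, h2⟩
    exact h.nonSeq_iff_nonSequentialSep.1 ⟨hX, fun ho => ho.elim h1.2.1 h2.2.1⟩
  · intro hX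
    have := h.nonSeq_iff_nonSequentialSep.2 hX
    refine ⟨hX.kSep, ⟨hX.kSep, fun hs => this.2 (Or.inl hs), hX.strong_compl⟩,
      ⟨hX.kSep.compl, fun hs => this.2 (Or.inr hs), ?_⟩⟩
    rw [sdiff_sdiff_cancel_left hX.kSep.1]
    exact hX.strong

omit h in
theorem _root_.TangleTree.NonSeq.compl {X : Set α} (hX : NonSeq K k 𝒯 X) :
    NonSeq K k 𝒯 (K.E \ X) := by
  have hcc := sdiff_sdiff_cancel_left hX.kSep.1
  exact ⟨hX.kSep.compl, hX.strong_compl, by rw [hcc]; exact hX.strong, hX.fcl_compl_ne,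
    by rw [hcc]; exact hX.fcl_ne⟩

omit h in
theorem _root_.TangleTree.NonSeq.strongSep {X : Set α} (hX : NonSeq K k 𝒯 X) :
    StrongSep K k 𝒯 X := ⟨hX.kSep, hX.strong, hX.strong_compl⟩

omit h in
theorem _root_.TangleTree.StrongSep.compl {X : Set α} (hX : StrongSep K k 𝒯 X) :
    StrongSep K k 𝒯 (K.E \ X) :=
  ⟨hX.1.compl, hX.2.2, by rw [sdiff_sdiff_cancel_left hX.1.1]; exact hX.2.1⟩

omit h in
theorem _root_.TangleTree.StrongSep.equivSep {X : Set α} (hX : StrongSep K k 𝒯 X) :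
    EquivSep K k 𝒯 X X := ⟨hX, hX, Or.inl ⟨rfl, rfl⟩⟩

omit h in
theorem _root_.TangleTree.EquivSep.symm {X Y : Set α} (he : EquivSep K k 𝒯 X Y) :
    EquivSep K k 𝒯 Y X := by
  obtain ⟨h1, h2, h3⟩ := he
  refine ⟨h2, h1, ?_⟩
  rcases h3 with ⟨a, b⟩ | ⟨a, b⟩
  · exact Or.inl ⟨a.symm, b.symm⟩
  · exact Or.inr ⟨b.symm, a.symm⟩

omit h in
theorem _root_.TangleTree.EquivSep.trans {X Y Z : Set α} (he : EquivSep K k 𝒯 X Y)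
    (he' : EquivSep K k 𝒯 Y Z) : EquivSep K k 𝒯 X Z := by
  obtain ⟨h1, -, h3⟩ := he
  obtain ⟨-, h2, h4⟩ := he'
  refine ⟨h1, h2, ?_⟩
  rcases h3 with ⟨a, b⟩ | ⟨a, b⟩ <;> rcases h4 with ⟨c, d⟩ | ⟨c, d⟩
  · exact Or.inl ⟨a.trans c, b.trans d⟩
  · exact Or.inr ⟨a.trans c, b.trans d⟩
  · exact Or.inr ⟨a.trans d, b.trans c⟩
  · exact Or.inl ⟨a.trans d, b.trans c⟩

omit h in
theorem _root_.TangleTree.StrongSep.equivSep_compl {X : Set α} (hX : StrongSep K k 𝒯 X) :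
    EquivSep K k 𝒯 X (K.E \ X) :=
  ⟨hX, hX.compl, Or.inr ⟨by rw [sdiff_sdiff_cancel_left hX.1.1], rfl⟩⟩

omit h in
theorem _root_.TangleTree.NonSeq.of_equivSep {X Y : Set α} (hX : NonSeq K k 𝒯 X)
    (he : EquivSep K k 𝒯 X Y) : NonSeq K k 𝒯 Y := by
  obtain ⟨-, h2, h3⟩ := he
  rcases h3 with ⟨a, b⟩ | ⟨a, b⟩
  · exact ⟨h2.1, h2.2.1, h2.2.2, a ▸ hX.fcl_ne, b ▸ hX.fcl_compl_ne⟩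
  · exact ⟨h2.1, h2.2.1, h2.2.2, b ▸ hX.fcl_compl_ne, a ▸ hX.fcl_ne⟩

theorem equivSep_of_fcl_eq {X Y : Set α} (hX : NonSeq K k 𝒯 X) (hY : K.KSep k Y)
    (hs : Strong 𝒯 Y) (he : fcl K k 𝒯 Y = fcl K k 𝒯 X) : EquivSep K k 𝒯 X Y := by
  have hs' : Strong 𝒯 (K.E \ Y) :=
    (h.strong_compl_of_fullyClosed (h.fullyClosed_fcl hX.kSep hX.strong) hX.fcl_ne).mono
      (sdiff_subset_sdiff_right (he ▸ subset_fcl Y))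
  refine ⟨hX.strongSep, ⟨hY, hs, hs'⟩, Or.inl ⟨he.symm, ?_⟩⟩
  rw [← h.fcl_compl_fcl hX.kSep hX.strong hX.fcl_ne, ← he,
    h.fcl_compl_fcl hY hs (he ▸ hX.fcl_ne)]

/-- A non-sequential separating set is not the union of two weak sets. -/
theorem not_subset_union {X A B : Set α} (hX : NonSeq K k 𝒯 X) (hA : Weak 𝒯 A) (hB : Weak 𝒯 B) :
    ¬ X ⊆ A ∪ B := by
  intro hsub
  have hXE := hX.kSep.1
  have w1 : Weak 𝒯 (X ∩ A) := hA.mono inter_subset_right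
  have w2 : Weak 𝒯 (X \ A) := hB.mono (by grind)
  -- Weak sets are themselves `k`-separating, hence so is the complement of `X \ A`. Thus `E \ X`
  -- absorbs `X ∩ A` first and `X \ A` second, and its closure is `E`.
  have k1 : K.KSep k (K.E \ X ∪ X ∩ A) := by
    have := (h.kSep_of_weak w2).compl
    rwa [show K.E \ (X \ A) = K.E \ X ∪ X ∩ A by grind] at this
  have s1 := h.subset_fcl_of_weak hX.strong_compl w1 k1
  have hf := h.fullyClosed_fcl hX.kSep.compl hX.strong_compl
  have s2 : X \ A ⊆ fcl K k 𝒯 (K.E \ X) := by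
    refine h.subset_of_fullyClosed hf (union_subset (subset_fcl _) s1)
      (hX.strong_compl.mono subset_union_left) ?_ w2
    rw [show K.E \ X ∪ X ∩ A ∪ X \ A = K.E by grind]
    exact h.kSep_ground
  refine hX.fcl_compl_ne (Subset.antisymm (h.fcl_subset_ground sdiff_subset) ?_)
  have s3 := subset_fcl (K := K) (k := k) (𝒯 := 𝒯) (K.E \ X)
  grind

theorem equivSep_union {Z W : Set α} (hZ : NonSeq K k 𝒯 Z) (hW : Weak 𝒯 W)
    (hk : K.KSep k (Z ∪ W)) : EquivSep K k 𝒯 Z (Z ∪ W) :=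
  h.equivSep_of_fcl_eq hZ hk (hZ.strong.mono subset_union_left)
    (h.fcl_eq_of_subset hZ.kSep hZ.strong subset_union_left
      (union_subset (subset_fcl Z) (h.subset_fcl_of_weak hZ.strong hW hk)))

/-- Removing a weak part of `Z` is the same as adjoining it to `E \ Z`. -/
theorem equivSep_diff {Z W : Set α} (hZ : NonSeq K k 𝒯 Z) (hW : Weak 𝒯 (Z ∩ W))
    (hk : K.KSep k (Z \ W)) : EquivSep K k 𝒯 Z (Z \ W) := by
  have hZE := hZ.kSep.1
  have e : K.E \ Z ∪ Z ∩ W = K.E \ (Z \ W) := by grind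
  have := h.equivSep_union hZ.compl hW (by rw [e]; exact hk.compl)
  rw [e] at this
  have h2 := this.2.1.compl
  have h3 := this.2.1.equivSep_compl
  rw [sdiff_sdiff_cancel_left hk.1] at h3
  exact hZ.strongSep.equivSep_compl.trans (this.trans h3)

end RobustIdeal

end

section

/-! ### Unions of petals -/

section PetalUnion

variable {n : ℕ} {P : Fin n → Set α}

theorem mem_petalUnion {I : Set (Fin n)} {x : α} : x ∈ petalUnion P I ↔ ∃ i ∈ I, x ∈ P i := by
  simp [petalUnion]

theorem petalUnion_union (I J : Set (Fin n)) :
    petalUnion P (I ∪ J) = petalUnion P I ∪ petalUnion P J := biUnion_union I J P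

theorem petalUnion_singleton (i : Fin n) : petalUnion P {i} = P i := by simp [petalUnion]

theorem petalUnion_pair (i j : Fin n) : petalUnion P {i, j} = P i ∪ P j := by simp [petalUnion]

theorem petalUnion_empty : petalUnion P ∅ = ∅ := by simp [petalUnion]

theorem subset_petalUnion {I : Set (Fin n)} {i : Fin n} (hi : i ∈ I) : P i ⊆ petalUnion P I :=
  fun _ hx => mem_petalUnion.2 ⟨i, hi, hx⟩

theorem petalUnion_comp {m : ℕ} (σ : Fin m ≃ Fin n) (I : Set (Fin m)) :
    petalUnion (P ∘ σ) I = petalUnion P (σ '' I) := (biUnion_image (f := σ) (g := P)).symm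

end PetalUnion

theorem cycSucc_eq {m : ℕ} (i : Fin (m + 1)) : cycSucc i = i + 1 := by
  apply Fin.ext
  rcases Nat.eq_zero_or_pos m with rfl | hm
  · simp [cycSucc]
  · simp [cycSucc, Fin.val_add]

namespace IsFlower

variable {K : ConnSystem α} {k : ℕ} {𝒯 : Set (Set α)} {n : ℕ} {P : Fin n → Set α}
  (hP : IsFlower K k 𝒯 P)
include hP

theorem index_eq {i j : Fin n} {x : α} (hi : x ∈ P i) (hj : x ∈ P j) : i = j := by
  by_contra hne
  exact (hP.disjoint hne).le_bot ⟨hi, hj⟩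

theorem exists_mem {x : α} (hx : x ∈ K.E) : ∃ i, x ∈ P i := by
  rw [← hP.union_eq] at hx
  simpa using hx

theorem petal_subset (i : Fin n) : P i ⊆ K.E := (hP.kSep i).1

theorem petalUnion_inter (I J : Set (Fin n)) :
    petalUnion P (I ∩ J) = petalUnion P I ∩ petalUnion P J := by
  ext x
  simp only [mem_petalUnion, mem_inter_iff]
  constructor
  · rintro ⟨i, ⟨h1, h2⟩, hx⟩
    exact ⟨⟨i, h1, hx⟩, ⟨i, h2, hx⟩⟩
  · rintro ⟨⟨i, h1, hx⟩, ⟨j, h2, hy⟩⟩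
    obtain rfl := hP.index_eq hx hy
    exact ⟨i, ⟨h1, h2⟩, hx⟩

theorem petalUnion_compl (I : Set (Fin n)) : petalUnion P Iᶜ = K.E \ petalUnion P I := by
  ext x
  simp only [mem_petalUnion, mem_sdiff]
  constructor
  · rintro ⟨i, hi, hx⟩
    refine ⟨hP.petal_subset i hx, ?_⟩
    rintro ⟨j, hj, hy⟩
    obtain rfl := hP.index_eq hx hy
    exact hi hj
  · rintro ⟨hx, hn⟩
    obtain ⟨i, hi⟩ := hP.exists_mem hx
    exact ⟨i, fun hI => hn ⟨i, hI, hi⟩, hi⟩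

theorem petalUnion_univ : petalUnion P univ = K.E := by
  have := hP.petalUnion_compl ∅
  simpa [petalUnion_empty] using this

theorem strong_petalUnion {I : Set (Fin n)} (hI : I.Nonempty) : Strong 𝒯 (petalUnion P I) :=
  let ⟨i, hi⟩ := hI
  (hP.strong i).mono (subset_petalUnion hi)

theorem flowerDisplays_compl {X : Set α} (hX : FlowerDisplays K k P X) :
    FlowerDisplays K k P (K.E \ X) := by
  obtain ⟨hk, I, rfl⟩ := hX
  exact ⟨hk.compl, Iᶜ, (hP.petalUnion_compl I).symm⟩

theorem kSep_compl {I : Set (Fin n)} (hI : K.KSep k (petalUnion P I)) :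
    K.KSep k (petalUnion P Iᶜ) := by
  rw [hP.petalUnion_compl]
  exact hI.compl

variable (h : RobustIdeal K k 𝒯)
include h

theorem petal_nonempty (i : Fin n) : (P i).Nonempty := h.strong_nonempty (hP.strong i)

theorem kSep_univ : K.KSep k (petalUnion P univ) := by
  rw [hP.petalUnion_univ]
  exact h.kSep_ground

theorem kSep_union {I J : Set (Fin n)} (hI : K.KSep k (petalUnion P I))
    (hJ : K.KSep k (petalUnion P J)) (hne : (I ∩ J).Nonempty) :
    K.KSep k (petalUnion P (I ∪ J)) := by
  by_cases hu : I ∩ J = univ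
  · rw [show I ∪ J = univ from eq_univ_of_univ_subset
      (hu.symm.subset.trans (inter_subset_left.trans subset_union_left))]
    exact hP.kSep_univ h
  · rw [petalUnion_union]
    apply h.kSep_union hI hJ
    · rw [← hP.petalUnion_inter]
      exact hP.strong_petalUnion hne
    · rw [← hP.petalUnion_inter, ← hP.petalUnion_compl]
      exact hP.strong_petalUnion (nonempty_compl.2 hu)

theorem kSep_inter {I J : Set (Fin n)} (hI : K.KSep k (petalUnion P I))
    (hJ : K.KSep k (petalUnion P J)) (hne : (I ∪ J) ≠ univ) :
    K.KSep k (petalUnion P (I ∩ J)) := by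
  have := hP.kSep_compl (hP.kSep_union h (hP.kSep_compl hI) (hP.kSep_compl hJ)
    (by rw [← compl_union]; exact nonempty_compl.2 hne))
  rwa [← compl_inter, compl_compl] at this

/-- Unions of cyclically consecutive petals are `k`-separating. -/
theorem kSep_of_consecutive {I : Set (Fin n)} (hI : Consecutive I) :
    K.KSep k (petalUnion P I) := by
  obtain ⟨a, l, rfl⟩ := hI
  have hn := hP.pos
  induction l with
  | zero =>
    simp only [not_lt_zero, false_and, exists_false, ofPred_false, petalUnion_empty]
    exact h.kSep_of_weak h.weak_empty
  | succ l ih =>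
    rcases Nat.eq_zero_or_pos l with rfl | hl
    · have : {i : Fin n | ∃ j < 0 + 1, i.val = (a.val + j) % n} = {a} := by
        ext i
        simp [Nat.mod_eq_of_lt a.2, Fin.ext_iff]
      rw [this, petalUnion_singleton]
      exact hP.kSep a
    · let b : Fin n := ⟨(a.val + (l - 1)) % n, Nat.mod_lt _ hn⟩
      have hb : (cycSucc b).val = (a.val + l) % n := by
        simp only [cycSucc, b, Nat.mod_add_mod]
        congr 1
        omega
      have hpair : K.KSep k (petalUnion P {b, cycSucc b}) := by
        rw [petalUnion_pair]
        exact hP.kSep_succ b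
      have := hP.kSep_union h ih hpair ⟨b, ⟨l - 1, by omega, rfl⟩, Or.inl rfl⟩
      convert this using 2
      ext i
      simp only [mem_ofPred_eq, mem_union, mem_insert_iff, mem_singleton_iff, Fin.ext_iff, hb]
      constructor
      · rintro ⟨j, hj, hi⟩
        rcases Nat.lt_succ_iff_lt_or_eq.1 hj with hj | rfl
        · exact Or.inl ⟨j, hj, hi⟩
        · exact Or.inr (Or.inr hi)
      · rintro (⟨j, hj, hi⟩ | hi | hi)
        · exact ⟨j, by omega, hi⟩
        · exact ⟨l - 1, by omega, hi⟩
        · exact ⟨l, by omega, hi⟩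

theorem kSep_interval (p q : ℕ) : K.KSep k (petalUnion P {i | p ≤ i.val ∧ i.val ≤ q}) := by
  by_cases hpq : p ≤ q ∧ p < n
  · apply hP.kSep_of_consecutive h
    refine ⟨⟨p, hpq.2⟩, min q (n - 1) - p + 1, ?_⟩
    ext i
    have hi := i.2
    simp only [mem_ofPred_eq]
    constructor
    · rintro ⟨h1, h2⟩
      exact ⟨i.val - p, by omega, by rw [Nat.add_sub_cancel' h1, Nat.mod_eq_of_lt hi]⟩
    · rintro ⟨j, hj, hij⟩
      rw [Nat.mod_eq_of_lt (by omega)] at hij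
      omega
  · have : {i : Fin n | p ≤ i.val ∧ i.val ≤ q} = ∅ := by
      ext i
      have := i.2
      simp only [mem_ofPred_eq, mem_empty_iff_false, iff_false]
      omega
    rw [this, petalUnion_empty]
    exact h.kSep_of_weak h.weak_empty

omit h in
theorem comp {σ : Fin n ≃ Fin n} (hσ : ∀ i, K.KSep k (P (σ i) ∪ P (σ (cycSucc i)))) :
    IsFlower K k 𝒯 (P ∘ σ) where
  pos := hP.pos
  disjoint i j hij := hP.disjoint (σ.injective.ne hij)
  union_eq := by rw [← hP.union_eq]; exact σ.surjective.iUnion_comp P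
  strong i := hP.strong (σ i)
  kSep i := hP.kSep (σ i)
  kSep_succ i := hσ i

omit hP h in
theorem _root_.TangleTree.flowerDisplays_comp {m : ℕ} {σ : Fin m ≃ Fin n} {X : Set α} :
    FlowerDisplays K k (P ∘ σ) X ↔ FlowerDisplays K k P X := by
  refine and_congr_right fun _ => ⟨?_, ?_⟩
  · rintro ⟨I, rfl⟩
    exact ⟨σ '' I, petalUnion_comp σ I⟩
  · rintro ⟨I, rfl⟩
    exact ⟨σ.symm '' I, by rw [petalUnion_comp, Equiv.image_symm_image]⟩

omit hP h in
theorem rotate {m : ℕ} {P : Fin (m + 1) → Set α} (hP : IsFlower K k 𝒯 P) (c : Fin (m + 1)) :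
    IsFlower K k 𝒯 (P ∘ Equiv.addRight c) := by
  apply hP.comp
  intro i
  have := hP.kSep_succ (i + c)
  rw [cycSucc_eq] at *
  simpa [add_right_comm] using this

omit hP h in
theorem reflect {m : ℕ} {P : Fin (m + 1) → Set α} (hP : IsFlower K k 𝒯 P) (c : Fin (m + 1)) :
    IsFlower K k 𝒯 (P ∘ Equiv.subLeft c) := by
  apply hP.comp
  intro i
  have := hP.kSep_succ (c - (i + 1))
  rw [cycSucc_eq] at *
  rw [union_comm]
  simpa [sub_add_eq_sub_sub] using this

/-! ### Anemones and daisies -/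

omit hP in
-- Let `c` be the first positive index in `I`, and `d > c` an index outside `I`; both exist because
-- `I` is not consecutive. Intersecting `I` with the interval from `0` to `c` isolates the pair `{0,
-- c}`; from it come all pairs `{0, x}`, then all sets containing `0` as unions of such pairs, then
-- all others as complements.
theorem forall_kSep_of_zero {m : ℕ} {P : Fin (m + 1) → Set α} (hP : IsFlower K k 𝒯 P)
    {I : Set (Fin (m + 1))} (hI : K.KSep k (petalUnion P I)) (h0 : 0 ∈ I) (h1 : 1 ∉ I)
    (hc : ¬ Consecutive I) (J : Set (Fin (m + 1))) : K.KSep k (petalUnion P J) := by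
  have hm : 0 < m := by
    rcases Nat.eq_zero_or_pos m with rfl | hm
    · exact absurd h0 h1
    · exact hm
  have h1v : (1 : Fin (m + 1)).val = 1 := by
    rw [Fin.val_one']
    exact Nat.mod_eq_of_lt (by omega)
  have hex : ∃ c, 0 < c ∧ ∃ hc : c < m + 1, (⟨c, hc⟩ : Fin (m + 1)) ∈ I := by
    by_contra hno
    push Not at hno
    refine hc ⟨0, 1, ?_⟩
    ext i
    simp only [Nat.lt_one_iff, exists_eq_left, mem_ofPred_eq, Fin.val_zero, Nat.zero_mod, zero_add]
    constructor
    · intro hi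
      by_contra hne
      exact hno i.val (by omega) i.2 hi
    · intro hi
      rwa [show i = 0 from Fin.ext hi]
  classical
  obtain ⟨hc0, hcm, hcI⟩ := Nat.find_spec hex
  have hmin := fun t (ht : t < Nat.find hex) => Nat.find_min hex ht
  generalize Nat.find hex = c at *
  have hc1 : c ≠ 1 := by
    rintro rfl
    exact h1 (by rwa [show (1 : Fin (m + 1)) = ⟨1, hcm⟩ from Fin.ext h1v])
  have hd : ∃ d : Fin (m + 1), c < d.val ∧ d ∉ I := by
    by_contra hno
    push Not at hno
    refine hc ⟨⟨c, hcm⟩, m + 1 - c + 1, ?_⟩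
    ext i
    have hi2 := i.2
    simp only [mem_ofPred_eq]
    constructor
    · intro hi
      rcases Nat.eq_zero_or_pos i.val with hi0 | hi0
      · exact ⟨m + 1 - c, by omega, by rw [hi0, Nat.add_sub_cancel' hcm.le, Nat.mod_self]⟩
      · have : ¬ i.val < c := fun hlt => hmin i.val hlt ⟨hi0, i.2, hi⟩
        exact ⟨i.val - c, by omega,
          by rw [Nat.add_sub_cancel' (by omega), Nat.mod_eq_of_lt i.2]⟩
    · rintro ⟨j, hj, hij⟩
      rcases Nat.lt_or_ge (c + j) (m + 1) with hlt | hge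
      · rw [Nat.mod_eq_of_lt hlt] at hij
        rcases Nat.eq_zero_or_pos j with rfl | hj0
        · rwa [show i = ⟨c, hcm⟩ from Fin.ext hij]
        · exact hno i (by omega)
      · rw [show c + j = m + 1 by omega, Nat.mod_self] at hij
        rwa [show i = 0 from Fin.ext hij]
  obtain ⟨d, hcd, hdI⟩ := hd
  have hpair : K.KSep k (petalUnion P {0, ⟨c, hcm⟩}) := by
    have := hP.kSep_inter h hI (hP.kSep_interval h 0 c) (by
      intro hu
      have : d ∈ I ∪ {i : Fin (m + 1) | 0 ≤ i.val ∧ i.val ≤ c} := hu ▸ mem_univ d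
      simp only [mem_union, mem_ofPred_eq] at this
      rcases this with h' | h'
      · exact hdI h'
      · omega)
    convert this using 2
    ext i
    simp only [mem_insert_iff, mem_singleton_iff, mem_inter_iff, mem_ofPred_eq, Fin.ext_iff,
      Fin.val_zero]
    constructor
    · rintro (hi | hi)
      · exact ⟨by rwa [show i = 0 from Fin.ext hi], by omega, by omega⟩
      · exact ⟨by rwa [show i = ⟨c, hcm⟩ from Fin.ext hi], by omega, by omega⟩
    · rintro ⟨hi, -, hic⟩
      by_contra hno
      push Not at hno
      exact hmin i.val (by omega) ⟨by omega, i.2, hi⟩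
  -- Adjoin the interval between `c` and `x`, then cut away all but `0` and `x`. The index `d` or
  -- `1` stays outside the union, as the second uncrossing requires.
  have hpairs : ∀ x : Fin (m + 1), K.KSep k (petalUnion P {0, x}) := by
    intro x
    have hx2 := x.2
    have hd2 := d.2
    rcases Nat.eq_zero_or_pos x.val with hx0 | hx0
    · rw [show x = 0 from Fin.ext hx0, pair_eq_singleton, petalUnion_singleton]
      exact hP.kSep 0
    rcases le_total x.val c with hxc | hxc
    · have u1 := hP.kSep_union h hpair (hP.kSep_interval h x.val c)
        ⟨⟨c, hcm⟩, by simp, hxc, le_rfl⟩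
      have u2 := hP.kSep_inter h u1 (hP.kSep_interval h 0 x.val) (by
        rw [Ne, eq_univ_iff_forall]
        intro hu
        have := hu d
        simp only [mem_union, mem_insert_iff, mem_singleton_iff, mem_ofPred_eq, Fin.ext_iff,
          Fin.val_zero] at this
        omega)
      convert u2 using 2
      ext i
      simp only [mem_union, mem_inter_iff, mem_insert_iff, mem_singleton_iff, mem_ofPred_eq,
        Fin.ext_iff, Fin.val_zero]
      omega
    · have u1 := hP.kSep_union h hpair (hP.kSep_interval h c x.val)
        ⟨⟨c, hcm⟩, by simp, le_rfl, hxc⟩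
      have u2 := hP.kSep_inter h u1 (hP.kSep_compl (hP.kSep_interval h 1 (x.val - 1))) (by
        rw [Ne, eq_univ_iff_forall]
        intro hu
        have := hu 1
        simp only [mem_union, mem_insert_iff, mem_singleton_iff, mem_ofPred_eq, Fin.ext_iff,
          Fin.val_zero, mem_compl_iff, h1v] at this
        omega)
      convert u2 using 2
      ext i
      simp only [mem_union, mem_inter_iff, mem_insert_iff, mem_singleton_iff, mem_ofPred_eq,
        Fin.ext_iff, Fin.val_zero, mem_compl_iff]
      omega
  have hmem : ∀ J : Set (Fin (m + 1)), K.KSep k (petalUnion P ({0} ∪ J)) := by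
    intro J
    induction J, J.toFinite using Set.Finite.induction_on with
    | empty =>
      rw [union_empty, petalUnion_singleton]
      exact hP.kSep 0
    | insert _ _ ih =>
      rename_i x J _ _
      have := hP.kSep_union h ih (hpairs x) ⟨0, by simp, by simp⟩
      convert this using 2
      ext i
      simp only [mem_union, mem_insert_iff, mem_singleton_iff]
      tauto
  by_cases hJ : 0 ∈ J
  · have := hmem J
    rwa [singleton_union, insert_eq_of_mem hJ] at this
  · have := hP.kSep_compl (hmem Jᶜ)
    rwa [singleton_union, insert_eq_of_mem (show 0 ∈ Jᶜ from hJ), compl_compl] at this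

/-- Every flower is an anemone or a daisy. -/
theorem isAnemone_or_isDaisy : IsAnemone K k 𝒯 P ∨ IsDaisy K k 𝒯 P := by
  obtain ⟨m, rfl⟩ := Nat.exists_eq_succ_of_ne_zero hP.pos.ne'
  by_contra! hno
  have hnd := hno.2
  simp only [IsDaisy, hP, true_and] at hnd
  push Not at hnd
  obtain ⟨I, hIne, hI⟩ := hnd
  replace hI : K.KSep k (petalUnion P I) ∧ ¬ Consecutive I := by
    rcases hI with hI | hI
    · exact hI
    · exact absurd (hP.kSep_of_consecutive h hI.2) hI.1
  obtain ⟨hIk, hIc⟩ := hI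
  -- Otherwise the non-empty set `I` is closed under successors, hence consists of all indices and
  -- is consecutive.
  have hb : ∃ b ∈ I, b + 1 ∉ I := by
    by_contra! hb
    obtain ⟨a, ha⟩ := hIne
    have hall : ∀ j : ℕ, (⟨(a.val + j) % (m + 1), Nat.mod_lt _ (by omega)⟩ : Fin (m + 1)) ∈ I := by
      intro j
      induction j with
      | zero => simpa [Nat.mod_eq_of_lt a.2] using ha
      | succ j ih =>
        have := hb _ ih
        rw [← cycSucc_eq] at this
        simp only [cycSucc, Nat.mod_add_mod] at this
        exact this
    refine hIc ⟨a, m + 1, ?_⟩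
    ext i
    simp only [mem_ofPred_eq]
    have hmain : ∃ j < m + 1, i.val = (a.val + j) % (m + 1) := by
      have := a.2
      have := i.2
      rcases le_total a.val i.val with hle | hle
      · exact ⟨i.val - a.val, by omega, by
          rw [Nat.add_sub_cancel' hle, Nat.mod_eq_of_lt i.2]⟩
      · rcases eq_or_lt_of_le hle with heq | hlt
        · exact ⟨0, by omega, by rw [add_zero, Nat.mod_eq_of_lt a.2, heq]⟩
        · refine ⟨i.val + (m + 1) - a.val, by omega, ?_⟩
          rw [Nat.add_sub_cancel' (by omega), Nat.add_mod_right, Nat.mod_eq_of_lt i.2]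
    refine ⟨fun _ => hmain, fun ⟨j, _, hj⟩ => ?_⟩
    have := hall j
    rwa [show i = ⟨(a.val + j) % (m + 1), Nat.mod_lt _ (by omega)⟩ from Fin.ext hj]
  obtain ⟨b, hbI, hb1⟩ := hb
  refine hno.1 ⟨hP, fun J _ => ?_⟩
  have hQ := hP.rotate b
  have himg : ∀ L : Set (Fin (m + 1)),
      petalUnion (P ∘ Equiv.addRight b) ((Equiv.addRight b).symm '' L) = petalUnion P L := by
    intro L
    rw [petalUnion_comp, Equiv.image_symm_image]
  rw [← himg]
  refine hQ.forall_kSep_of_zero h (I := (Equiv.addRight b).symm '' I) (by rwa [himg]) ?_ ?_ ?_ _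
  · exact ⟨b, hbI, by simp⟩
  · rintro ⟨x, hx, hxe⟩
    rw [Equiv.symm_apply_eq] at hxe
    simp only [Equiv.coe_addRight] at hxe
    rw [add_comm, ← hxe] at hb1
    exact hb1 hx
  · rintro ⟨a, l, hal⟩
    refine hIc ⟨a + b, l, ?_⟩
    ext i
    have hi : i ∈ I ↔ i - b ∈ (Equiv.addRight b).symm '' I := by
      constructor
      · intro hi
        exact ⟨i, hi, by simp [sub_eq_add_neg]⟩
      · rintro ⟨x, hx, hxe⟩
        have : x = i := by simpa [sub_eq_add_neg] using hxe
        rwa [← this]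
    rw [hi, hal]
    simp only [mem_ofPred_eq]
    refine exists_congr fun j => and_congr_right fun _ => ?_
    let t : Fin (m + 1) := ⟨(a.val + j) % (m + 1), Nat.mod_lt _ (by omega)⟩
    have e1 : (i - b).val = (a.val + j) % (m + 1) ↔ i - b = t := by rw [Fin.ext_iff]
    have e2 : i.val = ((a + b).val + j) % (m + 1) ↔ i = t + b := by
      rw [Fin.ext_iff, Fin.val_add, Fin.val_add]
      simp only [t, Nat.mod_add_mod]
      rw [add_right_comm]
    rw [e1, e2, sub_eq_iff_eq_add]

end IsFlower

end

/-! ### Merging and splitting petals -/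

section

theorem cycSucc_last (m : ℕ) : cycSucc (Fin.last m) = 0 := by
  apply Fin.ext
  simp [cycSucc]

theorem cycSucc_castSucc {m : ℕ} (i : Fin m) : cycSucc i.castSucc = i.succ := by
  apply Fin.ext
  simp [cycSucc]

theorem cycSucc_mk {n i : ℕ} (hi : i < n) (hi' : i + 1 < n) :
    cycSucc (⟨i, hi⟩ : Fin n) = ⟨i + 1, hi'⟩ :=
  Fin.ext (Nat.mod_eq_of_lt hi')

namespace IsFlower

variable {K : ConnSystem α} {k : ℕ} {𝒯 : Set (Set α)} (h : RobustIdeal K k 𝒯)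

/-- The two sides of a strong `k`-separation form a flower. -/
theorem of_strongSep {X : Set α} (hX : StrongSep K k 𝒯 X) (hE : K.KSep k K.E) :
    IsFlower K k 𝒯 ![X, K.E \ X] := by
  have hXE := hX.1.1
  have hu : X ∪ K.E \ X = K.E := union_sdiff_cancel hXE
  refine ⟨by omega, ?_, ?_, ?_, ?_, ?_⟩
  · intro i j hij
    fin_cases i <;> fin_cases j <;> simp_all [disjoint_sdiff_left, disjoint_sdiff_right]
  · ext x
    simp only [mem_iUnion, Fin.exists_fin_two, Matrix.cons_val_zero, Matrix.cons_val_one]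
    rw [← mem_union, hu]
  · intro i
    fin_cases i
    exacts [hX.2.1, hX.2.2]
  · intro i
    fin_cases i
    exacts [hX.1, hX.1.compl]
  · intro i
    fin_cases i
    · change K.KSep k (X ∪ K.E \ X)
      rwa [hu]
    · change K.KSep k (K.E \ X ∪ X)
      rwa [union_comm, hu]

theorem displays_of_strongSep {X : Set α} (hX : K.KSep k X) :
    FlowerDisplays K k ![X, K.E \ X] X :=
  ⟨hX, {0}, by rw [petalUnion_singleton]; rfl⟩

include h

/-- A flower with at most two petals displays at most one strong separation. -/
theorem eq_or_eq_of_le_two {n : ℕ} {P : Fin n → Set α} (hP : IsFlower K k 𝒯 P) (hn : n ≤ 2)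
    {X Y : Set α} (hX : FlowerDisplays K k P X) (hY : FlowerDisplays K k P Y)
    (sX : StrongSep K k 𝒯 X) (sY : StrongSep K k 𝒯 Y) : Y = X ∨ Y = K.E \ X := by
  obtain ⟨-, I, rfl⟩ := hX
  obtain ⟨-, J, rfl⟩ := hY
  have key : ∀ I : Set (Fin n), StrongSep K k 𝒯 (petalUnion P I) → I.Nonempty ∧ Iᶜ.Nonempty := by
    intro I hI
    constructor
    · by_contra hne
      rw [not_nonempty_iff_eq_empty] at hne
      rw [hne, petalUnion_empty] at hI
      exact hI.2.1 h.weak_empty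
    · by_contra hne
      rw [not_nonempty_iff_eq_empty] at hne
      have := hI.2.2
      rw [← hP.petalUnion_compl, hne, petalUnion_empty] at this
      exact this h.weak_empty
  obtain ⟨⟨i, hi⟩, ⟨i', hi'⟩⟩ := key I sX
  obtain ⟨⟨j, hj⟩, ⟨j', hj'⟩⟩ := key J sY
  rw [← hP.petalUnion_compl]
  have hii : i ≠ i' := by rintro rfl; exact hi' hi
  have hjj : j ≠ j' := by rintro rfl; exact hj' hj
  have hall : ∀ t : Fin n, t = i ∨ t = i' := by
    intro t
    rw [Fin.ext_iff, Fin.ext_iff]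
    have := t.2
    have := i.2
    have := i'.2
    rw [Ne, Fin.ext_iff] at hii
    omega
  by_cases hiJ : i ∈ J
  · left
    congr 1
    ext t
    rcases hall t with rfl | rfl
    · simp [hi, hiJ]
    · have : t ∉ J := by
        rcases hall j' with rfl | rfl
        · exact absurd hiJ hj'
        · exact hj'
      simp [this, show t ∉ I from hi']
  · right
    congr 1
    ext t
    rcases hall t with rfl | rfl
    · simp [hi, hiJ]
    · have : t ∈ J := by
        rcases hall j with rfl | rfl
        · exact absurd hj hiJ
        · exact hj
      simp [this, show t ∉ I from hi']

/-- Merging the last petal of a flower with the first one. -/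
theorem merge_last {m : ℕ} {Q : Fin (m + 2) → Set α} (hQ : IsFlower K k 𝒯 Q) :
    IsFlower K k 𝒯 (fun i : Fin (m + 1) =>
      if i = 0 then Q 0 ∪ Q (Fin.last (m + 1)) else Q i.castSucc) := by
  have hlast : K.KSep k (petalUnion Q {Fin.last (m + 1), 0}) := by
    rw [petalUnion_pair, ← cycSucc_last]
    exact hQ.kSep_succ _
  have hsucc : ∀ i : Fin (m + 1), K.KSep k (petalUnion Q {i.castSucc, i.succ}) := by
    intro i
    rw [petalUnion_pair, ← cycSucc_castSucc]
    exact hQ.kSep_succ _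
  have hl : ∀ i : Fin (m + 1), i.castSucc ≠ Fin.last (m + 1) := fun i => Fin.castSucc_ne_last i
  refine ⟨by omega, ?_, ?_, ?_, ?_, ?_⟩
  · intro i j hij
    have key : ∀ j : Fin (m + 1), j ≠ 0 →
        Disjoint (Q 0 ∪ Q (Fin.last (m + 1))) (Q j.castSucc) := by
      intro j hj
      refine Disjoint.union_left (hQ.disjoint ?_) (hQ.disjoint (hl j).symm)
      rw [← Fin.castSucc_zero]
      exact fun he => hj (Fin.castSucc_injective _ he).symm
    split_ifs with h1 h2 h2
    · exact absurd (h1.trans h2.symm) hij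
    · exact key j h2
    · exact (key i h1).symm
    · exact hQ.disjoint fun he => hij (Fin.castSucc_injective _ he)
  · rw [← hQ.union_eq]
    ext x
    simp only [mem_iUnion]
    constructor
    · rintro ⟨i, hi⟩
      split_ifs at hi with h1
      · rcases hi with hi | hi
        exacts [⟨_, hi⟩, ⟨_, hi⟩]
      · exact ⟨_, hi⟩
    · rintro ⟨i, hi⟩
      induction i using Fin.lastCases with
      | last => exact ⟨0, by rw [if_pos rfl]; exact Or.inr hi⟩
      | cast i =>
        by_cases h0 : i = 0
        · subst h0
          exact ⟨0, by rw [if_pos rfl]; exact Or.inl hi⟩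
        · exact ⟨i, by rwa [if_neg h0]⟩
  · intro i
    split_ifs
    · exact (hQ.strong 0).mono subset_union_left
    · exact hQ.strong _
  · intro i
    split_ifs
    · rwa [petalUnion_pair, union_comm] at hlast
    · exact hQ.kSep _
  · intro i
    induction i using Fin.lastCases with
    | last =>
      rw [cycSucc_last, if_pos rfl]
      split_ifs with h0
      · rw [union_self]
        rwa [petalUnion_pair, union_comm] at hlast
      · have := hQ.kSep_union h (hsucc (Fin.last m)) hlast
          ⟨Fin.last (m + 1), by simp [Fin.succ_last], by simp⟩
        rw [petalUnion_union, petalUnion_pair, petalUnion_pair, Fin.succ_last] at this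
        rwa [show Q (Fin.last m).castSucc ∪ Q (Fin.last (m + 1)) ∪ (Q (Fin.last (m + 1)) ∪ Q 0)
          = Q (Fin.last m).castSucc ∪ (Q 0 ∪ Q (Fin.last (m + 1))) by grind] at this
    | cast i =>
      rw [cycSucc_castSucc, if_neg (Fin.succ_ne_zero i)]
      split_ifs with h0
      · have := hQ.kSep_union h hlast (hsucc i.castSucc) ⟨0, by simp, by rw [h0]; simp⟩
        rw [petalUnion_union, petalUnion_pair, petalUnion_pair, Fin.succ_castSucc, h0,
          Fin.castSucc_zero] at this
        rwa [show Q (Fin.last (m + 1)) ∪ Q 0 ∪ (Q 0 ∪ Q i.succ.castSucc)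
          = Q 0 ∪ Q (Fin.last (m + 1)) ∪ Q i.succ.castSucc by grind] at this
      · have := hsucc i.castSucc
        rwa [petalUnion_pair, Fin.succ_castSucc] at this

/-- A flower with a loose petal has a coarsening with fewer petals that displays, up to
equivalence, the same non-sequential separations. -/
theorem exists_merge {n : ℕ} {P : Fin n → Set α} (hP : IsFlower K k 𝒯 P) {i : Fin n}
    (hi : LoosePetal K k 𝒯 P i) :
    ∃ m < n, ∃ P' : Fin m → Set α, IsFlower K k 𝒯 P' ∧ (∀ j, ∃ j', P j ⊆ P' j') ∧
      ∀ X, NonSeq K k 𝒯 X → FlowerDisplays K k P X →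
        ∃ Y, FlowerDisplays K k P' Y ∧ EquivSep K k 𝒯 X Y := by
  obtain ⟨j, hji, hadj, hsub⟩ := hi
  obtain ⟨m, rfl⟩ : ∃ m, n = m + 2 := by
    have := i.2
    have := j.2
    rw [Ne, Fin.ext_iff] at hji
    exact ⟨n - 2, by omega⟩
  -- Relabel so that the loose petal comes last and the petal whose closure contains it comes first:
  -- by two transpositions for an anemone, otherwise by a rotation or a reflection according to
  -- which of the two follows the other.
  obtain ⟨σ, hσ, h0, hl⟩ : ∃ σ : Fin (m + 2) ≃ Fin (m + 2), IsFlower K k 𝒯 (P ∘ σ) ∧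
      σ 0 = j ∧ σ (Fin.last (m + 1)) = i := by
    have hl1 : Fin.last (m + 1) + 1 = 0 := Fin.last_add_one _
    rcases hadj with hA | hs | hs
    · let τ := Equiv.swap (0 : Fin (m + 2)) j
      have hne : τ (Fin.last (m + 1)) ≠ j := by
        intro he
        have : τ (Fin.last (m + 1)) = τ 0 := by rw [he]; simp [τ]
        exact absurd (τ.injective this) (Fin.last_pos).ne'
      refine ⟨τ.trans (Equiv.swap (τ (Fin.last (m + 1))) i), ?_, ?_, ?_⟩
      · apply hP.comp
        intro t
        rw [← petalUnion_pair]
        exact hA.2 _ ⟨_, Or.inl rfl⟩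
      · simp only [Equiv.trans_apply]
        rw [show τ 0 = j by simp [τ]]
        exact Equiv.swap_apply_of_ne_of_ne hne.symm hji
      · simp
    · refine ⟨Equiv.addRight j, hP.rotate j, by simp, ?_⟩
      rw [cycSucc_eq] at hs
      change Fin.last (m + 1) + j = i
      rw [hs, add_comm i 1, ← add_assoc, hl1, zero_add]
    · refine ⟨Equiv.subLeft j, hP.reflect j, by simp, ?_⟩
      rw [cycSucc_eq] at hs
      rw [Equiv.subLeft_apply, hs, eq_neg_of_add_eq_zero_left hl1, sub_neg_eq_add]
  set Q := P ∘ σ with hQdef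
  have hQ0 : Q 0 = P j := by rw [hQdef, Function.comp, h0]
  have hQl : Q (Fin.last (m + 1)) = P i := by rw [hQdef, Function.comp, hl]
  set P' : Fin (m + 1) → Set α := fun i =>
    if i = 0 then Q 0 ∪ Q (Fin.last (m + 1)) else Q i.castSucc with hP'def
  have hP' : IsFlower K k 𝒯 P' := hσ.merge_last h
  have hdisp : ∀ I : Set (Fin (m + 2)), 0 ∈ I → Fin.last (m + 1) ∈ I →
      petalUnion Q I = petalUnion P' {t | t.castSucc ∈ I} := by
    intro I hI0 hIl
    ext x
    simp only [mem_petalUnion, mem_ofPred_eq]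
    constructor
    · rintro ⟨t, ht, hx⟩
      induction t using Fin.lastCases with
      | last => exact ⟨0, hI0, by simp only [hP'def, if_pos]; exact Or.inr hx⟩
      | cast t =>
        refine ⟨t, ht, ?_⟩
        by_cases ht0 : t = 0
        · subst ht0
          simp only [hP'def, if_pos]
          exact Or.inl hx
        · simpa only [hP'def, if_neg ht0] using hx
    · rintro ⟨t, ht, hx⟩
      by_cases ht0 : t = 0
      · subst ht0
        simp only [hP'def, if_pos] at hx
        rcases hx with hx | hx
        exacts [⟨_, hI0, hx⟩, ⟨_, hIl, hx⟩]
      · simp only [hP'def, if_neg ht0] at hx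
        exact ⟨_, ht, hx⟩
  have main : ∀ X, NonSeq K k 𝒯 X → ∀ I : Set (Fin (m + 2)), 0 ∈ I → X = petalUnion Q I →
      ∃ Y, FlowerDisplays K k P' Y ∧ EquivSep K k 𝒯 X Y := by
    intro X hX I hI0 hXI
    by_cases hIl : Fin.last (m + 1) ∈ I
    · exact ⟨X, ⟨hX.kSep, _, hXI.trans (hdisp I hI0 hIl)⟩, hX.strongSep.equivSep⟩
    -- The side containing the first petal has the loose petal in its full closure, so adjoining the
    -- latter does not change the class.
    · have hu : petalUnion Q (I ∪ {Fin.last (m + 1), 0}) = X ∪ Q (Fin.last (m + 1)) := by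
        rw [petalUnion_union, petalUnion_pair, ← hXI]
        have : Q 0 ⊆ X := hXI ▸ subset_petalUnion hI0
        grind
      have hk : K.KSep k (X ∪ Q (Fin.last (m + 1))) := by
        rw [← hu]
        refine hσ.kSep_union h (hXI ▸ hX.kSep) ?_ ⟨0, hI0, by simp⟩
        rw [petalUnion_pair, ← cycSucc_last]
        exact hσ.kSep_succ _
      refine ⟨X ∪ Q (Fin.last (m + 1)), ⟨hk, _, hu.symm.trans (hdisp _ (by simp [hI0])
        (by simp))⟩, h.equivSep_of_fcl_eq hX hk (hX.strong.mono subset_union_left) ?_⟩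
      refine h.fcl_eq_of_subset hX.kSep hX.strong subset_union_left
        (union_subset (subset_fcl X) ?_)
      rw [hQl]
      refine hsub.trans (fcl_mono ?_)
      rw [← hQ0, hXI]
      exact subset_petalUnion hI0
  refine ⟨m + 1, by omega, P', hP', ?_, ?_⟩
  · intro t
    obtain ⟨s, rfl⟩ := σ.surjective t
    induction s using Fin.lastCases with
    | last => exact ⟨0, by simp only [hP'def, if_pos]; exact subset_union_right⟩
    | cast s =>
      by_cases hs0 : s = 0
      · subst hs0
        exact ⟨0, by simp only [hP'def, if_pos]; exact subset_union_left⟩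
      · exact ⟨s, by simp only [hP'def, if_neg hs0]; exact Subset.rfl⟩
  · intro X hX hXP
    obtain ⟨-, I, hXI⟩ : FlowerDisplays K k Q X := flowerDisplays_comp.2 hXP
    by_cases hI0 : (0 : Fin (m + 2)) ∈ I
    · exact main X hX I hI0 hXI
    · obtain ⟨Y, hY, he⟩ := main (K.E \ X) hX.compl Iᶜ hI0
        (by rw [hXI]; exact (hσ.petalUnion_compl I).symm)
      exact ⟨Y, hY, hX.strongSep.equivSep_compl.trans he⟩

omit h in
/-- Splitting the first petal of a flower into two petals. -/
theorem split_zero {m : ℕ} {Q : Fin (m + 1) → Set α} (hQ : IsFlower K k 𝒯 Q) (hm : 0 < m)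
    {A B : Set α} (hAB : A ∪ B = Q 0) (hd : Disjoint A B) (sA : Strong 𝒯 A) (sB : Strong 𝒯 B)
    (kA : K.KSep k A) (kB : K.KSep k B) (kA1 : K.KSep k (A ∪ Q 1))
    (kBl : K.KSep k (Q (Fin.last m) ∪ B)) :
    ∃ P' : Fin (m + 1 + 1) → Set α, IsFlower K k 𝒯 P' ∧
      (∀ X, FlowerDisplays K k Q X → FlowerDisplays K k P' X) ∧
      (∀ j, P' j = A ∨ P' j = B ∨ ∃ j' ≠ 0, P' j = Q j') ∧
      (∀ j' ≠ 0, ∃ j, P' j = Q j') ∧ (∃ j, P' j = A) ∧ ∃ j, P' j = B := by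
  -- `A` takes the place of the first petal and `B` is appended at the end, so that cyclically `B`
  -- lies between the old last petal and `A`.
  set P' : Fin (m + 1 + 1) → Set α := Fin.snoc (α := fun _ => Set α) (Function.update Q 0 A) B
    with hP'
  have h0 : P' 0 = A := by
    have := Fin.snoc_castSucc (α := fun _ => Set α) B (Function.update Q 0 A) 0
    rwa [Function.update_self] at this
  have hl : P' (Fin.last (m + 1)) = B := by rw [hP', Fin.snoc_last]
  have hc : ∀ j : Fin (m + 1), j ≠ 0 → P' j.castSucc = Q j := by
    intro j hj
    rw [hP', Fin.snoc_castSucc, Function.update_of_ne hj]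
  have hcases : ∀ p : Fin (m + 1 + 1) → Prop, p 0 → p (Fin.last (m + 1)) →
      (∀ j : Fin (m + 1), j ≠ 0 → p j.castSucc) → ∀ j, p j := by
    intro p p0 pl pc j
    induction j using Fin.lastCases with
    | last => exact pl
    | cast j =>
      by_cases hj : j = 0
      · subst hj
        exact p0
      · exact pc j hj
  have hA : A ⊆ Q 0 := hAB ▸ subset_union_left
  have hB : B ⊆ Q 0 := hAB ▸ subset_union_right
  have hlm : Fin.last m ≠ 0 := by
    intro he
    have := congrArg Fin.val he
    simp at this
    omega
  refine ⟨P', ⟨by omega, ?_, ?_, ?_, ?_, ?_⟩, ?_, ?_, ?_, ⟨0, h0⟩, ⟨_, hl⟩⟩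
  · have hQd : ∀ j ≠ 0, Disjoint (Q 0) (Q j) := fun j hj => hQ.disjoint hj.symm
    have key : ∀ i j, i ≠ j → Disjoint (P' i) (P' j) := by
      intro i
      refine hcases (fun i => ∀ j, i ≠ j → Disjoint (P' i) (P' j)) ?_ ?_ ?_ i
      · refine hcases _ (fun hh => absurd rfl hh) ?_ ?_
        · intro _
          rwa [h0, hl]
        · intro j hj _
          rw [h0, hc j hj]
          exact (hQd j hj).mono_left hA
      · refine hcases _ ?_ (fun hh => absurd rfl hh) ?_
        · intro _
          rw [h0, hl]
          exact hd.symm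
        · intro j hj _
          rw [hl, hc j hj]
          exact (hQd j hj).mono_left hB
      · intro i hi
        refine hcases _ ?_ ?_ ?_
        · intro _
          rw [h0, hc i hi]
          exact ((hQd i hi).mono_left hA).symm
        · intro _
          rw [hl, hc i hi]
          exact ((hQd i hi).mono_left hB).symm
        · intro j hj hij
          rw [hc i hi, hc j hj]
          exact hQ.disjoint fun he => hij (by rw [he])
    exact fun i j hij => key i j hij
  · rw [← hQ.union_eq]
    ext x
    simp only [mem_iUnion]
    constructor
    · rintro ⟨j, hj⟩
      revert hj
      refine hcases (fun j => x ∈ P' j → ∃ i, x ∈ Q i) ?_ ?_ ?_ j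
      · intro hx
        exact ⟨0, hA (h0 ▸ hx)⟩
      · intro hx
        exact ⟨0, hB (hl ▸ hx)⟩
      · intro j hj hx
        exact ⟨j, hc j hj ▸ hx⟩
    · rintro ⟨j, hj⟩
      by_cases hj0 : j = 0
      · subst hj0
        rw [← hAB] at hj
        rcases hj with hj | hj
        · exact ⟨0, h0.symm ▸ hj⟩
        · exact ⟨_, hl.symm ▸ hj⟩
      · exact ⟨_, (hc j hj0).symm ▸ hj⟩
  · refine hcases _ (h0.symm ▸ sA) (hl.symm ▸ sB) fun j hj => ?_
    rw [hc j hj]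
    exact hQ.strong j
  · refine hcases _ (h0.symm ▸ kA) (hl.symm ▸ kB) fun j hj => ?_
    rw [hc j hj]
    exact hQ.kSep j
  · intro i
    induction i using Fin.lastCases with
    | last =>
      rw [cycSucc_last, h0, hl, union_comm, hAB]
      exact hQ.kSep 0
    | cast i =>
      rw [cycSucc_castSucc]
      induction i using Fin.lastCases with
      | last =>
        rw [Fin.succ_last, hl, hc _ hlm]
        exact kBl
      | cast i =>
        rw [Fin.succ_castSucc, hc _ (Fin.succ_ne_zero i)]
        by_cases hi : i.castSucc = 0
        · have h1 : i.succ = 1 := by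
            apply Fin.ext
            have := congrArg Fin.val hi
            simp at this
            rw [Fin.val_one', Nat.mod_eq_of_lt (by omega)]
            simp [this]
          rw [hi, Fin.castSucc_zero, h0, h1]
          exact kA1
        · rw [hc _ hi, ← cycSucc_castSucc]
          exact hQ.kSep_succ _
  · rintro X ⟨hX, I, rfl⟩
    refine ⟨hX, {j | P' j ⊆ petalUnion Q I}, ?_⟩
    ext x
    rw [mem_petalUnion, mem_petalUnion]
    constructor
    · rintro ⟨j, hj, hx⟩
      by_cases hj0 : j = 0
      · subst hj0
        rw [← hAB] at hx
        rcases hx with hx | hx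
        · exact ⟨0, by rw [mem_ofPred_eq, h0]; exact hA.trans (subset_petalUnion hj), h0 ▸ hx⟩
        · exact ⟨_, by rw [mem_ofPred_eq, hl]; exact hB.trans (subset_petalUnion hj), hl ▸ hx⟩
      · exact ⟨_, by rw [mem_ofPred_eq, hc j hj0]; exact subset_petalUnion hj, hc j hj0 ▸ hx⟩
    · rintro ⟨j, hj, hx⟩
      exact mem_petalUnion.1 (hj hx)
  · refine hcases _ (Or.inl h0) (Or.inr (Or.inl hl)) fun j hj => Or.inr (Or.inr ⟨j, hj, hc j hj⟩)
  · exact fun j hj => ⟨_, hc j hj⟩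

end IsFlower

end

/-! ### Refining a flower so that it displays a given separation -/

section

variable {K : ConnSystem α} {k : ℕ} {𝒯 : Set (Set α)}

variable (K k 𝒯) in
/-- The flower `P` can be refined so as to display `Z`, keeping `R` inside a petal. -/
structure Splittable {n : ℕ} (P : Fin n → Set α) (Z R : Set α) : Prop where
  flower : IsFlower K k 𝒯 P
  kSep : K.KSep k Z
  strong_inter : ∀ i, (P i ∩ Z).Nonempty → Strong 𝒯 (P i ∩ Z)
  strong_diff : ∀ i, (P i \ Z).Nonempty → Strong 𝒯 (P i \ Z)
  not_subset : ∀ i, ¬ Z ⊆ P i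
  compl_not_subset : ∀ i, ¬ K.E \ Z ⊆ P i
  root : ∃ i, R ⊆ P i
  disjoint_root : Disjoint R Z

/-- Petals are disjoint and, being strong, non-empty. This bound makes the repeated splitting of
petals terminate. -/
theorem IsFlower.le_ncard {n : ℕ} {P : Fin n → Set α} (hP : IsFlower K k 𝒯 P)
    (h : RobustIdeal K k 𝒯) : n ≤ K.E.ncard := by
  choose f hf using fun i => hP.petal_nonempty h i
  have hinj : Function.Injective f := fun i j hij => hP.index_eq (hf i) (hij ▸ hf j)
  calc n = (f '' univ).ncard := by rw [ncard_image_of_injective _ hinj, ncard_univ, Nat.card_fin]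
    _ ≤ K.E.ncard := ncard_le_ncard (by
      rintro _ ⟨i, -, rfl⟩
      exact hP.petal_subset i (hf i)) K.finite_E

/-- The data needed to split the first petal of the flower `Q` into `A` and `B`. -/
theorem IsFlower.kSep_last_union {m : ℕ} {Q : Fin (m + 1) → Set α} (hQ : IsFlower K k 𝒯 Q)
    (h : RobustIdeal K k 𝒯) (hm : 0 < m) {A B : Set α} (hAB : A ∪ B = Q 0) (hd : Disjoint A B)
    (kA : K.KSep k A) (kA1 : K.KSep k (A ∪ Q 1)) : K.KSep k (Q (Fin.last m) ∪ B) := by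
  have h10 : (1 : Fin (m + 1)) ≠ 0 := by
    rw [Ne, Fin.ext_iff, Fin.val_one', Nat.mod_eq_of_lt (by omega)]
    simp
  have hl0 : Fin.last m ≠ 0 := by
    rw [Ne, Fin.ext_iff]
    simp
    omega
  have d10 := hQ.disjoint h10
  have dl0 := hQ.disjoint hl0
  have e0 := hQ.petal_subset 0
  have el := hQ.petal_subset (Fin.last m)
  -- With only two petals, the last petal is the neighbour of the first on both sides, and the set
  -- in question is simply `E \ A`.
  by_cases hl1 : Fin.last m = 1
  · have hu : K.E = Q 0 ∪ Q (Fin.last m) := by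
      refine Subset.antisymm (fun x hx => ?_) (union_subset e0 el)
      obtain ⟨i, hi⟩ := hQ.exists_mem hx
      have hm1 : m = 1 := by
        have := congrArg Fin.val hl1
        rw [Fin.val_one', Nat.mod_eq_of_lt (by omega)] at this
        simpa using this
      subst hm1
      have : i = 0 ∨ i = Fin.last 1 := by
        fin_cases i
        exacts [Or.inl rfl, Or.inr rfl]
      rcases this with rfl | rfl
      exacts [Or.inl hi, Or.inr hi]
    have := kA.compl
    rwa [show K.E \ A = Q (Fin.last m) ∪ B by grind] at this
  · have dl1 := hQ.disjoint hl1
    have hp : K.KSep k (Q (Fin.last m) ∪ Q 0) := by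
      have := hQ.kSep_succ (Fin.last m)
      rwa [cycSucc_last] at this
    have e1 := hQ.petal_subset 1
    have := h.kSep_inter kA1.compl hp ((hQ.strong 0).mono (by grind))
      ((hQ.strong 1).mono (by grind))
    rwa [show K.E \ (A ∪ Q 1) ∩ (Q (Fin.last m) ∪ Q 0) = Q (Fin.last m) ∪ B by grind] at this

namespace Splittable

variable {n : ℕ} {P : Fin n → Set α} {Z R : Set α}

/-- A point of `E \ Z` outside `P i` lies in another petal, whose part off `Z` is then non-empty and
so strong. -/
theorem strong_outside (hs : Splittable K k 𝒯 P Z R) (i : Fin n) :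
    Strong 𝒯 (K.E \ (P i ∪ Z)) := by
  obtain ⟨x, hx, hxi⟩ := Set.not_subset.1 (hs.compl_not_subset i)
  obtain ⟨j, hj⟩ := hs.flower.exists_mem hx.1
  have hij : i ≠ j := by rintro rfl; exact hxi hj
  have hd := hs.flower.disjoint hij
  have := hs.flower.petal_subset j
  exact (hs.strong_diff j ⟨x, hj, hx.2⟩).mono (by grind)

theorem strong_inside (hs : Splittable K k 𝒯 P Z R) (i : Fin n) : Strong 𝒯 (Z \ P i) := by
  obtain ⟨x, hx, hxi⟩ := Set.not_subset.1 (hs.not_subset i)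
  obtain ⟨j, hj⟩ := hs.flower.exists_mem (hs.kSep.1 hx)
  have hij : i ≠ j := by rintro rfl; exact hxi hj
  have hd := hs.flower.disjoint hij
  exact (hs.strong_inter j ⟨x, hj, hx⟩).mono (by grind)

theorem comp (hs : Splittable K k 𝒯 P Z R) {σ : Fin n ≃ Fin n} (hσ : IsFlower K k 𝒯 (P ∘ σ)) :
    Splittable K k 𝒯 (P ∘ σ) Z R where
  flower := hσ
  kSep := hs.kSep
  strong_inter i := hs.strong_inter (σ i)
  strong_diff i := hs.strong_diff (σ i)
  not_subset i := hs.not_subset (σ i)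
  compl_not_subset i := hs.compl_not_subset (σ i)
  root := let ⟨i, hi⟩ := hs.root; ⟨σ.symm i, by simpa using hi⟩
  disjoint_root := hs.disjoint_root

/-- Two uncrossings: the set is `(Z ∪ Q 1) ∩ (Q 0 ∪ Q 1)`. -/
theorem kSep_union_one {m : ℕ} {Q : Fin (m + 1) → Set α} (hQ : IsFlower K k 𝒯 Q)
    (h : RobustIdeal K k 𝒯) (hZ : K.KSep k Z) (s1 : Strong 𝒯 (Q 1 ∩ Z))
    (s2 : Strong 𝒯 ((K.E \ (Q 0 ∪ Q 1)) \ Z)) : K.KSep k (Q 0 ∩ Z ∪ Q 1) := by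
  have e0 := hQ.petal_subset 0
  have e1 := hQ.petal_subset 1
  have eZ := hZ.1
  have k1 := h.kSep_union hZ (hQ.kSep 1) (s1.mono (by grind)) (s2.mono (by grind))
  have hp : K.KSep k (Q 0 ∪ Q 1) := by
    have := hQ.kSep_succ 0
    rwa [cycSucc_eq, zero_add] at this
  have := h.kSep_inter k1 hp ((hQ.strong 0).mono (by grind)) (s2.mono (by grind))
  rwa [show (Z ∪ Q 1) ∩ (Q 0 ∪ Q 1) = Q 0 ∩ Z ∪ Q 1 by grind] at this

/-- This decides which half of the split petal goes next to `Q 1`. `kSep_union_one` applies to `Z`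
if `Z` meets `Q 1` and `E \ Z` meets the remaining petals, and to `E \ Z` in the opposite situation.
If neither holds, `Z` or its complement lies in `Q 0`, unless there are no remaining petals, where
complementation suffices. -/
theorem kSep_union_one_or {m : ℕ} {Q : Fin (m + 1) → Set α} (hs : Splittable K k 𝒯 Q Z R)
    (h : RobustIdeal K k 𝒯) (hm : 0 < m) (kB : K.KSep k (Q 0 \ Z)) :
    K.KSep k (Q 0 ∩ Z ∪ Q 1) ∨ K.KSep k (Q 0 \ Z ∪ Q 1) := by
  have hQ := hs.flower
  have e0 := hQ.petal_subset 0
  have e1 := hQ.petal_subset 1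
  have eZ := hs.kSep.1
  have h10 : (1 : Fin (m + 1)) ≠ 0 := by
    rw [Ne, Fin.ext_iff, Fin.val_one', Nat.mod_eq_of_lt (by omega)]
    simp
  have d10 := hQ.disjoint h10
  by_cases hrest : K.E \ (Q 0 ∪ Q 1) = ∅
  · left
    have := kB.compl
    rw [sdiff_eq_empty] at hrest
    rwa [show K.E \ (Q 0 \ Z) = Q 0 ∩ Z ∪ Q 1 by grind] at this
  have hB : Strong 𝒯 (Q 1 \ Z) → Strong 𝒯 ((K.E \ (Q 0 ∪ Q 1)) ∩ Z) →
      K.KSep k (Q 0 \ Z ∪ Q 1) := by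
    intro s1 s2
    have := kSep_union_one hQ h hs.kSep.compl (s1.mono (by grind)) (s2.mono (by grind))
    rwa [show Q 0 ∩ (K.E \ Z) = Q 0 \ Z by grind] at this
  have hZK : ((K.E \ (Q 0 ∪ Q 1)) ∩ Z).Nonempty → Strong 𝒯 ((K.E \ (Q 0 ∪ Q 1)) ∩ Z) := by
    rintro ⟨x, hx, hxZ⟩
    obtain ⟨j, hj⟩ := hQ.exists_mem hx.1
    have hd0 := hQ.disjoint (i := 0) (j := j) (by rintro rfl; exact hx.2 (Or.inl hj))
    have hd1 := hQ.disjoint (i := 1) (j := j) (by rintro rfl; exact hx.2 (Or.inr hj))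
    exact (hs.strong_inter j ⟨x, hj, hxZ⟩).mono (by grind)
  have hZK' : ((K.E \ (Q 0 ∪ Q 1)) \ Z).Nonempty → Strong 𝒯 ((K.E \ (Q 0 ∪ Q 1)) \ Z) := by
    rintro ⟨x, hx, hxZ⟩
    obtain ⟨j, hj⟩ := hQ.exists_mem hx.1
    have hd0 := hQ.disjoint (i := 0) (j := j) (by rintro rfl; exact hx.2 (Or.inl hj))
    have hd1 := hQ.disjoint (i := 1) (j := j) (by rintro rfl; exact hx.2 (Or.inr hj))
    have := hQ.petal_subset j
    exact (hs.strong_diff j ⟨x, hj, hxZ⟩).mono (by grind)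
  obtain ⟨x, hxZ, hx0⟩ := Set.not_subset.1 (hs.not_subset 0)
  obtain ⟨y, hyZ, hy0⟩ := Set.not_subset.1 (hs.compl_not_subset 0)
  have hxE := eZ hxZ
  by_cases hx1 : (Q 1 ∩ Z).Nonempty
  · by_cases hK : ((K.E \ (Q 0 ∪ Q 1)) \ Z).Nonempty
    · exact Or.inl (kSep_union_one hQ h hs.kSep (hs.strong_inter 1 hx1) (hZK' hK))
    · rw [not_nonempty_iff_eq_empty, sdiff_eq_empty] at hK
      refine Or.inr (hB (hs.strong_diff 1 ⟨y, ?_, hyZ.2⟩) (hZK ?_))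
      · by_contra hy1
        exact hyZ.2 (hK ⟨hyZ.1, fun ho => ho.elim hy0 hy1⟩)
      · rw [inter_eq_left.2 hK]
        exact nonempty_iff_ne_empty.2 hrest
  · rw [not_nonempty_iff_eq_empty] at hx1
    refine Or.inr (hB ?_ (hZK ⟨x, ⟨hxE, ?_⟩, hxZ⟩))
    · rw [show Q 1 \ Z = Q 1 by rw [sdiff_eq_left, disjoint_iff_inter_eq_empty, hx1]]
      exact hQ.strong 1
    · rintro (h' | h')
      · exact hx0 h'
      · have : x ∈ Q 1 ∩ Z := ⟨h', hxZ⟩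
        rw [hx1] at this
        exact this

/-- Splitting one petal along `Z`. -/
theorem exists_step (hs : Splittable K k 𝒯 P Z R) (h : RobustIdeal K k 𝒯) {i : Fin n}
    (hi1 : (P i ∩ Z).Nonempty) (hi2 : (P i \ Z).Nonempty) :
    ∃ P' : Fin (n + 1) → Set α, Splittable K k 𝒯 P' Z R ∧
      ∀ X, FlowerDisplays K k P X → FlowerDisplays K k P' X := by
  obtain ⟨m, rfl⟩ := Nat.exists_eq_succ_of_ne_zero hs.flower.pos.ne'
  obtain ⟨Q, hsQ, hQd, hQ1, hQ2⟩ : ∃ Q : Fin (m + 1) → Set α, Splittable K k 𝒯 Q Z R ∧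
      (∀ X, FlowerDisplays K k P X → FlowerDisplays K k Q X) ∧ (Q 0 ∩ Z).Nonempty ∧
      (Q 0 \ Z).Nonempty := by
    have hr := hs.flower.rotate i
    exact ⟨_, hs.comp hr, fun X hX => flowerDisplays_comp.2 hX, by simpa using hi1,
      by simpa using hi2⟩
  have hQ := hsQ.flower
  have hm : 0 < m := by
    rcases Nat.eq_zero_or_pos m with rfl | hm
    · refine absurd (fun x hx => ?_) (hsQ.not_subset 0)
      obtain ⟨j, hj⟩ := hQ.exists_mem (hsQ.kSep.1 hx)
      rwa [show 0 = j from Subsingleton.elim (α := Fin 1) 0 j]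
    · exact hm
  have sA := hsQ.strong_inter 0 hQ1
  have sB := hsQ.strong_diff 0 hQ2
  have e0 := hQ.petal_subset 0
  have eZ := hsQ.kSep.1
  have kA := h.kSep_inter (hQ.kSep 0) hsQ.kSep ((hQ.strong 0).mono subset_union_left)
    (hsQ.strong_outside 0)
  have kB := h.kSep_diff (hQ.kSep 0) hsQ.kSep (hQ.strong 0) (hsQ.strong_inside 0)
  have hd : Disjoint (Q 0 ∩ Z) (Q 0 \ Z) := by
    rw [disjoint_left]
    exact fun x hx hx' => hx'.2 hx.2
  have key : ∃ P' : Fin (m + 1 + 1) → Set α, IsFlower K k 𝒯 P' ∧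
      (∀ X, FlowerDisplays K k Q X → FlowerDisplays K k P' X) ∧
      (∀ j, P' j = Q 0 ∩ Z ∨ P' j = Q 0 \ Z ∨ ∃ j' ≠ 0, P' j = Q j') ∧
      (∀ j' ≠ 0, ∃ j, P' j = Q j') ∧ ∃ j, P' j = Q 0 \ Z := by
    rcases hsQ.kSep_union_one_or h hm kB with k1 | k1
    · obtain ⟨P', h1, h2, h3, h4, h5, h6⟩ := hQ.split_zero hm (inter_union_sdiff _ _) hd sA sB kA
        kB k1 (hQ.kSep_last_union h hm (inter_union_sdiff _ _) hd kA k1)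
      exact ⟨P', h1, h2, h3, h4, h6⟩
    · obtain ⟨P', h1, h2, h3, h4, h5, h6⟩ := hQ.split_zero hm (sdiff_union_inter _ _) hd.symm sB sA
        kB kA k1 (hQ.kSep_last_union h hm (sdiff_union_inter _ _) hd.symm kB k1)
      exact ⟨P', h1, h2, fun j => by have := h3 j; tauto, h4, h5⟩
  obtain ⟨P', hP', hdisp, hcase, hother, hB⟩ := key
  refine ⟨P', ⟨hP', hs.kSep, ?_, ?_, ?_, ?_, ?_, hs.disjoint_root⟩, fun X hX => hdisp X (hQd X hX)⟩
  · intro j hj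
    rcases hcase j with e | e | ⟨j', -, e⟩ <;> rw [e] at hj ⊢
    · rwa [inter_assoc, inter_self]
    · rw [sdiff_inter_self] at hj
      exact absurd hj not_nonempty_empty
    · exact hsQ.strong_inter j' hj
  · intro j hj
    rcases hcase j with e | e | ⟨j', -, e⟩ <;> rw [e] at hj ⊢
    · obtain ⟨x, hx, hx'⟩ := hj
      exact absurd hx.2 hx'
    · rwa [show (Q 0 \ Z) \ Z = Q 0 \ Z by grind]
    · exact hsQ.strong_diff j' hj
  · intro j
    rcases hcase j with e | e | ⟨j', -, e⟩ <;> rw [e]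
    · exact fun hsub => hsQ.not_subset 0 (hsub.trans inter_subset_left)
    · exact fun hsub => hsQ.not_subset 0 (hsub.trans sdiff_subset)
    · exact hsQ.not_subset j'
  · intro j
    rcases hcase j with e | e | ⟨j', -, e⟩ <;> rw [e]
    · exact fun hsub => hsQ.compl_not_subset 0 (hsub.trans inter_subset_left)
    · exact fun hsub => hsQ.compl_not_subset 0 (hsub.trans sdiff_subset)
    · exact hsQ.compl_not_subset j'
  -- Since `R` avoids `Z`, it survives in the half `Q 0 \ Z` if its petal is the one that was split.
  · obtain ⟨j, hj⟩ := hsQ.root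
    by_cases hj0 : j = 0
    · obtain ⟨t, ht⟩ := hB
      refine ⟨t, ?_⟩
      rw [ht]
      rw [hj0] at hj
      have := hs.disjoint_root
      exact subset_sdiff.2 ⟨hj, this⟩
    · obtain ⟨t, ht⟩ := hother j hj0
      exact ⟨t, ht ▸ hj⟩

/-- A splittable flower has a refinement that displays `Z`. -/
theorem exists_refinement (hs : Splittable K k 𝒯 P Z R) (h : RobustIdeal K k 𝒯) :
    ∃ (n' : ℕ) (P' : Fin n' → Set α), IsFlower K k 𝒯 P' ∧ (∃ i, R ⊆ P' i) ∧
      (∀ X, FlowerDisplays K k P X → FlowerDisplays K k P' X) ∧ FlowerDisplays K k P' Z := by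
  -- Induction on the number of splittings still possible, as a flower has at most `|E|` petals.
  obtain ⟨c, hc⟩ : ∃ c, K.E.ncard ≤ n + c := ⟨K.E.ncard, by omega⟩
  induction c generalizing n with
  | zero =>
    by_cases hcross : ∃ i, (P i ∩ Z).Nonempty ∧ (P i \ Z).Nonempty
    · obtain ⟨i, hi1, hi2⟩ := hcross
      obtain ⟨P', hP', -⟩ := hs.exists_step h hi1 hi2
      have := hP'.flower.le_ncard h
      omega
    · exact ⟨n, P, hs.flower, hs.root, fun _ hX => hX, hs.kSep, displayed_of_forall hs hcross⟩
  | succ c ih =>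
    by_cases hcross : ∃ i, (P i ∩ Z).Nonempty ∧ (P i \ Z).Nonempty
    · obtain ⟨i, hi1, hi2⟩ := hcross
      obtain ⟨P', hP', hd⟩ := hs.exists_step h hi1 hi2
      obtain ⟨n', P'', h1, h2, h3, h4⟩ := ih hP' (by omega)
      exact ⟨n', P'', h1, h2, fun X hX => h3 X (hd X hX), h4⟩
    · exact ⟨n, P, hs.flower, hs.root, fun _ hX => hX, hs.kSep, displayed_of_forall hs hcross⟩
where
  displayed_of_forall {n : ℕ} {P : Fin n → Set α} (hs : Splittable K k 𝒯 P Z R)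
      (hcross : ¬ ∃ i, (P i ∩ Z).Nonempty ∧ (P i \ Z).Nonempty) :
      ∃ I : Set (Fin n), Z = petalUnion P I := by
    refine ⟨{i | (P i ∩ Z).Nonempty}, Subset.antisymm (fun x hx => ?_) (fun x hx => ?_)⟩
    · obtain ⟨j, hj⟩ := hs.flower.exists_mem (hs.kSep.1 hx)
      exact mem_petalUnion.2 ⟨j, ⟨x, hj, hx⟩, hj⟩
    · obtain ⟨j, hj, hxj⟩ := mem_petalUnion.1 hx
      by_contra hxZ
      exact hcross ⟨j, hj, x, hxj, hxZ⟩

end Splittable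

end

section

variable {K : ConnSystem α} {k : ℕ} {𝒯 : Set (Set α)}

/-! ### Optimal flowers -/

variable (K k 𝒯) in
/-- The non-sequential separations that are equivalent to one displayed by the flower `P`. -/
def displayedClasses {n : ℕ} (P : Fin n → Set α) : Set (Set α) :=
  {Y | NonSeq K k 𝒯 Y ∧ ∃ W, FlowerDisplays K k P W ∧ EquivSep K k 𝒯 Y W}

theorem displayedClasses_subset {n : ℕ} (P : Fin n → Set α) :
    displayedClasses K k 𝒯 P ⊆ 𝒫 K.E := fun _ hY => hY.1.kSep.1

theorem displayedClasses_finite {n : ℕ} (P : Fin n → Set α) :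
    (displayedClasses K k 𝒯 P).Finite := K.finite_E.finite_subsets.subset (displayedClasses_subset P)

theorem displayedClasses_subset_of {n m : ℕ} {P : Fin n → Set α} {P' : Fin m → Set α}
    (hd : ∀ X, NonSeq K k 𝒯 X → FlowerDisplays K k P X →
      ∃ Y, FlowerDisplays K k P' Y ∧ EquivSep K k 𝒯 X Y) :
    displayedClasses K k 𝒯 P ⊆ displayedClasses K k 𝒯 P' := by
  rintro Y ⟨hY, W, hW, he⟩
  obtain ⟨V, hV, he'⟩ := hd W (hY.of_equivSep he) hW
  exact ⟨hY, V, hV, he.trans he'⟩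

variable (K k 𝒯) in
/-- Among the flowers that display a separation equivalent to `X` and have a petal containing `R`,
the flower `P` displays the most non-sequential separations up to equivalence and, subject to that,
has the fewest petals. -/
structure OptimalFlower {n : ℕ} (P : Fin n → Set α) (R X : Set α) : Prop where
  flower : IsFlower K k 𝒯 P
  root : ∃ i, R ⊆ P i
  mem : X ∈ displayedClasses K k 𝒯 P
  ncard_le : ∀ (m : ℕ) (P' : Fin m → Set α), IsFlower K k 𝒯 P' → (∃ i, R ⊆ P' i) →
    X ∈ displayedClasses K k 𝒯 P' →
      (displayedClasses K k 𝒯 P').ncard ≤ (displayedClasses K k 𝒯 P).ncard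
  le_of_ncard_le : ∀ (m : ℕ) (P' : Fin m → Set α), IsFlower K k 𝒯 P' → (∃ i, R ⊆ P' i) →
    X ∈ displayedClasses K k 𝒯 P' →
      (displayedClasses K k 𝒯 P).ncard ≤ (displayedClasses K k 𝒯 P').ncard → n ≤ m

/-- The number of displayed classes is bounded by that of all subsets of `E`, so maximising it means
minimising the deficit `c`; the number of petals is minimised afterwards for that deficit. -/
theorem exists_optimalFlower {n : ℕ} {P : Fin n → Set α} {R X : Set α} (hP : IsFlower K k 𝒯 P)
    (hR : ∃ i, R ⊆ P i) (hX : X ∈ displayedClasses K k 𝒯 P) :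
    ∃ (m : ℕ) (Q : Fin m → Set α), OptimalFlower K k 𝒯 Q R X := by
  classical
  let good : ∀ (m : ℕ) (Q : Fin m → Set α), Prop := fun m Q =>
    IsFlower K k 𝒯 Q ∧ (∃ i, R ⊆ Q i) ∧ X ∈ displayedClasses K k 𝒯 Q
  let N := (𝒫 K.E).ncard
  have hN : ∀ (m : ℕ) (Q : Fin m → Set α), (displayedClasses K k 𝒯 Q).ncard ≤ N := fun m Q =>
    ncard_le_ncard (displayedClasses_subset Q) K.finite_E.finite_subsets
  have h1 : ∃ c, ∃ (m : ℕ) (Q : Fin m → Set α), good m Q ∧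
      N - (displayedClasses K k 𝒯 Q).ncard = c := ⟨_, n, P, ⟨hP, hR, hX⟩, rfl⟩
  have hc := Nat.find_spec h1
  have hcm := fun {c} => Nat.find_min' h1 (m := c)
  generalize Nat.find h1 = c at hc hcm
  have h2 : ∃ m, ∃ Q : Fin m → Set α, good m Q ∧
      N - (displayedClasses K k 𝒯 Q).ncard = c := hc
  obtain ⟨Q, hQ, hQc⟩ := Nat.find_spec h2
  have hmm := fun {m} => Nat.find_min' h2 (m := m)
  refine ⟨_, Q, hQ.1, hQ.2.1, hQ.2.2, ?_, ?_⟩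
  · intro m P' a b d
    have := hcm ⟨m, P', ⟨a, b, d⟩, rfl⟩
    have := hN _ Q
    have := hN _ P'
    omega
  · intro m P' a b d hle
    apply hmm
    refine ⟨P', ⟨a, b, d⟩, ?_⟩
    have := hcm ⟨m, P', ⟨a, b, d⟩, rfl⟩
    have := hN _ Q
    have := hN _ P'
    omega

namespace OptimalFlower

variable {n : ℕ} {P : Fin n → Set α} {R X : Set α} (hP : OptimalFlower K k 𝒯 P R X)
include hP

theorem displayedClasses_eq {m : ℕ} {P' : Fin m → Set α} (hP' : IsFlower K k 𝒯 P')
    (hR : ∃ i, R ⊆ P' i)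
    (hd : displayedClasses K k 𝒯 P ⊆ displayedClasses K k 𝒯 P') :
    displayedClasses K k 𝒯 P = displayedClasses K k 𝒯 P' :=
  eq_of_subset_of_ncard_le hd (hP.ncard_le m P' hP' hR (hd hP.mem)) (displayedClasses_finite P')

theorem card_le {m : ℕ} {P' : Fin m → Set α} (hP' : IsFlower K k 𝒯 P') (hR : ∃ i, R ⊆ P' i)
    (hd : displayedClasses K k 𝒯 P ⊆ displayedClasses K k 𝒯 P') : n ≤ m :=
  hP.le_of_ncard_le m P' hP' hR (hd hP.mem) (ncard_le_ncard hd (displayedClasses_finite P'))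

/-- Merging a loose petal would save a petal without losing a class. -/
theorem not_loosePetal (h : RobustIdeal K k 𝒯) (i : Fin n) : ¬ LoosePetal K k 𝒯 P i := by
  intro hi
  obtain ⟨m, hm, P', hP', hsub, hd⟩ := hP.flower.exists_merge h hi
  obtain ⟨j, hj⟩ := hP.root
  obtain ⟨j', hj'⟩ := hsub j
  exact absurd (hP.card_le hP' ⟨j', hj.trans hj'⟩ (displayedClasses_subset_of hd)) (by omega)

theorem comp {σ : Fin n ≃ Fin n} (hσ : IsFlower K k 𝒯 (P ∘ σ)) :
    OptimalFlower K k 𝒯 (P ∘ σ) R X := by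
  have he : displayedClasses K k 𝒯 (P ∘ σ) = displayedClasses K k 𝒯 P := by
    simp only [displayedClasses, flowerDisplays_comp]
  refine ⟨hσ, ?_, he ▸ hP.mem, he ▸ hP.ncard_le, he ▸ hP.le_of_ncard_le⟩
  obtain ⟨i, hi⟩ := hP.root
  exact ⟨σ.symm i, by simpa using hi⟩

end OptimalFlower

/-! ### Separations crossing an optimal flower -/

/-- The petals of `P` that are cut by `Z`. -/
def crossed {n : ℕ} (P : Fin n → Set α) (Z : Set α) : Set (Fin n) :=
  {i | (P i ∩ Z).Nonempty ∧ (P i \ Z).Nonempty}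

variable (K k 𝒯) in
/-- A non-sequential separation `Z` that does not conform with the optimal flower `P`, chosen
within its equivalence class so that it cuts as few petals as possible. -/
structure MinimalCrossing {n : ℕ} (P : Fin n → Set α) (R X Z : Set α) : Prop where
  optimal : OptimalFlower K k 𝒯 P R X
  root_or : R = ∅ ∨ Strong 𝒯 R
  nonSeq : NonSeq K k 𝒯 Z
  disjoint_root : Disjoint R Z
  minimal : ∀ Z', EquivSep K k 𝒯 Z Z' → Disjoint R Z' →
    (crossed P Z).ncard ≤ (crossed P Z').ncard
  not_subset : ∀ i, ¬ Z ⊆ P i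
  compl_not_subset : ∀ i, ¬ K.E \ Z ⊆ P i
  notMem : Z ∉ displayedClasses K k 𝒯 P

/-- In a path, a proper non-empty set of vertices has a neighbour outside. The path arises from a
cycle by deleting `p`. -/
theorem exists_adjacent {m : ℕ} {p : Fin (m + 1)} {S : Set (Fin (m + 1))} (hp : p ∉ S)
    (hne : S.Nonempty) (hS : S ≠ {p}ᶜ) :
    ∃ i j, i ∉ S ∧ i ≠ p ∧ j ∈ S ∧ (j = cycSucc i ∨ i = cycSucc j) := by
  by_contra! hno
  have key : ∀ t : Fin (m + 1), t ≠ 0 → (p + t ∈ S ↔ p + 1 ∈ S) := by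
    intro t
    induction t using Fin.induction with
    | zero => exact fun hh => absurd rfl hh
    | succ t ih =>
      intro _
      have hs : t.succ = t.castSucc + 1 := by rw [← cycSucc_eq, cycSucc_castSucc]
      by_cases ht : t.castSucc = 0
      · rw [hs, ht, zero_add]
      · rw [← ih ht, hs, ← add_assoc]
        have n1 : p + t.castSucc ≠ p := by simpa using ht
        have n2 : p + t.castSucc + 1 ≠ p := by
          rw [add_assoc, ← hs]
          simp
        constructor
        · intro hin
          by_contra hout
          exact (hno _ _ hout n1 hin).1 (cycSucc_eq _).symm
        · intro hin
          by_contra hout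
          exact (hno _ _ hout n2 hin).2 (cycSucc_eq _).symm
  have key' : ∀ i, i ≠ p → (i ∈ S ↔ p + 1 ∈ S) := by
    intro i hi
    have := key (i - p) (sub_ne_zero.2 hi)
    rwa [add_sub_cancel] at this
  obtain ⟨j, hj⟩ := hne
  have hjp : j ≠ p := by rintro rfl; exact hp hj
  refine hS (Set.ext fun i => ⟨fun hi => ?_, fun hi => ?_⟩)
  · rintro rfl
    exact hp hi
  · exact (key' i hi).2 ((key' j hjp).1 hj)

/-- Three uncrossings show that `P j ∪ (P i ∩ Z)`, the intersection of `Z ∪ P_J`, `P i ∪ P_J` and `P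
i ∪ P j`, is `k`-separating. Then `P j` absorbs the weak set `P i ∩ Z`. -/
theorem IsFlower.inter_subset_fcl {n : ℕ} {P : Fin n → Set α} (hP : IsFlower K k 𝒯 P)
    (h : RobustIdeal K k 𝒯) {Z : Set α} (hZ : K.KSep k Z) {i j : Fin n} {J : Set (Fin n)}
    (hiJ : i ∉ J) (hjJ : j ∈ J) (hij : K.KSep k (P i ∪ P j)) (hJ : K.KSep k (petalUnion P J))
    (hw : Weak 𝒯 (P i ∩ Z)) (sJ : Strong 𝒯 (petalUnion P J ∩ Z))
    (sK : Strong 𝒯 ((K.E \ (petalUnion P J ∪ P i)) \ Z)) :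
    P i ∩ Z ⊆ fcl K k 𝒯 (P j) := by
  have ei := hP.petal_subset i
  have eJ := hJ.1
  have eZ := hZ.1
  have hj : P j ⊆ petalUnion P J := subset_petalUnion hjJ
  have hd : Disjoint (P i) (petalUnion P J) := by
    rw [disjoint_left]
    intro x hx hx'
    obtain ⟨t, ht, hxt⟩ := mem_petalUnion.1 hx'
    exact hiJ (hP.index_eq hx hxt ▸ ht)
  have kiJ : K.KSep k (P i ∪ petalUnion P J) := by
    have := hP.kSep_union h (I := {i, j}) (by rwa [petalUnion_pair]) hJ ⟨j, by simp, hjJ⟩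
    rw [petalUnion_union, petalUnion_pair] at this
    rwa [show P i ∪ P j ∪ petalUnion P J = P i ∪ petalUnion P J by grind] at this
  have k1 := h.kSep_union hZ hJ (sJ.mono (by grind)) (sK.mono (by grind))
  have k2 := h.kSep_inter k1 kiJ (sJ.mono (by grind)) (sK.mono (by grind))
  have k3 := h.kSep_inter k2 hij ((hP.strong j).mono (by grind)) (sK.mono (by grind))
  refine h.subset_fcl_of_weak (hP.strong j) hw ?_
  rwa [show ((Z ∪ petalUnion P J) ∩ (P i ∪ petalUnion P J)) ∩ (P i ∪ P j) = P j ∪ P i ∩ Z by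
    grind] at k3

namespace MinimalCrossing

variable {n : ℕ} {P : Fin n → Set α} {R X Z : Set α} (hc : MinimalCrossing K k 𝒯 P R X Z)
  (h : RobustIdeal K k 𝒯)
include hc h

/-- `Z ∪ P_I` is equivalent to `Z`, cuts no petal in `I` and no new petal outside, so minimality
leaves no cut petal in `I`. It still avoids `R`: a strong `R` does not fit into the weak set `P_I \
Z`, so its petal lies outside `I`. -/
theorem not_mem_crossed_of_diff_weak {I : Set (Fin n)} (hI : K.KSep k (petalUnion P I))
    (s : Strong 𝒯 (petalUnion P I ∩ Z)) (w : Weak 𝒯 (petalUnion P I \ Z)) {i : Fin n}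
    (hi : i ∈ I) : i ∉ crossed P Z := by
  intro hcr
  have hP := hc.optimal.flower
  have eI := hI.1
  have eZ := hc.nonSeq.kSep.1
  have hk : K.KSep k (Z ∪ petalUnion P I \ Z) := by
    have := h.kSep_union hc.nonSeq.kSep hI (s.mono (by grind))
      (hc.nonSeq.strong_compl.mono (by grind))
    rwa [show Z ∪ petalUnion P I = Z ∪ petalUnion P I \ Z by grind] at this
  have hd : Disjoint R (Z ∪ petalUnion P I \ Z) := by
    rcases hc.root_or with rfl | hs
    · exact empty_disjoint _
    · obtain ⟨j, hj⟩ := hc.optimal.root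
      have hRZ := hc.disjoint_root
      by_cases hjI : j ∈ I
      · have := subset_petalUnion (P := P) hjI
        exact absurd (w.mono (by grind)) hs
      · have : Disjoint (P j) (petalUnion P I) := by
          rw [disjoint_left]
          intro x hx hx'
          obtain ⟨t, ht, hxt⟩ := mem_petalUnion.1 hx'
          exact hjI (hP.index_eq hx hxt ▸ ht)
        grind
  refine absurd (hc.minimal _ (h.equivSep_union hc.nonSeq w hk) hd) (not_le.2 ?_)
  apply ncard_lt_ncard _ (toFinite _)
  refine ⟨fun t ht => ⟨?_, ht.2.mono (by grind)⟩, fun hsub => ?_⟩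
  · obtain ⟨⟨x, hxt, hx⟩, ⟨y, hyt, hy⟩⟩ := ht
    refine ⟨x, hxt, ?_⟩
    rcases hx with hx | hx
    · exact hx
    · exfalso
      obtain ⟨s, hs, hxs⟩ := mem_petalUnion.1 hx.1
      obtain rfl := hP.index_eq hxt hxs
      have hyI := subset_petalUnion hs hyt
      grind
  · obtain ⟨-, y, hyi, hy⟩ := hsub hcr
    have := subset_petalUnion hi hyi
    grind

/-- The same with `Z \ P_I`, which avoids `R` because it is smaller than `Z`. -/
theorem not_mem_crossed_of_inter_weak {I : Set (Fin n)} (hI : K.KSep k (petalUnion P I))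
    (w : Weak 𝒯 (petalUnion P I ∩ Z)) (s : Strong 𝒯 (petalUnion P I \ Z)) {i : Fin n}
    (hi : i ∈ I) : i ∉ crossed P Z := by
  intro hcr
  have hP := hc.optimal.flower
  have hk := h.kSep_diff hc.nonSeq.kSep hI hc.nonSeq.strong s
  refine absurd (hc.minimal _ (h.equivSep_diff hc.nonSeq (by rwa [inter_comm]) hk)
    (hc.disjoint_root.mono_right sdiff_subset)) (not_le.2 ?_)
  apply ncard_lt_ncard _ (toFinite _)
  refine ⟨fun t ht => ⟨ht.1.mono (by grind), ?_⟩, fun hsub => ?_⟩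
  · obtain ⟨⟨x, hxt, hx⟩, ⟨y, hyt, hy⟩⟩ := ht
    refine ⟨y, hyt, fun hyZ => ?_⟩
    have hyI : y ∈ petalUnion P I := by
      by_contra hyI
      exact hy ⟨hyZ, hyI⟩
    obtain ⟨s, hs, hys⟩ := mem_petalUnion.1 hyI
    obtain rfl := hP.index_eq hyt hys
    exact hx.2 (subset_petalUnion hs hxt)
  · obtain ⟨⟨x, hxi, hx⟩, -⟩ := hsub hcr
    exact hx.2 (subset_petalUnion hi hxi)

/-- In the two mixed cases `Z` could be moved within its class across the whole block of petals,
cutting fewer of them. -/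
theorem strong_or_weak {I : Set (Fin n)} (hI : K.KSep k (petalUnion P I)) {i : Fin n}
    (hi : i ∈ I) (hcr : i ∈ crossed P Z) :
    (Strong 𝒯 (petalUnion P I ∩ Z) ∧ Strong 𝒯 (petalUnion P I \ Z)) ∨
      (Weak 𝒯 (petalUnion P I ∩ Z) ∧ Weak 𝒯 (petalUnion P I \ Z)) := by
  by_cases h1 : Weak 𝒯 (petalUnion P I ∩ Z) <;> by_cases h2 : Weak 𝒯 (petalUnion P I \ Z)
  · exact Or.inr ⟨h1, h2⟩
  · exact absurd hcr (hc.not_mem_crossed_of_inter_weak h hI h1 h2 hi)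
  · exact absurd hcr (hc.not_mem_crossed_of_diff_weak h hI h1 h2 hi)
  · exact Or.inl ⟨h1, h2⟩

omit h in
theorem mem_crossed_of_weak {i : Fin n} (h1 : Weak 𝒯 (P i ∩ Z)) (h2 : Weak 𝒯 (P i \ Z)) :
    i ∈ crossed P Z := by
  constructor
  · by_contra hne
    rw [not_nonempty_iff_eq_empty] at hne
    exact hc.optimal.flower.strong i
      (h2.mono (sdiff_eq_left.2 (disjoint_iff_inter_eq_empty.2 hne)).superset)
  · by_contra hne
    rw [not_nonempty_iff_eq_empty, sdiff_eq_empty] at hne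
    exact hc.optimal.flower.strong i (h1.mono (by grind))

/-- Apply the dichotomy to the pair `{i, j}`. Strong pieces of the union must draw on `P j` on both
sides of `Z`; weak pieces of the union leave weak pieces of `P j`, and a strong petal is not
contained in one of them. -/
theorem mem_crossed_of_adjacent {i j : Fin n} (h1 : Weak 𝒯 (P i ∩ Z)) (h2 : Weak 𝒯 (P i \ Z))
    (hij : K.KSep k (P i ∪ P j)) : j ∈ crossed P Z := by
  have hcr := hc.mem_crossed_of_weak h1 h2
  have hP := hc.optimal.flower
  have sj := hP.strong j
  rcases hc.strong_or_weak h (I := {i, j}) (by rwa [petalUnion_pair]) (by simp) hcr with hs | hw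
  · rw [petalUnion_pair] at hs
    constructor
    · by_contra hne
      rw [not_nonempty_iff_eq_empty] at hne
      exact hs.1 (h1.mono (by rw [union_inter_distrib_right, hne, union_empty]))
    · by_contra hne
      rw [not_nonempty_iff_eq_empty] at hne
      exact hs.2 (h2.mono (by rw [union_sdiff_distrib, hne, union_empty]))
  · rw [petalUnion_pair] at hw
    exact hc.mem_crossed_of_weak (hw.1.mono (by grind)) (hw.2.mono (by grind))

/-- With all four quarters strong, `P j` absorbs both weak halves of its neighbour `P i`, making `P
i` loose. -/
theorem not_all_strong {i j : Fin n} {J : Set (Fin n)} (hiJ : i ∉ J) (hjJ : j ∈ J)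
    (hadj : j = cycSucc i ∨ i = cycSucc j) (hJ : K.KSep k (petalUnion P J))
    (w1 : Weak 𝒯 (P i ∩ Z)) (w2 : Weak 𝒯 (P i \ Z))
    (s1 : Strong 𝒯 (petalUnion P J ∩ Z)) (s2 : Strong 𝒯 (petalUnion P J \ Z))
    (s3 : Strong 𝒯 ((K.E \ (petalUnion P J ∪ P i)) ∩ Z))
    (s4 : Strong 𝒯 ((K.E \ (petalUnion P J ∪ P i)) \ Z)) : False := by
  have hP := hc.optimal.flower
  have eZ := hc.nonSeq.kSep.1
  have ei := hP.petal_subset i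
  have eJ := hJ.1
  have hij : K.KSep k (P i ∪ P j) := by
    rcases hadj with rfl | rfl
    · exact hP.kSep_succ i
    · rw [union_comm]
      exact hP.kSep_succ j
  refine hc.optimal.not_loosePetal h i
    ⟨j, by rintro rfl; exact hiJ hjJ, Or.inr hadj, ?_⟩
  have f1 := hP.inter_subset_fcl h hc.nonSeq.kSep hiJ hjJ hij hJ w1 s1 s4
  have e1 : P i ∩ (K.E \ Z) = P i \ Z := by grind
  have f2 := hP.inter_subset_fcl h hc.nonSeq.kSep.compl hiJ hjJ hij hJ (e1 ▸ w2)
    (s2.mono (by grind)) (s3.mono (by grind))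
  rw [e1] at f2
  rw [← inter_union_sdiff (P i) Z]
  exact union_subset f1 f2

omit h in
theorem comp {σ : Fin n ≃ Fin n} (hσ : IsFlower K k 𝒯 (P ∘ σ)) :
    MinimalCrossing K k 𝒯 (P ∘ σ) R X Z := by
  have hcr : ∀ Z, (crossed (P ∘ σ) Z).ncard = (crossed P Z).ncard := by
    intro Z
    have : crossed P Z = σ '' crossed (P ∘ σ) Z := by
      ext i
      rw [Equiv.image_eq_preimage_symm]
      simp [crossed]
    rw [this, ncard_image_of_injective _ σ.injective]
  have hd : displayedClasses K k 𝒯 (P ∘ σ) = displayedClasses K k 𝒯 P := by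
    simp only [displayedClasses, flowerDisplays_comp]
  exact ⟨hc.optimal.comp hσ, hc.root_or, hc.nonSeq, hc.disjoint_root,
    fun Z' h1 h2 => by rw [hcr, hcr]; exact hc.minimal Z' h1 h2, fun i => hc.not_subset (σ i),
    fun i => hc.compl_not_subset (σ i), hd ▸ hc.notMem⟩

/-- A refinement of `Q` displays everything that `P` does and also `Z`, against the maximality of
the displayed classes. -/
theorem false_of_splittable {m : ℕ} {Q : Fin m → Set α} (hQ : Splittable K k 𝒯 Q Z R)
    (hd : ∀ Y, NonSeq K k 𝒯 Y → FlowerDisplays K k P Y → FlowerDisplays K k Q Y) : False := by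
  obtain ⟨m', P', hP', hR, hd', hZ⟩ := hQ.exists_refinement h
  have hsub : displayedClasses K k 𝒯 P ⊆ displayedClasses K k 𝒯 P' :=
    displayedClasses_subset_of fun Y hY hYP =>
      ⟨Y, hd' Y (hd Y hY hYP), hY.strongSep.equivSep⟩
  apply hc.notMem
  rw [hc.optimal.displayedClasses_eq hP' hR hsub]
  exact ⟨hc.nonSeq, Z, hZ, hc.nonSeq.strongSep.equivSep⟩

omit hc in
/-- All petals but one being cut into two weak pieces is impossible. -/
theorem false_of_all_weak {m : ℕ} {P : Fin (m + 1) → Set α}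
    (hc : MinimalCrossing K k 𝒯 P R X Z) {p q : Fin (m + 1)} (hqp : q ≠ p)
    (w1 : ∀ i ≠ p, Weak 𝒯 (P i ∩ Z)) (w2 : ∀ i ≠ p, Weak 𝒯 (P i \ Z))
    (s1 : Strong 𝒯 (P p ∩ Z)) (s2 : Strong 𝒯 (P p \ Z)) : False := by
  have hP := hc.optimal.flower
  have ep := hP.petal_subset p
  have eZ := hc.nonSeq.kSep.1
  have hO : petalUnion P {p}ᶜ = K.E \ P p := by rw [hP.petalUnion_compl, petalUnion_singleton]
  -- Otherwise a petal in `I` has a neighbour outside `I` other than `p`. Weak pieces of `P_I`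
  -- contradict non-sequentiality; strong pieces make that neighbour loose, the strong quarters
  -- beyond it being supplied by `P p`.
  have hdisp : ∀ I : Set (Fin (m + 1)), p ∉ I → NonSeq K k 𝒯 (petalUnion P I) → I = {p}ᶜ := by
    intro I hpI hI
    by_contra hne
    have hIne : I.Nonempty := by
      rw [nonempty_iff_ne_empty]
      rintro rfl
      rw [petalUnion_empty] at hI
      exact hI.strong h.weak_empty
    obtain ⟨i, j, hiI, hip, hjI, hadj⟩ := exists_adjacent hpI hIne hne
    have hjp : j ≠ p := by rintro rfl; exact hpI hjI
    have hpK : P p ⊆ K.E \ (petalUnion P I ∪ P i) := by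
      intro x hx
      refine ⟨ep hx, ?_⟩
      rintro (hx' | hx')
      · obtain ⟨t, ht, hxt⟩ := mem_petalUnion.1 hx'
        exact hpI (hP.index_eq hx hxt ▸ ht)
      · exact hip (hP.index_eq hx' hx)
    rcases hc.strong_or_weak h hI.kSep hjI (hc.mem_crossed_of_weak (w1 j hjp) (w2 j hjp))
      with hs | hw
    · exact hc.not_all_strong h hiI hjI hadj hI.kSep (w1 i hip) (w2 i hip) hs.1 hs.2
        (s1.mono (by grind)) (s2.mono (by grind))
    · exact h.not_subset_union hI hw.1 hw.2 (by grind)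
  have hdisp' : ∀ Y, NonSeq K k 𝒯 Y → FlowerDisplays K k P Y → Y = P p ∨ Y = K.E \ P p := by
    rintro Y hY ⟨-, I, rfl⟩
    by_cases hpI : p ∈ I
    · have := hdisp Iᶜ (by simpa using hpI) (by rw [hP.petalUnion_compl]; exact hY.compl)
      rw [compl_inj_iff] at this
      rw [this, petalUnion_singleton]
      exact Or.inl rfl
    · rw [hdisp I hpI hY, hO]
      exact Or.inr rfl
  have hcompl : NonSeq K k 𝒯 (K.E \ P p) := by
    obtain ⟨hX, W, hW, he⟩ := hc.optimal.mem
    have hWn := hX.of_equivSep he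
    rcases hdisp' W hWn hW with rfl | rfl
    · exact hWn.compl
    · exact hWn
  obtain ⟨sO1, sO2⟩ : Strong 𝒯 ((K.E \ P p) ∩ Z) ∧ Strong 𝒯 ((K.E \ P p) \ Z) := by
    rcases hc.strong_or_weak h (I := {p}ᶜ) (hO ▸ hcompl.kSep) hqp
      (hc.mem_crossed_of_weak (w1 q hqp) (w2 q hqp)) with hs | hw
    · rwa [hO] at hs
    · rw [hO] at hw
      exact absurd (by grind) (h.not_subset_union hcompl hw.1 hw.2)
  have hpair : ∀ p' : Set α → Prop, p' (P p) → p' (K.E \ P p) →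
      ∀ i, p' ((![P p, K.E \ P p] : Fin 2 → Set α) i) := by
    intro p' h1 h2 i
    fin_cases i
    exacts [h1, h2]
  have hss : StrongSep K k 𝒯 (P p) := by
    have := hcompl.compl.strongSep
    rwa [sdiff_sdiff_cancel_left ep] at this
  -- All displayed non-sequential separations are given by `P p` alone, so this two-petal flower
  -- displays them too. It may be split along `Z` since its four pieces are strong.
  refine hc.false_of_splittable h (Q := ![P p, K.E \ P p])
    ⟨IsFlower.of_strongSep hss h.kSep_ground, hc.nonSeq.kSep,
    hpair (fun S => (S ∩ Z).Nonempty → Strong 𝒯 (S ∩ Z)) (fun _ => s1) fun _ => sO1,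
    hpair (fun S => (S \ Z).Nonempty → Strong 𝒯 (S \ Z)) (fun _ => s2) fun _ => sO2,
    hpair (fun S => ¬ Z ⊆ S) ?_ ?_, hpair (fun S => ¬ K.E \ Z ⊆ S) ?_ ?_, ?_, hc.disjoint_root⟩ ?_
  · exact hc.not_subset p
  · intro hsub
    obtain ⟨x, hx, hxZ⟩ := h.strong_nonempty s1
    exact (hsub hxZ).2 hx
  · exact hc.compl_not_subset p
  · intro hsub
    obtain ⟨x, hx, hxZ⟩ := h.strong_nonempty s2
    exact (hsub ⟨ep hx, hxZ⟩).2 hx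
  · obtain ⟨j, hj⟩ := hc.optimal.root
    by_cases hjp : j = p
    · exact ⟨0, hjp ▸ hj⟩
    · refine ⟨1, hj.trans ?_⟩
      change P j ⊆ K.E \ P p
      rw [← hO]
      exact subset_petalUnion hjp
  · intro Y hY hYP
    have hd := IsFlower.displays_of_strongSep (K := K) (k := k) hss.1
    rcases hdisp' Y hY hYP with rfl | rfl
    · exact hd
    · exact (IsFlower.of_strongSep hss h.kSep_ground).flowerDisplays_compl hd

omit hc in
/-- The first petal is not cut into two weak pieces. -/
theorem false_of_zero_weak {m : ℕ} {P : Fin (m + 1) → Set α}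
    (hc : MinimalCrossing K k 𝒯 P R X Z)
    (w1 : Weak 𝒯 (P 0 ∩ Z)) (w2 : Weak 𝒯 (P 0 \ Z)) : False := by
  have hP := hc.optimal.flower
  have e0 := hP.petal_subset 0
  have eZ := hc.nonSeq.kSep.1
  have hm : 0 < m := by
    rcases Nat.eq_zero_or_pos m with rfl | hm
    · refine absurd (fun x hx => ?_) (hc.not_subset 0)
      obtain ⟨j, hj⟩ := hP.exists_mem (eZ hx)
      rwa [show 0 = j from Subsingleton.elim (α := Fin 1) 0 j]
    · exact hm
  have h1v : (1 : Fin (m + 1)).val = 1 := by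
    rw [Fin.val_one']
    exact Nat.mod_eq_of_lt (by omega)
  have hone : (1 : Fin (m + 1)) ∈ crossed P Z := by
    apply hc.mem_crossed_of_adjacent h w1 w2
    have := hP.kSep_succ 0
    rwa [cycSucc_eq, zero_add] at this
  have hlast : Fin.last m ∈ crossed P Z := by
    apply hc.mem_crossed_of_adjacent h w1 w2
    have := hP.kSep_succ (Fin.last m)
    rwa [cycSucc_last, union_comm] at this
  -- Blocks of petals starting right after the weakly cut petal `0`. Petal `1` is cut, so each
  -- non-empty block is cut into two strong or two weak pieces; the first strong block singles out
  -- its last petal `p`.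
  let S : ℕ → Prop := fun j => Strong 𝒯 (petalUnion P {t | 1 ≤ t.val ∧ t.val ≤ j} ∩ Z) ∧
    Strong 𝒯 (petalUnion P {t | 1 ≤ t.val ∧ t.val ≤ j} \ Z)
  have hSW : ∀ j, ¬ S j → Weak 𝒯 (petalUnion P {t | 1 ≤ t.val ∧ t.val ≤ j} ∩ Z) ∧
      Weak 𝒯 (petalUnion P {t | 1 ≤ t.val ∧ t.val ≤ j} \ Z) := by
    intro j hj
    rcases Nat.eq_zero_or_pos j with rfl | hj0
    · have : petalUnion P {t | 1 ≤ t.val ∧ t.val ≤ 0} = ∅ := by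
        rw [show {t : Fin (m + 1) | 1 ≤ t.val ∧ t.val ≤ 0} = ∅ by
          ext t
          simp only [mem_ofPred_eq, mem_empty_iff_false, iff_false]
          omega, petalUnion_empty]
      rw [this, empty_inter, empty_sdiff]
      exact ⟨h.weak_empty, h.weak_empty⟩
    · refine (hc.strong_or_weak h (hP.kSep_interval h 1 j) ?_ hone).resolve_left hj
      simp only [mem_ofPred_eq, h1v]
      omega
  -- If even the block of all petals but the first were cut into weak pieces, four weak sets would
  -- cover `E`.
  have hex : ∃ j, S j := by
    refine ⟨m, ?_⟩
    by_contra hno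
    obtain ⟨v1, v2⟩ := hSW m hno
    refine h.not_cover_eight w1 w2 v1 v2 w1 w2 v1 v2 ?_
    rw [union_self]
    intro x hx
    obtain ⟨i, hi⟩ := hP.exists_mem hx
    by_cases hi0 : i = 0
    · subst hi0
      grind
    · have : x ∈ petalUnion P {t | 1 ≤ t.val ∧ t.val ≤ m} :=
        mem_petalUnion.2 ⟨i, ⟨by rw [Fin.ext_iff, Fin.val_zero] at hi0; omega, by omega⟩, hi⟩
      grind
  classical
  have hSp := Nat.find_spec hex
  have hmin := fun t (ht : t < Nat.find hex) => Nat.find_min hex ht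
  generalize Nat.find hex = p at hSp hmin
  have hp0 : 0 < p := by
    rcases Nat.eq_zero_or_pos p with rfl | hp
    · obtain ⟨x, hx, -⟩ := h.strong_nonempty hSp.1
      obtain ⟨t, ht, -⟩ := mem_petalUnion.1 hx
      simp only [mem_ofPred_eq] at ht
      omega
    · exact hp
  have hpm : p ≤ m := by
    by_contra hlt
    refine hmin m (by omega) ?_
    have : {t : Fin (m + 1) | 1 ≤ t.val ∧ t.val ≤ m} = {t | 1 ≤ t.val ∧ t.val ≤ p} := by
      ext t
      simp only [mem_ofPred_eq]
      omega
    simp only [S, this]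
    exact hSp
  obtain ⟨a1, a2⟩ := hSW (p - 1) (hmin _ (by omega))
  -- The block behind `p` contains the last petal, which is cut. Were its pieces strong, petal `0`,
  -- lying between two blocks with strong pieces, would be loose through its neighbour `1`.
  obtain ⟨b1, b2⟩ : Weak 𝒯 (petalUnion P {t | p + 1 ≤ t.val ∧ t.val ≤ m} ∩ Z) ∧
      Weak 𝒯 (petalUnion P {t | p + 1 ≤ t.val ∧ t.val ≤ m} \ Z) := by
    by_cases hpm' : p = m
    · have : petalUnion P {t | p + 1 ≤ t.val ∧ t.val ≤ m} = ∅ := by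
        rw [show {t : Fin (m + 1) | p + 1 ≤ t.val ∧ t.val ≤ m} = ∅ by
          ext t
          simp only [mem_ofPred_eq, mem_empty_iff_false, iff_false]
          omega, petalUnion_empty]
      rw [this, empty_inter, empty_sdiff]
      exact ⟨h.weak_empty, h.weak_empty⟩
    · refine (hc.strong_or_weak h (hP.kSep_interval h (p + 1) m) (i := Fin.last m) ?_
        hlast).resolve_left ?_
      · simp only [mem_ofPred_eq, Fin.val_last]
        omega
      · intro hs
        have hK : petalUnion P {t | p + 1 ≤ t.val ∧ t.val ≤ m} ⊆
            K.E \ (petalUnion P {t | 1 ≤ t.val ∧ t.val ≤ p} ∪ P 0) := by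
          intro x hx
          obtain ⟨t, ht, hxt⟩ := mem_petalUnion.1 hx
          simp only [mem_ofPred_eq] at ht
          refine ⟨hP.petal_subset t hxt, ?_⟩
          rintro (hx' | hx')
          · obtain ⟨t', ht', hxt'⟩ := mem_petalUnion.1 hx'
            obtain rfl := hP.index_eq hxt hxt'
            simp only [mem_ofPred_eq] at ht'
            omega
          · obtain rfl := hP.index_eq hxt hx'
            simp only [Fin.val_zero] at ht
            omega
        refine hc.not_all_strong h (i := 0) (j := 1) (J := {t | 1 ≤ t.val ∧ t.val ≤ p}) ?_ ?_ ?_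
          (hP.kSep_interval h 1 p) w1 w2 hSp.1 hSp.2 (hs.1.mono (by grind)) (hs.2.mono (by grind))
        · simp
        · simp only [mem_ofPred_eq, h1v]
          omega
        · left
          rw [cycSucc_eq, zero_add]
  let p' : Fin (m + 1) := ⟨p, by omega⟩
  have hsub : ∀ i ≠ p', P i ⊆ P 0 ∪ petalUnion P {t | 1 ≤ t.val ∧ t.val ≤ p - 1} ∪
      petalUnion P {t | p + 1 ≤ t.val ∧ t.val ≤ m} := by
    intro i hi x hx
    rw [Ne, Fin.ext_iff] at hi
    simp only [p'] at hi
    have := i.2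
    rcases Nat.lt_trichotomy i.val p with hlt | heq | hgt
    · by_cases hi0 : i = 0
      · exact Or.inl (Or.inl (hi0 ▸ hx))
      · rw [Fin.ext_iff, Fin.val_zero] at hi0
        exact Or.inl (Or.inr (mem_petalUnion.2 ⟨i, ⟨by omega, by omega⟩, hx⟩))
    · exact absurd heq hi
    · exact Or.inr (mem_petalUnion.2 ⟨i, ⟨by omega, by omega⟩, hx⟩)
  have hwk : ∀ i ≠ p', Weak 𝒯 (P i ∩ Z) ∧ Weak 𝒯 (P i \ Z) := by
    intro i hi
    rw [Ne, Fin.ext_iff] at hi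
    simp only [p'] at hi
    have := i.2
    by_cases hi0 : i = 0
    · rw [hi0]
      exact ⟨w1, w2⟩
    rw [Fin.ext_iff, Fin.val_zero] at hi0
    rcases Nat.lt_trichotomy i.val p with hlt | heq | hgt
    · have := subset_petalUnion (P := P) (I := {t | 1 ≤ t.val ∧ t.val ≤ p - 1}) (i := i)
        ⟨by omega, by omega⟩
      exact ⟨a1.mono (inter_subset_inter_left _ this), a2.mono (sdiff_subset_sdiff_left this)⟩
    · exact absurd heq hi
    · have := subset_petalUnion (P := P) (I := {t | p + 1 ≤ t.val ∧ t.val ≤ m}) (i := i)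
        ⟨by omega, by omega⟩
      exact ⟨b1.mono (inter_subset_inter_left _ this), b2.mono (sdiff_subset_sdiff_left this)⟩
  have hp0' : (0 : Fin (m + 1)) ≠ p' := by
    rw [Ne, Fin.ext_iff]
    simp only [p', Fin.val_zero]
    omega
  have hpc : p' ∈ crossed P Z := by
    let q : Fin (m + 1) := ⟨p - 1, by omega⟩
    have hq : q ≠ p' := by
      rw [Ne, Fin.ext_iff]
      simp only [p', q]
      omega
    apply hc.mem_crossed_of_adjacent h (hwk q hq).1 (hwk q hq).2
    have := hP.kSep_succ q
    rwa [cycSucc_mk (n := m + 1) (i := p - 1) (by omega) (by omega),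
      show (⟨p - 1 + 1, by omega⟩ : Fin (m + 1)) = p' from Fin.ext (by simp only [p']; omega)]
      at this
  rcases hc.strong_or_weak h (I := {p'}) (by rw [petalUnion_singleton]; exact hP.kSep p')
    rfl hpc with hs | hw
  · rw [petalUnion_singleton] at hs
    exact hc.false_of_all_weak h hp0' (fun i hi => (hwk i hi).1) (fun i hi => (hwk i hi).2)
      hs.1 hs.2
  · rw [petalUnion_singleton] at hw
    -- Here the number eight arises: petal `0`, the block before `p`, the block after `p`, and `p`
    -- itself, each cut into two weak pieces.
    refine h.not_cover_eight w1 w2 a1 a2 b1 b2 hw.1 hw.2 ?_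
    intro x hx
    obtain ⟨i, hi⟩ := hP.exists_mem hx
    by_cases hip : i = p'
    · rw [hip] at hi
      by_cases hxZ : x ∈ Z <;> simp [hi, hxZ]
    · by_cases hxZ : x ∈ Z <;> rcases hsub i hip hi with (hx' | hx') | hx' <;>
        simp only [mem_union, mem_inter_iff, mem_sdiff, hx', hxZ, true_and, not_true, not_false_eq_true,
          and_true, true_or, or_true]

/-- A petal with two weak pieces can be rotated to index `0`. Without one, all cut petals have
strong pieces and `P` itself is splittable along `Z`. -/
theorem false : False := by
  have hP := hc.optimal.flower
  by_cases hw : ∃ i, Weak 𝒯 (P i ∩ Z) ∧ Weak 𝒯 (P i \ Z)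
  · obtain ⟨i, w1, w2⟩ := hw
    obtain ⟨m, rfl⟩ := Nat.exists_eq_succ_of_ne_zero hP.pos.ne'
    exact (hc.comp (hP.rotate i)).false_of_zero_weak h (by simpa using w1) (by simpa using w2)
  · push Not at hw
    have hcr : ∀ i ∈ crossed P Z, Strong 𝒯 (P i ∩ Z) ∧ Strong 𝒯 (P i \ Z) := by
      intro i hi
      have := hc.strong_or_weak h (I := {i}) (by rw [petalUnion_singleton]; exact hP.kSep i)
        rfl hi
      rw [petalUnion_singleton] at this
      exact this.resolve_right fun hh => hw i hh.1 hh.2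
    refine hc.false_of_splittable h (Q := P) ⟨hP, hc.nonSeq.kSep, ?_, ?_, hc.not_subset,
      hc.compl_not_subset, hc.optimal.root, hc.disjoint_root⟩ fun _ _ hY => hY
    · intro i hi
      by_cases hi' : (P i \ Z).Nonempty
      · exact (hcr i ⟨hi, hi'⟩).1
      · rw [not_nonempty_iff_eq_empty, sdiff_eq_empty] at hi'
        rw [inter_eq_left.2 hi']
        exact hP.strong i
    · intro i hi
      by_cases hi' : (P i ∩ Z).Nonempty
      · exact (hcr i ⟨hi', hi⟩).2
      · rw [not_nonempty_iff_eq_empty, ← disjoint_iff_inter_eq_empty] at hi'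
        rw [sdiff_eq_left.2 hi']
        exact hP.strong i

end MinimalCrossing

/-- Every non-sequential separation avoiding `R` conforms with an optimal flower. -/
theorem OptimalFlower.conforms {n : ℕ} {P : Fin n → Set α} {R X Z : Set α}
    (hP : OptimalFlower K k 𝒯 P R X) (h : RobustIdeal K k 𝒯) (hR : R = ∅ ∨ Strong 𝒯 R)
    (hZ : NonSeq K k 𝒯 Z) (hd : Disjoint R Z) :
    ∃ Z', EquivSep K k 𝒯 Z Z' ∧ Disjoint R Z' ∧
      (Z' ∈ displayedClasses K k 𝒯 P ∨ ∃ i, Z' ⊆ P i ∨ K.E \ Z' ⊆ P i) := by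
  classical
  -- Only representatives that avoid `R` compete for the minimum number of cut petals.
  have hex : ∃ c Z', EquivSep K k 𝒯 Z Z' ∧ Disjoint R Z' ∧ (crossed P Z').ncard = c :=
    ⟨_, Z, hZ.strongSep.equivSep, hd, rfl⟩
  obtain ⟨Z', he, hd', hcard⟩ := Nat.find_spec hex
  refine ⟨Z', he, hd', ?_⟩
  by_contra! hno
  refine MinimalCrossing.false (P := P) (R := R) (X := X) (Z := Z') ⟨hP, hR, hZ.of_equivSep he, hd',
    ?_, fun i => (hno.2 i).1, fun i => (hno.2 i).2, hno.1⟩ h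
  intro Z'' he' hd''
  rw [hcard]
  exact Nat.find_min' hex ⟨Z'', he.trans he', hd'', rfl⟩

end

section

/-! ### Reachability -/

section Graph

variable {V W : Type*} {G : SimpleGraph V} {H : SimpleGraph W}

/-- Edges may be contracted by `f`, so this also covers the retractions of a joined graph onto its
two parts. -/
theorem reachable_of_map (f : V → W) (hf : ∀ x y, G.Adj x y → f x = f y ∨ H.Adj (f x) (f y))
    {x y : V} (hxy : G.Reachable x y) : H.Reachable (f x) (f y) := by
  obtain ⟨p⟩ := hxy
  induction p with
  | nil => exact SimpleGraph.Reachable.refl _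
  | cons hadj _ ih =>
    rcases hf _ _ hadj with he | ha
    · rwa [he]
    · exact ha.reachable.trans ih

theorem reachable_invariant {p : V → Prop} (hp : ∀ x y, G.Adj x y → p x → p y) {x y : V}
    (hxy : G.Reachable x y) (hx : p x) : p y := by
  obtain ⟨w⟩ := hxy
  induction w with
  | nil => exact hx
  | cons hadj _ ih => exact ih (hp _ _ hadj hx)

/-- The disjoint union of two graphs together with an edge joining `v` and `w`. -/
def joinGraph (G : SimpleGraph V) (H : SimpleGraph W) (v : V) (w : W) : SimpleGraph (V ⊕ W) where
  Adj
    | .inl x, .inl y => G.Adj x y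
    | .inr x, .inr y => H.Adj x y
    | .inl x, .inr y => x = v ∧ y = w
    | .inr x, .inl y => y = v ∧ x = w
  symm := ⟨by
    rintro (x | x) (y | y) hxy
    · exact G.symm.symm _ _ hxy
    · exact hxy
    · exact hxy
    · exact H.symm.symm _ _ hxy⟩
  loopless := ⟨by
    rintro (x | x) hx
    · exact G.loopless.irrefl x hx
    · exact H.loopless.irrefl x hx⟩

variable {v : V} {w : W}

/-- Contracting the attached graph onto `v` gives one direction; since it is connected and hangs on
`v`, the other holds too. -/
theorem joinGraph_reachable_inl {x y : V} (z : V ⊕ W) (hH : H.Connected) :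
    ((joinGraph G H v w).deleteEdges {s(Sum.inl x, Sum.inl y)}).Reachable (Sum.inl y) z ↔
      (G.deleteEdges {s(x, y)}).Reachable y (Sum.elim id (fun _ => v) z) := by
  constructor
  · intro hr
    refine reachable_of_map (Sum.elim id (fun _ => v)) ?_ hr
    rintro (a | a) (b | b) hab <;> rw [SimpleGraph.deleteEdges_adj] at hab
    · right
      rw [SimpleGraph.deleteEdges_adj]
      refine ⟨hab.1, fun he => hab.2 ?_⟩
      simp only [mem_singleton_iff, Sym2.eq_iff, Sum.elim_inl, id] at he ⊢
      simpa using he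
    · exact Or.inl hab.1.1
    · exact Or.inl hab.1.1.symm
    · exact Or.inl rfl
  · intro hr
    have lift : ∀ a b, (G.deleteEdges {s(x, y)}).Reachable a b →
        ((joinGraph G H v w).deleteEdges {s(Sum.inl x, Sum.inl y)}).Reachable
          (Sum.inl a) (Sum.inl b) := by
      intro a b hab
      refine reachable_of_map Sum.inl ?_ hab
      intro c d hcd
      rw [SimpleGraph.deleteEdges_adj] at hcd
      right
      rw [SimpleGraph.deleteEdges_adj]
      refine ⟨hcd.1, fun he => hcd.2 ?_⟩
      simp only [mem_singleton_iff, Sym2.eq_iff] at he ⊢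
      simpa using he
    rcases z with z | z
    · exact lift _ _ hr
    · refine (lift _ _ hr).trans (SimpleGraph.Reachable.trans (v := Sum.inr w) ?_ ?_)
      · apply SimpleGraph.Adj.reachable
        rw [SimpleGraph.deleteEdges_adj]
        exact ⟨⟨rfl, rfl⟩, by simp⟩
      · refine reachable_of_map Sum.inr ?_ (hH.preconnected w z)
        intro c d hcd
        right
        rw [SimpleGraph.deleteEdges_adj]
        exact ⟨hcd, by simp⟩

theorem joinGraph_reachable_inr (z : V ⊕ W) (hH : H.Connected) :
    ((joinGraph G H v w).deleteEdges {s(Sum.inl v, Sum.inr w)}).Reachable (Sum.inr w) z ↔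
      ∃ c, z = Sum.inr c := by
  constructor
  · intro hr
    refine reachable_invariant (p := fun z => ∃ c, z = Sum.inr c) ?_ hr ⟨w, rfl⟩
    rintro (a | a) (b | b) hab ⟨c, hc⟩
    · exact absurd hc (by simp)
    · exact ⟨b, rfl⟩
    · rw [SimpleGraph.deleteEdges_adj] at hab
      obtain ⟨⟨rfl, rfl⟩, h2⟩ := hab
      exact absurd Sym2.eq_swap h2
    · exact ⟨b, rfl⟩
  · rintro ⟨c, rfl⟩
    refine reachable_of_map Sum.inr ?_ (hH.preconnected w c)
    intro a b hab
    right
    rw [SimpleGraph.deleteEdges_adj]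
    exact ⟨hab, by simp⟩

/-- Acyclicity is checked through bridges: an old edge stays a bridge because the other part can be
contracted onto its end of the joining edge. -/
theorem joinGraph_isTree (hG : G.IsTree) (hH : H.IsTree) : (joinGraph G H v w).IsTree := by
  refine ⟨?_, ?_⟩
  · rw [SimpleGraph.connected_iff_exists_forall_reachable]
    refine ⟨Sum.inl v, ?_⟩
    rintro (z | z)
    · exact reachable_of_map Sum.inl (fun a b hab => Or.inr hab) (hG.connected.preconnected v z)
    · exact (SimpleGraph.Adj.reachable (show (joinGraph G H v w).Adj (Sum.inl v) (Sum.inr w) from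
        ⟨rfl, rfl⟩)).trans
        (reachable_of_map Sum.inr (fun a b hab => Or.inr hab) (hH.connected.preconnected w z))
  · have hGb := SimpleGraph.isAcyclic_iff_forall_adj_isBridge.1 hG.isAcyclic
    have hHb := SimpleGraph.isAcyclic_iff_forall_adj_isBridge.1 hH.isAcyclic
    have hjoint : (joinGraph G H v w).IsBridge s(Sum.inl v, Sum.inr w) := by
      rw [SimpleGraph.isBridge_iff]
      intro hr
      obtain ⟨c, hc⟩ := (joinGraph_reachable_inr _ hH.connected).1 hr.symm
      simp at hc
    rw [SimpleGraph.isAcyclic_iff_forall_adj_isBridge]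
    rintro (a | a) (b | b) hab
    · rw [SimpleGraph.isBridge_iff]
      intro hr
      exact SimpleGraph.isBridge_iff.1 (hGb hab)
        ((joinGraph_reachable_inl _ hH.connected).1 hr.symm).symm
    · obtain ⟨rfl, rfl⟩ := hab
      exact hjoint
    · obtain ⟨rfl, rfl⟩ := hab
      rw [Sym2.eq_swap]
      exact hjoint
    · rw [SimpleGraph.isBridge_iff]
      intro hr
      refine SimpleGraph.isBridge_iff.1 (hHb hab)
        (reachable_of_map (Sum.elim (fun _ => w) id) ?_ hr)
      rintro (c | c) (d | d) hcd <;> rw [SimpleGraph.deleteEdges_adj] at hcd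
      · exact Or.inl rfl
      · exact Or.inl hcd.1.2.symm
      · exact Or.inl hcd.1.2
      · right
        rw [SimpleGraph.deleteEdges_adj]
        refine ⟨hcd.1, fun he => hcd.2 ?_⟩
        simp only [mem_singleton_iff, Sym2.eq_iff, Sum.elim_inr, id] at he ⊢
        simpa using he

end Graph

/-! ### Sides of edges -/

namespace LabelledTree

variable {E : Set α} (T : LabelledTree E)

theorem mem_bagUnion {U : Set T.V} {x : α} :
    x ∈ T.bagUnion U ↔ ∃ v ∈ U, x ∈ (T.label v).toSet := by
  simp [bagUnion]

theorem not_reachable_of_adj {v w : T.V} (hvw : T.graph.Adj v w) :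
    ¬ (T.graph.deleteEdges {s(v, w)}).Reachable v w :=
  SimpleGraph.isBridge_iff.1
    (SimpleGraph.isAcyclic_iff_forall_adj_isBridge.1 T.isTree.isAcyclic hvw)

theorem reachable_or {v w : T.V} (x : T.V) :
    (T.graph.deleteEdges {s(v, w)}).Reachable v x ∨
      (T.graph.deleteEdges {s(v, w)}).Reachable w x := by
  refine reachable_invariant (p := fun x => (T.graph.deleteEdges {s(v, w)}).Reachable v x ∨
      (T.graph.deleteEdges {s(v, w)}).Reachable w x) ?_ (T.isTree.connected.preconnected v x)
      (Or.inl (SimpleGraph.Reachable.refl _))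
  intro a b hab hp
  by_cases he : s(a, b) = s(v, w)
  · rw [Sym2.eq_iff] at he
    rcases he with ⟨rfl, rfl⟩ | ⟨rfl, rfl⟩
    · exact Or.inr (SimpleGraph.Reachable.refl _)
    · exact Or.inl (SimpleGraph.Reachable.refl _)
  · have hab' : (T.graph.deleteEdges {s(v, w)}).Reachable a b := by
      apply SimpleGraph.Adj.reachable
      rw [SimpleGraph.deleteEdges_adj]
      exact ⟨hab, he⟩
    exact hp.imp (fun hr => hr.trans hab') fun hr => hr.trans hab'

theorem index_eq {v w : T.V} {x : α} (hv : x ∈ (T.label v).toSet) (hw : x ∈ (T.label w).toSet) :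
    v = w := by
  by_contra hne
  exact (T.disjoint hne).le_bot ⟨hv, hw⟩

theorem label_subset (v : T.V) : (T.label v).toSet ⊆ E :=
  (subset_iUnion (fun v => (T.label v).toSet) v).trans T.union_eq.subset

theorem edgeSide_compl {v w : T.V} (hvw : T.graph.Adj v w) :
    E \ T.edgeSide v w = T.edgeSide w v := by
  have hsw : s(w, v) = s(v, w) := Sym2.eq_swap
  ext x
  simp only [edgeSide, mem_sdiff, mem_bagUnion, mem_ofPred_eq, hsw]
  constructor
  · rintro ⟨hxE, hn⟩
    rw [← T.union_eq, mem_iUnion] at hxE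
    obtain ⟨y, hy⟩ := hxE
    rcases T.reachable_or (v := v) (w := w) y with hr | hr
    · exact ⟨y, hr, hy⟩
    · exact absurd ⟨y, hr, hy⟩ hn
  · rintro ⟨y, hr, hy⟩
    refine ⟨T.label_subset y hy, ?_⟩
    rintro ⟨z, hr', hz⟩
    obtain rfl := T.index_eq hy hz
    exact T.not_reachable_of_adj hvw (hr.trans hr'.symm)

theorem edgeSide_disjoint {v w : T.V} (hvw : T.graph.Adj v w) :
    Disjoint (T.label v).toSet (T.edgeSide v w) := by
  rw [disjoint_left]
  intro x hx hx'
  obtain ⟨y, hy, hxy⟩ := T.mem_bagUnion.1 hx'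
  obtain rfl := T.index_eq hx hxy
  exact T.not_reachable_of_adj hvw (SimpleGraph.Reachable.symm hy)

/-- In a tree, the component of `T - v` and that of `T \ vw` which contain `w` agree. -/
theorem branch_eq_edgeSide {v w : T.V} (hvw : T.graph.Adj v w) :
    T.branch v w = T.edgeSide v w := by
  unfold branch edgeSide
  congr 1
  ext x
  simp only [mem_ofPred_eq]
  rw [SimpleGraph.reachable_deleteEdges_iff_exists_walk]
  constructor
  · rintro ⟨p, hp⟩
    exact ⟨p, fun he => hp (p.fst_mem_support_of_mem_edges he)⟩
  · rintro ⟨p, hp⟩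
    refine ⟨p, fun hv => ?_⟩
    classical
    refine T.not_reachable_of_adj hvw (SimpleGraph.Reachable.symm ?_)
    rw [SimpleGraph.reachable_deleteEdges_iff_exists_walk]
    exact ⟨p.takeUntil v hv, fun he => hp (p.edges_takeUntil_subset_edges hv he)⟩

theorem petals_apply (v : T.V) {n : ℕ} (e : Fin n ≃ T.graph.neighborSet v) (i : Fin n) :
    T.petals v e i = T.edgeSide v (e i) := T.branch_eq_edgeSide (e i).2

/-! ### Grafting a tree onto a vertex -/

/-- The data of a labelled tree that is attached by an edge to a bag vertex `v` of `T`, and whose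
bags, together with a new bag `B` for `v`, partition the old bag of `v`. -/
structure Scion (v : T.V) where
  W : Type
  finite_W : Finite W
  graph : SimpleGraph W
  isTree : graph.IsTree
  root : W
  label : W → VertexLabel α
  B : Set α
  disjoint : Pairwise fun c d => Disjoint (label c).toSet (label d).toSet
  disjoint_B : ∀ c, Disjoint B (label c).toSet
  union_eq : B ∪ (⋃ c, (label c).toSet) = (T.label v).toSet

variable {T} {v : T.V} (S : T.Scion v)

open Classical in
/-- The tree obtained from `T` by attaching `S` at `v`. -/
noncomputable def graft : LabelledTree E where
  V := T.V ⊕ S.W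
  finite_V := by
    have := T.finite_V
    have := S.finite_W
    infer_instance
  graph := joinGraph T.graph S.graph v S.root
  isTree := joinGraph_isTree T.isTree S.isTree
  label := Sum.elim (Function.update T.label v (.bag S.B)) S.label
  disjoint := by
    have hsub : ∀ c, (S.label c).toSet ⊆ (T.label v).toSet := fun c =>
      (subset_iUnion (fun c => (S.label c).toSet) c).trans
        (subset_union_right.trans S.union_eq.subset)
    have hB : S.B ⊆ (T.label v).toSet := subset_union_left.trans S.union_eq.subset
    have key : ∀ x c, Disjoint (Function.update T.label v (.bag S.B) x).toSet
        (S.label c).toSet := by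
      intro x c
      by_cases hx : x = v
      · subst hx
        rw [Function.update_self]
        exact S.disjoint_B c
      · rw [Function.update_of_ne hx]
        exact (T.disjoint hx).mono_right (hsub c)
    rintro (x | c) (y | d) hne
    · have hxy : x ≠ y := fun he => hne (by rw [he])
      simp only [Sum.elim_inl]
      by_cases hx : x = v
      · subst hx
        rw [Function.update_self, Function.update_of_ne hxy.symm]
        exact (T.disjoint hxy).mono_left hB
      · rw [Function.update_of_ne hx]
        by_cases hy : y = v
        · subst hy
          rw [Function.update_self]
          exact (T.disjoint hxy).mono_right hB
        · rw [Function.update_of_ne hy]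
          exact T.disjoint hxy
    · exact key x d
    · exact (key y c).symm
    · exact S.disjoint fun he => hne (by rw [he])
  union_eq := by
    refine Eq.trans ?_ T.union_eq
    ext x
    simp only [mem_iUnion, Sum.exists, Sum.elim_inl, Sum.elim_inr]
    have hv : x ∈ (T.label v).toSet ↔ x ∈ S.B ∨ ∃ c, x ∈ (S.label c).toSet := by
      rw [← S.union_eq]
      simp
    constructor
    · rintro (⟨y, hy⟩ | hc)
      · by_cases hyv : y = v
        · subst hyv
          rw [Function.update_self] at hy
          exact ⟨_, hv.2 (Or.inl hy)⟩
        · rw [Function.update_of_ne hyv] at hy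
          exact ⟨y, hy⟩
      · exact ⟨v, hv.2 (Or.inr hc)⟩
    · rintro ⟨y, hy⟩
      by_cases hyv : y = v
      · subst hyv
        rcases hv.1 hy with hB | hc
        · exact Or.inl ⟨y, by rwa [Function.update_self]⟩
        · exact Or.inr hc
      · exact Or.inl ⟨y, by rwa [Function.update_of_ne hyv]⟩

theorem graft_label_self : (graft S).label (Sum.inl v) = .bag S.B := by
  classical
  simp only [graft, Sum.elim_inl, Function.update_self]

theorem graft_label_of_ne {x : T.V} (hx : x ≠ v) :
    (graft S).label (Sum.inl x) = T.label x := by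
  classical
  simp only [graft, Sum.elim_inl]
  exact Function.update_of_ne hx _ _

/-- The bags of the scion and the new bag of `v` make up the old bag of `v`, so contracting the
scion onto `v` loses nothing. Hence the old edges display the same separations. -/
theorem graft_bagUnion (U : Set T.V) :
    (graft S).bagUnion {z | Sum.elim id (fun _ => v) z ∈ U} = T.bagUnion U := by
  ext x
  rw [mem_bagUnion, mem_bagUnion]
  have hv : x ∈ (T.label v).toSet ↔ x ∈ S.B ∨ ∃ c, x ∈ (S.label c).toSet := by
    rw [← S.union_eq]
    simp
  constructor
  · rintro ⟨z | c, hz, hx⟩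
    · by_cases hzv : z = v
      · subst hzv
        rw [graft_label_self] at hx
        exact ⟨z, hz, hv.2 (Or.inl hx)⟩
      · rw [graft_label_of_ne S hzv] at hx
        exact ⟨z, hz, hx⟩
    · exact ⟨v, hz, hv.2 (Or.inr ⟨c, hx⟩)⟩
  · rintro ⟨y, hy, hx⟩
    by_cases hyv : y = v
    · subst hyv
      rcases hv.1 hx with hB | ⟨c, hc⟩
      · exact ⟨Sum.inl y, hy, by rwa [graft_label_self]⟩
      · exact ⟨Sum.inr c, hy, hc⟩
    · exact ⟨Sum.inl y, hy, by rwa [graft_label_of_ne S hyv]⟩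

theorem graft_edgeSide_inl (x y : T.V) :
    (graft S).edgeSide (Sum.inl x) (Sum.inl y) = T.edgeSide x y := by
  refine Eq.trans (congrArg (graft S).bagUnion ?_) (graft_bagUnion S _)
  ext z
  exact joinGraph_reachable_inl z S.isTree.connected

theorem graft_edgeSide_join :
    (graft S).edgeSide (Sum.inl v) (Sum.inr S.root) = ⋃ c, (S.label c).toSet := by
  ext x
  refine (graft S).mem_bagUnion.trans ?_
  rw [mem_iUnion]
  constructor
  · rintro ⟨z, hz, hx⟩
    obtain ⟨c, rfl⟩ := (joinGraph_reachable_inr z S.isTree.connected).1 hz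
    exact ⟨c, hx⟩
  · rintro ⟨c, hc⟩
    exact ⟨Sum.inr c, (joinGraph_reachable_inr _ S.isTree.connected).2 ⟨c, rfl⟩, hc⟩

/-- The neighbours of an old vertex other than `v` do not change. -/
noncomputable def graftNeighborEquiv {x : T.V} (hx : x ≠ v) :
    T.graph.neighborSet x ≃ (graft S).graph.neighborSet (Sum.inl x) where
  toFun y := ⟨Sum.inl y.1, y.2⟩
  invFun z := ⟨Sum.elim id (fun _ => v) z.1, by
    obtain ⟨z | c, hz⟩ := z
    · exact hz
    · exact absurd hz.1 hx⟩
  left_inv _ := rfl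
  right_inv := by
    rintro ⟨z | c, hz⟩
    · rfl
    · exact absurd hz.1 hx

theorem graft_petals {x : T.V} (hx : x ≠ v) {n : ℕ} (e : Fin n ≃ T.graph.neighborSet x) :
    (graft S).petals (Sum.inl x) (e.trans (graftNeighborEquiv S hx)) = T.petals x e := by
  funext i
  rw [petals_apply]
  exact ((graft S).petals_apply (Sum.inl x : T.V ⊕ S.W) (e.trans (graftNeighborEquiv S hx)) i).trans
    (graft_edgeSide_inl S x (e i))

end LabelledTree

open LabelledTree

variable {K : ConnSystem α} {k : ℕ} {𝒯 𝒮 : Set (Set α)} {T : LabelledTree K.E} {v : T.V}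

/-- Since `v` is a bag vertex, no flower vertex acquires a new neighbour, and old flowers are
unchanged. -/
theorem treeDisplays_graft (S : T.Scion v) (hv : (T.label v).IsBag) {X : Set α}
    (hX : TreeDisplays K k 𝒯 T X) : TreeDisplays K k 𝒯 (graft S) X := by
  refine ⟨hX.1, ?_⟩
  rcases hX.2 with ⟨a, b, hab, rfl⟩ | ⟨x, hx, n, e, hP, hd⟩
  · exact Or.inl ⟨Sum.inl a, Sum.inl b, hab, (graft_edgeSide_inl S a b).symm⟩
  · have hxv : x ≠ v := by rintro rfl; exact hx hv
    refine Or.inr ⟨Sum.inl x, by rwa [graft_label_of_ne S hxv], n,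
      e.trans (graftNeighborEquiv S hxv), ?_, ?_⟩
    · rwa [graft_petals]
    · rwa [graft_petals]

theorem SSep.compl {X : Set α} (hX : SSep K k 𝒮 X) : SSep K k 𝒮 (K.E \ X) :=
  ⟨hX.1.compl, hX.2.2, by rw [sdiff_sdiff_cancel_left hX.1.1]; exact hX.2.1⟩

/-- The conditions on old edges and old flower vertices are inherited from `T`; the hypotheses
concern the joining edge, the scion, and conformity. -/
theorem IsPartialTree.graft (hT : IsPartialTree K k 𝒯 𝒮 T) (S : T.Scion v)
    (hv : (T.label v).IsBag) (hj : StrongSep K k 𝒯 (⋃ c, (S.label c).toSet))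
    (hj' : (S.label S.root).IsBag → SSep K k 𝒮 (⋃ c, (S.label c).toSet))
    (hS : ∀ c d, S.graph.Adj c d →
      StrongSep K k 𝒯 ((LabelledTree.graft S).edgeSide (Sum.inr c) (Sum.inr d)))
    (hS' : ∀ c d, S.graph.Adj c d → (S.label c).IsBag → ¬ (S.label d).IsBag)
    (hA : ∀ c, S.label c = .A → ∃ (n : ℕ)
      (e : Fin n ≃ (LabelledTree.graft S).graph.neighborSet (Sum.inr c)),
      IsAnemone K k 𝒯 ((LabelledTree.graft S).petals (Sum.inr c) e) ∧
        3 ≤ sOrder K k 𝒯 𝒮 ((LabelledTree.graft S).petals (Sum.inr c) e) ∧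
        ∀ i, ¬ LoosePetal K k 𝒯 ((LabelledTree.graft S).petals (Sum.inr c) e) i)
    (hD : ∀ c, S.label c = .D → ∃ (n : ℕ)
      (e : Fin n ≃ (LabelledTree.graft S).graph.neighborSet (Sum.inr c)),
      IsDaisy K k 𝒯 ((LabelledTree.graft S).petals (Sum.inr c) e) ∧
        3 ≤ sOrder K k 𝒯 𝒮 ((LabelledTree.graft S).petals (Sum.inr c) e) ∧
        ∀ i, ¬ LoosePetal K k 𝒯 ((LabelledTree.graft S).petals (Sum.inr c) e) i)
    (hc : ∀ X, SSep K k 𝒮 X → Conforms K k 𝒯 (LabelledTree.graft S) X) :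
    IsPartialTree K k 𝒯 𝒮 (LabelledTree.graft S) := by
  have hbag : ∀ x, ((LabelledTree.graft S).label (Sum.inl x)).IsBag → (T.label x).IsBag := by
    intro x hx
    by_cases hxv : x = v
    · rwa [hxv]
    · rwa [graft_label_of_ne S hxv] at hx
  have hjoin : (LabelledTree.graft S).graph.Adj (Sum.inl v) (Sum.inr S.root) := ⟨rfl, rfl⟩
  have hjoin' := (LabelledTree.graft S).edgeSide_compl hjoin
  rw [graft_edgeSide_join] at hjoin'
  have hne : ∀ (x : T.V) (L : VertexLabel α), (¬ L.IsBag) →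
      (LabelledTree.graft S).label (Sum.inl x) = L → x ≠ v ∧ T.label x = L := by
    intro x L hL hx
    have hxv : x ≠ v := by
      rintro rfl
      rw [graft_label_self] at hx
      exact hL ⟨_, hx.symm⟩
    exact ⟨hxv, by rwa [graft_label_of_ne S hxv] at hx⟩
  refine ⟨?_, ?_, ?_, ?_, hc⟩
  · rintro (a | a) (b | b) hab
    · rw [graft_edgeSide_inl]
      exact hT.strongSep_edge a b hab
    · obtain ⟨rfl, rfl⟩ := hab
      rwa [graft_edgeSide_join]
    · obtain ⟨rfl, rfl⟩ := hab
      rw [← hjoin']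
      exact hj.compl
    · exact hS a b hab
  · rintro (a | a) (b | b) hab h1 h2
    · rw [graft_edgeSide_inl]
      exact hT.sSep_edge a b hab (hbag a h1) (hbag b h2)
    · obtain ⟨rfl, rfl⟩ := hab
      rw [graft_edgeSide_join]
      exact hj' h2
    · obtain ⟨rfl, rfl⟩ := hab
      rw [← hjoin']
      exact (hj' h1).compl
    · exact absurd h2 (hS' a b hab h1)
  · rintro (x | c) hx
    · obtain ⟨hxv, hx'⟩ := hne x _ (by rintro ⟨B, hB⟩; cases hB) hx
      obtain ⟨n, e, h1⟩ := hT.anemone x hx'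
      refine ⟨n, e.trans (graftNeighborEquiv S hxv), ?_⟩
      rwa [graft_petals]
    · exact hA c hx
  · rintro (x | c) hx
    · obtain ⟨hxv, hx'⟩ := hne x _ (by rintro ⟨B, hB⟩; cases hB) hx
      obtain ⟨n, e, h1⟩ := hT.daisy x hx'
      refine ⟨n, e.trans (graftNeighborEquiv S hxv), ?_⟩
      rwa [graft_petals]
    · exact hD c hx

end

/-! ### Scions: a single leaf and a star -/

section

namespace LabelledTree

variable {E : Set α} {T : LabelledTree E} {v : T.V}

/-- A single bag vertex. -/
def leafScion {B L : Set α} (hd : Disjoint B L) (hu : B ∪ L = (T.label v).toSet) : T.Scion v where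
  W := Unit
  finite_W := inferInstance
  graph := ⊥
  isTree := SimpleGraph.IsTree.of_subsingleton
  root := ()
  label _ := .bag L
  B := B
  disjoint := fun c d hne => absurd (Subsingleton.elim c d) hne
  disjoint_B _ := hd
  union_eq := by rw [iUnion_const]; exact hu

open Classical in
/-- The labels of a star with centre `j₀`: the centre is labelled `L`, the other vertices are
labelled by the petals of a flower. -/
noncomputable def starLabel {n : ℕ} (P : Fin n → Set α) (j₀ : Fin n) (L : VertexLabel α) :
    Fin n → VertexLabel α :=
  Function.update (fun j => .bag (P j)) j₀ L

theorem starLabel_self {n : ℕ} (P : Fin n → Set α) (j₀ : Fin n) (L : VertexLabel α) :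
    starLabel P j₀ L j₀ = L := by
  classical
  exact Function.update_self _ _ _

theorem starLabel_of_ne {n : ℕ} (P : Fin n → Set α) {j₀ j : Fin n} (L : VertexLabel α)
    (hj : j ≠ j₀) : starLabel P j₀ L j = .bag (P j) := by
  classical
  exact Function.update_of_ne hj _ _

section Star

variable {n : ℕ} {P : Fin n → Set α} {j₀ : Fin n} {L : VertexLabel α}
  (hP : Pairwise fun i j => Disjoint (P i) (P j)) (hu : (⋃ i, P i) = E) (hL : L.toSet = ∅)
  (hv : E \ (T.label v).toSet ⊆ P j₀)

include hL hP in
theorem disjoint_starLabel (c d : Fin n) (hcd : c ≠ d) :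
    Disjoint (P c) (starLabel P j₀ L d).toSet := by
  by_cases hd : d = j₀
  · rw [hd, starLabel_self, hL]
    exact disjoint_bot_right
  · rw [starLabel_of_ne P L hd]
    exact hP hcd

include hP hu hL in
theorem iUnion_starLabel : (⋃ j, (starLabel P j₀ L j).toSet) = E \ P j₀ := by
  ext x
  rw [← hu, mem_sdiff, mem_iUnion, mem_iUnion]
  constructor
  · rintro ⟨j, hj⟩
    by_cases hd : j = j₀
    · rw [hd, starLabel_self, hL] at hj
      exact hj.elim
    · rw [starLabel_of_ne P L hd] at hj
      exact ⟨⟨j, hj⟩, fun hx => (hP hd).le_bot ⟨hj, hx⟩⟩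
  · rintro ⟨⟨j, hj⟩, hx⟩
    have hd : j ≠ j₀ := by rintro rfl; exact hx hj
    exact ⟨j, by rwa [starLabel_of_ne P L hd]⟩

/-- A flower vertex that represents `P`, together with bag vertices for its petals other than
`P j₀`. -/
noncomputable def starScion : T.Scion v where
  W := Fin n
  finite_W := inferInstance
  graph := SimpleGraph.starGraph j₀
  isTree := SimpleGraph.isTree_starGraph j₀
  root := j₀
  label := starLabel P j₀ L
  B := P j₀ ∩ (T.label v).toSet
  disjoint := by
    intro c d hcd
    by_cases hc : c = j₀
    · rw [hc, starLabel_self, hL]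
      exact disjoint_bot_left
    · rw [starLabel_of_ne P L hc]
      exact disjoint_starLabel hP hL c d hcd
  disjoint_B := by
    intro c
    by_cases hc : c = j₀
    · rw [hc, starLabel_self, hL]
      exact disjoint_bot_right
    · exact (disjoint_starLabel hP hL j₀ c (Ne.symm hc)).mono_left inter_subset_left
  union_eq := by
    rw [iUnion_starLabel hP hu hL]
    have h1 := T.label_subset v
    grind

theorem star_edgeSide {j : Fin n} (hj : j ≠ j₀) :
    (graft (starScion (T := T) hP hu hL hv)).edgeSide (Sum.inr j₀ : T.V ⊕ Fin n)
      (Sum.inr j : T.V ⊕ Fin n) = P j := by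
  have key : ∀ z : T.V ⊕ Fin n,
      ((graft (starScion (T := T) hP hu hL hv)).graph.deleteEdges
        {s((Sum.inr j₀ : T.V ⊕ Fin n), (Sum.inr j : T.V ⊕ Fin n))}).Reachable
        (Sum.inr j : T.V ⊕ Fin n) z → z = Sum.inr j := by
    intro z hz
    refine reachable_invariant (p := fun z : T.V ⊕ Fin n => z = Sum.inr j) ?_ hz rfl
    rintro x y hxy rfl
    obtain ⟨h1, h2⟩ := SimpleGraph.deleteEdges_adj.1 hxy
    rcases y with y | y
    · exact absurd h1.2 hj
    · have h3 : (SimpleGraph.starGraph j₀).Adj j y := h1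
      rw [SimpleGraph.starGraph_adj] at h3
      rcases h3.2 with h4 | rfl
      · exact absurd h4 hj
      · exact absurd Sym2.eq_swap h2
  ext x
  refine (mem_bagUnion _).trans ?_
  have hlab : (graft (starScion (T := T) hP hu hL hv)).label (Sum.inr j : T.V ⊕ Fin n)
    = .bag (P j) := starLabel_of_ne P L hj
  constructor
  · rintro ⟨z, hz, hx⟩
    obtain rfl := key z hz
    rw [hlab] at hx
    exact hx
  · intro hx
    exact ⟨(Sum.inr j : T.V ⊕ Fin n), SimpleGraph.Reachable.refl _, by rw [hlab]; exact hx⟩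

theorem star_edgeSide_inl :
    (graft (starScion (T := T) hP hu hL hv)).edgeSide (Sum.inr j₀ : T.V ⊕ Fin n)
      (Sum.inl v : T.V ⊕ Fin n) = P j₀ := by
  have hadj : (graft (starScion (T := T) hP hu hL hv)).graph.Adj (Sum.inl v : T.V ⊕ Fin n)
    (Sum.inr j₀ : T.V ⊕ Fin n) := ⟨rfl, rfl⟩
  have h1 := (graft (starScion (T := T) hP hu hL hv)).edgeSide_compl hadj
  have h2 := graft_edgeSide_join (starScion (T := T) hP hu hL hv)
  have h3 : (⋃ c, ((starScion (T := T) hP hu hL hv).label c).toSet) = E \ P j₀ :=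
    iUnion_starLabel hP hu hL
  refine h1.symm.trans ((congrArg (E \ ·) (h2.trans h3)).trans ?_)
  exact sdiff_sdiff_cancel_left ((subset_iUnion P j₀).trans hu.subset)

theorem exists_star_petals :
    ∃ e : Fin n ≃ (graft (starScion (T := T) hP hu hL hv)).graph.neighborSet
      (Sum.inr j₀ : T.V ⊕ Fin n),
      (graft (starScion (T := T) hP hu hL hv)).petals (Sum.inr j₀ : T.V ⊕ Fin n) e = P := by
  classical
  let G := graft (starScion (T := T) hP hu hL hv)
  -- The index `j₀` serves as the centre of the star, since the petal `P j₀` needs no new leaf: it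
  -- is displayed by the branch towards the old vertex `v`.
  let f : Fin n → T.V ⊕ Fin n := fun j => if j = j₀ then Sum.inl v else Sum.inr j
  have hf : ∀ j, G.graph.Adj (Sum.inr j₀ : T.V ⊕ Fin n) (f j) := by
    intro j
    by_cases hj : j = j₀
    · simp only [f, hj, if_true]
      exact ⟨rfl, rfl⟩
    · simp only [f, hj, if_false]
      exact SimpleGraph.starGraph_center_adj (Ne.symm hj)
  let e : Fin n → G.graph.neighborSet (Sum.inr j₀ : T.V ⊕ Fin n) := fun j => ⟨f j, hf j⟩
  have he : Function.Bijective e := by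
    constructor
    · intro i j hij
      have hij' : f i = f j := congrArg Subtype.val hij
      by_cases hi : i = j₀ <;> by_cases hj : j = j₀ <;> simp [f, hi, hj] at hij' ⊢
      exact hij'
    · rintro ⟨y | y, hy⟩
      · have h1 : y = v := hy.1
        refine ⟨j₀, Subtype.ext ?_⟩
        simp only [e, f, if_true, h1]
        rfl
      · have h1 : (SimpleGraph.starGraph j₀).Adj j₀ y := hy
        have h2 : (y : Fin n) ≠ j₀ := (SimpleGraph.starGraph_adj.1 h1).1.symm
        exact ⟨(y : Fin n), Subtype.ext (if_neg h2)⟩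
  refine ⟨Equiv.ofBijective e he, ?_⟩
  funext j
  refine (G.petals_apply _ _ j).trans ?_
  change G.edgeSide (Sum.inr j₀ : T.V ⊕ Fin n) (f j) = P j
  by_cases hj : j = j₀
  · simp only [f, hj, if_true]
    exact star_edgeSide_inl hP hu hL hv
  · simp only [f, hj, if_false]
    exact star_edgeSide hP hu hL hv hj

end Star

end LabelledTree

end

section

variable {K : ConnSystem α} {k : ℕ} {𝒯 : Set (Set α)}

/-! ### Attaching an optimal flower to a bag vertex -/

theorem IsFlower.strongSep_petal {n : ℕ} {P : Fin n → Set α} (hP : IsFlower K k 𝒯 P) (hn : 2 ≤ n)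
    (i : Fin n) : StrongSep K k 𝒯 (P i) := by
  have : Nontrivial (Fin n) := Fin.nontrivial_iff_two_le.2 hn
  obtain ⟨j, hj⟩ := exists_ne i
  refine ⟨hP.kSep i, hP.strong i, (hP.strong j).mono ?_⟩
  rw [subset_sdiff]
  exact ⟨(hP.kSep j).1, hP.disjoint hj⟩

theorem IsFlower.flowerDisplays_petal {n : ℕ} {P : Fin n → Set α} (hP : IsFlower K k 𝒯 P)
    (i : Fin n) : FlowerDisplays K k P (P i) :=
  ⟨hP.kSep i, {i}, (petalUnion_singleton i).symm⟩

theorem IsFlower.two_le {n : ℕ} {P : Fin n → Set α} (hP : IsFlower K k 𝒯 P) (h : RobustIdeal K k 𝒯)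
    {W : Set α} (hW : StrongSep K k 𝒯 W) (hd : FlowerDisplays K k P W) : 2 ≤ n := by
  obtain ⟨-, I, rfl⟩ := hd
  obtain ⟨x, hx⟩ := h.strong_nonempty hW.2.1
  obtain ⟨y, hy⟩ := h.strong_nonempty hW.2.2
  obtain ⟨i, hi, hxi⟩ := mem_petalUnion.1 hx
  obtain ⟨j, hj⟩ := hP.exists_mem hy.1
  have hne : i ≠ j := by
    rintro rfl
    exact hy.2 (mem_petalUnion.2 ⟨i, hi, hj⟩)
  exact Fin.nontrivial_iff_two_le.1 ⟨i, j, hne⟩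

theorem FlowerLE.displayedClasses_subset (h : RobustIdeal K k 𝒯) {n m : ℕ} {P : Fin n → Set α}
    {Q : Fin m → Set α} (hPQ : FlowerLE K k 𝒯 (nonSequentialSets K k 𝒯) P Q) :
    displayedClasses K k 𝒯 P ⊆ displayedClasses K k 𝒯 Q := by
  refine displayedClasses_subset_of fun X hX hd => ?_
  obtain ⟨Y, -, hY, he⟩ := hPQ X (h.sSep_iff.2 hX) hd
  exact ⟨Y, hY, he⟩

/-- A flower with at most two petals displays at most one class. If one were equivalent to `P`, the
flower `(X, E \ X)`, admissible since `R` avoids `X`, would display as much as `P` with only two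
petals. -/
theorem OptimalFlower.three_le_sOrder {n : ℕ} {P : Fin n → Set α} {R X : Set α}
    (hP : OptimalFlower K k 𝒯 P R X) (h : RobustIdeal K k 𝒯) (hR : R ⊆ K.E \ X) (hn : 3 ≤ n) :
    3 ≤ sOrder K k 𝒯 (nonSequentialSets K k 𝒯) P := by
  refine le_csInf ⟨n, P, hP.flower, ?_⟩ ?_
  · exact ⟨fun Y hY hd => ⟨Y, hY, hd, (h.sSep_iff.1 hY).strongSep.equivSep⟩,
      fun Y hY hd => ⟨Y, hY, hd, (h.sSep_iff.1 hY).strongSep.equivSep⟩⟩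
  · rintro m ⟨Q, hQ, hPQ, -⟩
    by_contra hm
    have hsub := FlowerLE.displayedClasses_subset h hPQ
    obtain ⟨hX, V, hV, hXV⟩ := hsub hP.mem
    have h2 : n ≤ 2 := by
      refine hP.card_le (IsFlower.of_strongSep hX.strongSep h.kSep_ground)
        ⟨1, hR⟩ ?_
      intro Y hY
      obtain ⟨hY', W, hW, hYW⟩ := hsub hY
      refine ⟨hY', X, IsFlower.displays_of_strongSep hX.kSep, ?_⟩
      rcases hQ.eq_or_eq_of_le_two h (by omega) hV hW hXV.2.1 hYW.2.1 with rfl | rfl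
      · exact hYW.trans hXV.symm
      · exact hYW.trans (hXV.2.1.equivSep_compl.symm.trans hXV.symm)
    omega

variable (K k 𝒯) in
/-- `T'` is obtained from `T` by attaching a representation of the flower `P` to the vertex `v`,
the bag of which is `B`. -/
structure IsExtension (T T' : LabelledTree K.E) (v : T.V) (B : Set α) {n : ℕ} (P : Fin n → Set α) :
    Prop where
  displays : ∀ Y, TreeDisplays K k 𝒯 T Y → TreeDisplays K k 𝒯 T' Y
  displays_flower : ∀ W, StrongSep K k 𝒯 W → FlowerDisplays K k P W → TreeDisplays K k 𝒯 T' W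
  bag : ∀ w ≠ v, ∀ C, T.label w = .bag C → ∃ w', T'.label w' = .bag C
  bag_petal : ∀ i, ∃ w', T'.label w' = .bag (P i ∩ B)
  isPartialTree : (∀ X, SSep K k (nonSequentialSets K k 𝒯) X → Conforms K k 𝒯 T' X) →
    IsPartialTree K k 𝒯 (nonSequentialSets K k 𝒯) T'

variable {T : LabelledTree K.E} {v : T.V} {B R X : Set α} {n : ℕ} {P : Fin n → Set α}

open LabelledTree

theorem exists_isExtension_of_two (hT : IsPartialTree K k 𝒯 (nonSequentialSets K k 𝒯) T)
    (hv : T.label v = .bag B) (h : RobustIdeal K k 𝒯) (hP : OptimalFlower K k 𝒯 P R X)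
    {j₀ : Fin n} (hj₀ : K.E \ B ⊆ P j₀) (hn : n = 2) :
    ∃ T', IsExtension K k 𝒯 T T' v B P := by
  subst hn
  obtain ⟨j₁, hj₁⟩ : ∃ j₁ : Fin 2, j₁ ≠ j₀ := exists_ne j₀
  have hall : ∀ i, i = j₀ ∨ i = j₁ := by omega
  have hBE : B ⊆ K.E := by
    have := T.label_subset v
    rwa [hv] at this
  have hd := hP.flower.disjoint hj₁
  have h1E := (hP.flower.kSep j₁).1
  have h1B : P j₁ ⊆ B := by
    intro x hx
    by_contra hxB
    exact hd.le_bot ⟨hx, hj₀ ⟨h1E hx, hxB⟩⟩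
  have hu : ∀ x ∈ K.E, x ∈ P j₀ ∨ x ∈ P j₁ := by
    intro x hx
    obtain ⟨i, hi⟩ := hP.flower.exists_mem hx
    rcases hall i with rfl | rfl
    · exact Or.inl hi
    · exact Or.inr hi
  -- A two-petal flower displays only one strong separation, here one equivalent to `X`. So it is
  -- non-sequential, as an edge joining two bag vertices requires.
  have hns : NonSeq K k 𝒯 (P j₁) := by
    obtain ⟨hX, W, hW, he⟩ := hP.mem
    have hWn := hX.of_equivSep he
    rcases hP.flower.eq_or_eq_of_le_two h le_rfl hW (hP.flower.flowerDisplays_petal j₁) he.2.1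
      (hP.flower.strongSep_petal le_rfl j₁) with he' | he'
    · rwa [he']
    · rw [he']
      exact hWn.compl
  let S : T.Scion v := leafScion (B := P j₀ ∩ B) (L := P j₁)
    (hd.symm.mono_left inter_subset_left) (by
      rw [hv]
      change P j₀ ∩ B ∪ P j₁ = B
      ext x
      have := hu x
      have := @hBE x
      have := @h1B x
      grind)
  have hjoin : (⋃ c, (S.label c).toSet) = P j₁ :=
    iUnion_const (ι := Unit) _
  have hvb : (T.label v).IsBag := ⟨B, hv⟩
  have hadj : (graft S).graph.Adj (Sum.inl v : T.V ⊕ Unit) (Sum.inr () : T.V ⊕ Unit) := ⟨rfl, rfl⟩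
  have hside := (graft_edgeSide_join S).trans hjoin
  have hdisp : TreeDisplays K k 𝒯 (graft S) (P j₁) :=
    ⟨hns.kSep, Or.inl ⟨_, _, hadj, hside.symm⟩⟩
  have hdisp' : TreeDisplays K k 𝒯 (graft S) (K.E \ P j₁) := by
    refine ⟨hns.kSep.compl, Or.inl ⟨_, _, hadj.symm, ?_⟩⟩
    have h1 := (graft S).edgeSide_compl hadj
    rw [← h1]
    exact congrArg (K.E \ ·) hside.symm
  refine ⟨graft S, ⟨fun Y => treeDisplays_graft S hvb, ?_, ?_, ?_, ?_⟩⟩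
  · intro W hW hd'
    rcases hP.flower.eq_or_eq_of_le_two h le_rfl (hP.flower.flowerDisplays_petal j₁) hd'
      hns.strongSep hW with rfl | rfl
    · exact hdisp
    · exact hdisp'
  · intro w hw C hC
    exact ⟨(Sum.inl w : T.V ⊕ Unit), (graft_label_of_ne S hw).trans hC⟩
  · intro i
    rcases hall i with rfl | rfl
    · exact ⟨(Sum.inl v : T.V ⊕ Unit), graft_label_self S⟩
    · rw [inter_eq_left.2 h1B]
      exact ⟨(Sum.inr () : T.V ⊕ Unit), rfl⟩
  · refine hT.graft S hvb ?_ ?_ ?_ ?_ ?_ ?_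
    · rw [hjoin]
      exact hns.strongSep
    · rw [hjoin]
      exact fun _ => h.sSep_iff.2 hns
    · exact fun c d hcd => absurd hcd id
    · exact fun c d hcd => absurd hcd id
    · intro c hc
      cases hc
    · intro c hc
      cases hc

theorem exists_isExtension_of_three (hT : IsPartialTree K k 𝒯 (nonSequentialSets K k 𝒯) T)
    (hv : T.label v = .bag B) (h : RobustIdeal K k 𝒯) (hP : OptimalFlower K k 𝒯 P R X)
    (hR : R ⊆ K.E \ X) {j₀ : Fin n} (hj₀ : K.E \ B ⊆ P j₀) (hn : 3 ≤ n) :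
    ∃ T', IsExtension K k 𝒯 T T' v B P := by
  obtain ⟨L, hL⟩ : ∃ L : VertexLabel α, L = .A ∧ IsAnemone K k 𝒯 P ∨ L = .D ∧ IsDaisy K k 𝒯 P := by
    rcases hP.flower.isAnemone_or_isDaisy h with hA | hD
    · exact ⟨_, Or.inl ⟨rfl, hA⟩⟩
    · exact ⟨_, Or.inr ⟨rfl, hD⟩⟩
  have hLs : L.toSet = ∅ := by rcases hL with ⟨rfl, -⟩ | ⟨rfl, -⟩ <;> rfl
  have hLb : ¬ L.IsBag := by
    rintro ⟨C, hC⟩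
    rcases hL with ⟨rfl, -⟩ | ⟨rfl, -⟩ <;> cases hC
  have hvb : (T.label v).IsBag := ⟨B, hv⟩
  have hv' : K.E \ (T.label v).toSet ⊆ P j₀ := by rwa [hv]
  have hsP := hP.flower.strongSep_petal (by omega : 2 ≤ n)
  let S : T.Scion v := starScion (L := L) hP.flower.disjoint hP.flower.union_eq hLs hv'
  have hjoin : (⋃ c, (S.label c).toSet) = K.E \ P j₀ :=
    iUnion_starLabel hP.flower.disjoint hP.flower.union_eq hLs
  have hside : ∀ {j}, j ≠ j₀ → (graft S).edgeSide (Sum.inr j₀ : T.V ⊕ Fin n)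
      (Sum.inr j : T.V ⊕ Fin n) = P j := fun hj =>
    star_edgeSide hP.flower.disjoint hP.flower.union_eq hLs hv' hj
  obtain ⟨e, he⟩ : ∃ e : Fin n ≃ (graft S).graph.neighborSet (Sum.inr j₀ : T.V ⊕ Fin n),
      (graft S).petals (Sum.inr j₀ : T.V ⊕ Fin n) e = P :=
    exists_star_petals hP.flower.disjoint hP.flower.union_eq hLs hv'
  have hroot : (graft S).label (Sum.inr j₀ : T.V ⊕ Fin n) = L := starLabel_self P j₀ L
  have hleaf : ∀ {j : Fin n}, j ≠ j₀ → S.label j = .bag (P j) := fun hj => starLabel_of_ne P L hj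
  have hroot' : S.label j₀ = L := starLabel_self P j₀ L
  refine ⟨graft S, ⟨fun Y => treeDisplays_graft S hvb, ?_, ?_, ?_, ?_⟩⟩
  · intro W hW hd
    refine ⟨hW.1, Or.inr ⟨(Sum.inr j₀ : T.V ⊕ Fin n), ?_, n, e, ?_, ?_⟩⟩
    · rwa [hroot]
    · rw [he]
      exact hP.flower
    · rwa [he]
  · intro w hw C hC
    exact ⟨(Sum.inl w : T.V ⊕ Fin n), (graft_label_of_ne S hw).trans hC⟩
  · intro i
    by_cases hi : i = j₀
    · refine ⟨(Sum.inl v : T.V ⊕ Fin n), (graft_label_self S).trans ?_⟩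
      change VertexLabel.bag (P j₀ ∩ (T.label v).toSet) = _
      rw [hv, hi]
      rfl
    · have hiB : P i ⊆ B := by
        intro x hx
        by_contra hxB
        exact (hP.flower.disjoint hi).le_bot ⟨hx, hj₀ ⟨(hP.flower.kSep i).1 hx, hxB⟩⟩
      rw [inter_eq_left.2 hiB]
      exact ⟨(Sum.inr i : T.V ⊕ Fin n), hleaf hi⟩
  · refine hT.graft S hvb ?_ ?_ ?_ ?_ ?_ ?_
    · rw [hjoin]
      exact (hsP j₀).compl
    · intro hb
      have hb' : (S.label j₀).IsBag := hb
      rw [hroot'] at hb'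
      exact absurd hb' hLb
    · intro c d hcd
      obtain ⟨hne, hc | hd⟩ := SimpleGraph.starGraph_adj.1 hcd
      · replace hc := hc.symm
        subst hc
        have := hsP d
        rw [← hside hne.symm] at this
        exact this
      · replace hd := hd.symm
        subst hd
        have h1 := (hsP c).compl
        rw [← hside hne] at h1
        have hadj : (graft S).graph.Adj (Sum.inr j₀ : T.V ⊕ Fin n) (Sum.inr c : T.V ⊕ Fin n) :=
          SimpleGraph.starGraph_center_adj hne.symm
        rw [(graft S).edgeSide_compl hadj] at h1
        exact h1
    · intro c d hcd hc hd
      obtain ⟨hne, hc' | hd'⟩ := SimpleGraph.starGraph_adj.1 hcd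
      · rw [hc', hroot'] at hc
        exact hLb hc
      · rw [hd', hroot'] at hd
        exact hLb hd
    · intro c hc
      have hcj : j₀ = c := by
        by_contra hne
        rw [hleaf (Ne.symm hne)] at hc
        cases hc
      subst hcj
      rw [hroot'] at hc
      rcases hL with ⟨-, hA⟩ | ⟨hLD, -⟩
      · refine ⟨n, e, ?_⟩
        have := And.intro hA (And.intro (hP.three_le_sOrder h hR hn) (hP.not_loosePetal h))
        rw [← he] at this
        exact this
      · rw [hc] at hLD
        cases hLD
    · intro c hc
      have hcj : j₀ = c := by
        by_contra hne
        rw [hleaf (Ne.symm hne)] at hc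
        cases hc
      subst hcj
      rw [hroot'] at hc
      rcases hL with ⟨hLA, -⟩ | ⟨-, hD⟩
      · rw [hc] at hLA
        cases hLA
      · refine ⟨n, e, ?_⟩
        have := And.intro hD (And.intro (hP.three_le_sOrder h hR hn) (hP.not_loosePetal h))
        rw [← he] at this
        exact this

theorem exists_isExtension (hT : IsPartialTree K k 𝒯 (nonSequentialSets K k 𝒯) T)
    (hv : T.label v = .bag B) (h : RobustIdeal K k 𝒯) (hP : OptimalFlower K k 𝒯 P R X)
    (hR : R ⊆ K.E \ X) {j₀ : Fin n} (hj₀ : K.E \ B ⊆ P j₀) :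
    ∃ T', IsExtension K k 𝒯 T T' v B P := by
  obtain ⟨-, W, hW, he⟩ := hP.mem
  have hn := hP.flower.two_le h he.2.1 hW
  rcases hn.eq_or_lt with hn | hn
  · exact exists_isExtension_of_two hT hv h hP hj₀ hn.symm
  · exact exists_isExtension_of_three hT hv h hP hR hj₀ hn

end

section

variable {K : ConnSystem α} {k : ℕ} {𝒯 : Set (Set α)}

/-! ### Maximal partial trees -/

theorem RobustIdeal.isFlower_ground (h : RobustIdeal K k 𝒯) :
    IsFlower K k 𝒯 (fun _ : Fin 1 => K.E) where
  pos := Nat.one_pos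
  disjoint := fun i j hij => absurd (Subsingleton.elim i j) hij
  union_eq := iUnion_const _
  strong _ := h.strong_ground
  kSep _ := h.kSep_ground
  kSep_succ _ := by rw [union_self]; exact h.kSep_ground

/-- Otherwise the flower would be equivalent to the one with the single petal `E`, which displays no
strong separation. -/
theorem IsFlower.exists_nonSeq (h : RobustIdeal K k 𝒯) {n : ℕ} {P : Fin n → Set α}
    (hs : 2 ≤ sOrder K k 𝒯 (nonSequentialSets K k 𝒯) P) :
    ∃ W, NonSeq K k 𝒯 W ∧ FlowerDisplays K k P W := by
  by_contra! hno
  have h1 : sOrder K k 𝒯 (nonSequentialSets K k 𝒯) P ≤ 1 := by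
    refine Nat.sInf_le ⟨_, h.isFlower_ground, ?_, ?_⟩
    · exact fun Y hY hd => absurd hd (hno Y (h.sSep_iff.1 hY))
    · intro Y hY hd
      have := h.isFlower_ground.two_le h (h.sSep_iff.1 hY).strongSep hd
      omega
  omega

variable {T : LabelledTree K.E} {v : T.V} {B : Set α}

theorem IsPartialTree.exists_flower (hT : IsPartialTree K k 𝒯 (nonSequentialSets K k 𝒯) T)
    (hv : ¬ (T.label v).IsBag) : ∃ (n : ℕ) (e : Fin n ≃ T.graph.neighborSet v),
      IsFlower K k 𝒯 (T.petals v e) ∧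
        3 ≤ sOrder K k 𝒯 (nonSequentialSets K k 𝒯) (T.petals v e) := by
  cases hl : T.label v with
  | bag B => exact absurd ⟨B, hl⟩ hv
  | D =>
    obtain ⟨n, e, h1, h2, -⟩ := hT.daisy v hl
    exact ⟨n, e, h1.1, h2⟩
  | A =>
    obtain ⟨n, e, h1, h2, -⟩ := hT.anemone v hl
    exact ⟨n, e, h1.1, h2⟩

/-- Between bag vertices the edge is non-sequential. If `w` is a flower vertex, its flower displays
a non-sequential separation, and the petal towards `v` lies in one of its sides. -/
theorem IsPartialTree.fcl_edgeSide_ne (hT : IsPartialTree K k 𝒯 (nonSequentialSets K k 𝒯) T)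
    (h : RobustIdeal K k 𝒯) (hv : (T.label v).IsBag) {w : T.V} (hvw : T.graph.Adj v w) :
    fcl K k 𝒯 (T.edgeSide w v) ≠ K.E := by
  by_cases hw : (T.label w).IsBag
  · exact (h.sSep_iff.1 (hT.sSep_edge w v hvw.symm hw hv)).fcl_ne
  · obtain ⟨n, e, hP, hs⟩ := hT.exists_flower hw
    obtain ⟨W, hW, hd, I, rfl⟩ := IsFlower.exists_nonSeq h ((Nat.le_succ 2).trans hs)
    obtain ⟨i, hi⟩ := e.surjective ⟨v, hvw.symm⟩
    have hPi : T.petals w e i = T.edgeSide w v := by rw [LabelledTree.petals_apply, hi]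
    have key : ∀ {Y}, Y ⊆ K.E → fcl K k 𝒯 Y ≠ K.E → T.petals w e i ⊆ Y →
        fcl K k 𝒯 (T.edgeSide w v) ≠ K.E := by
      intro Y hYE hY hsub he
      rw [hPi] at hsub
      exact hY ((h.fcl_subset_ground hYE).antisymm (he.symm.subset.trans (fcl_mono hsub)))
    by_cases hiI : i ∈ I
    · exact key hW.kSep.1 hW.fcl_ne (subset_petalUnion hiI)
    · refine key sdiff_subset hW.fcl_compl_ne ?_
      rw [← hP.petalUnion_compl]
      exact subset_petalUnion hiI

/-- `Q` is the side of any edge at `v` pointing away from `v`. Its existence makes `E \ B` strong,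
and the closure condition prevents sets inside `B` from absorbing all of `Q`. -/
theorem IsPartialTree.exists_root (hT : IsPartialTree K k 𝒯 (nonSequentialSets K k 𝒯) T)
    (h : RobustIdeal K k 𝒯) (hv : T.label v = .bag B) :
    K.E \ B = ∅ ∨ ∃ Q ⊆ K.E \ B, Strong 𝒯 Q ∧ fcl K k 𝒯 (K.E \ Q) ≠ K.E := by
  by_cases hw : ∃ w, T.graph.Adj v w
  · right
    obtain ⟨w, hvw⟩ := hw
    have hs := hT.strongSep_edge v w hvw
    refine ⟨T.edgeSide v w, ?_, hs.2.1, ?_⟩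
    · rw [subset_sdiff]
      have := T.edgeSide_disjoint hvw
      rw [hv] at this
      exact ⟨hs.1.1, this.symm⟩
    · rw [T.edgeSide_compl hvw]
      exact hT.fcl_edgeSide_ne h ⟨B, hv⟩ hvw
  · left
    rw [sdiff_eq_empty, ← T.union_eq]
    refine iUnion_subset fun x => ?_
    have hx : x = v := reachable_invariant (p := fun x => x = v)
      (by rintro a b hab rfl; exact absurd ⟨b, hab⟩ hw) (T.isTree.connected.preconnected v x) rfl
    rw [hx, hv]
    rfl

variable (K k 𝒯) in
/-- The non-sequential separations with a side in `B` that are not equivalent to a separation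
displayed by `T`. -/
def undisplayed (T : LabelledTree K.E) (B : Set α) : Set (Set α) :=
  {Y | NonSeq K k 𝒯 Y ∧ Y ⊆ B ∧ ¬ ∃ Z, TreeDisplays K k 𝒯 T Z ∧ EquivSep K k 𝒯 Y Z}

/-- If `X` has maximal full closure among the separations in the bag `B` that are not displayed,
then the extension of `T` by an optimal flower displaying `X` satisfies the conformity condition. -/
theorem IsExtension.conforms (hT : IsPartialTree K k 𝒯 (nonSequentialSets K k 𝒯) T)
    (h : RobustIdeal K k 𝒯) (hv : T.label v = .bag B) {X : Set α}
    (hX : X ∈ undisplayed K k 𝒯 T B)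
    (hmax : ∀ Y ∈ undisplayed K k 𝒯 T B, (fcl K k 𝒯 Y).ncard ≤ (fcl K k 𝒯 X).ncard)
    {n : ℕ} {P : Fin n → Set α} (hP : OptimalFlower K k 𝒯 P (K.E \ B) X) {j₀ : Fin n}
    (hj₀ : K.E \ B ⊆ P j₀) {T' : LabelledTree K.E} (hT' : IsExtension K k 𝒯 T T' v B P)
    {Z : Set α} (hZ : NonSeq K k 𝒯 Z) : Conforms K k 𝒯 T' Z := by
  have hroot := hT.exists_root h hv
  have hdC : ∀ {Y}, NonSeq K k 𝒯 Y → EquivSep K k 𝒯 Z Y → Y ∈ displayedClasses K k 𝒯 P →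
      Conforms K k 𝒯 T' Z := by
    rintro Y - hZY ⟨-, W, hW, he⟩
    exact Or.inl ⟨W, hZY.trans he, hT'.displays_flower W he.2.1 hW⟩
  have hbag : ∀ {Y}, EquivSep K k 𝒯 Z Y → ∀ i, (Y ⊆ P i ∩ B ∨ K.E \ Y ⊆ P i ∩ B) →
      Conforms K k 𝒯 T' Z := by
    intro Y hZY i hY
    obtain ⟨w, hw⟩ := hT'.bag_petal i
    exact Or.inr ⟨Y, hZY, w, _, hw, hY⟩
  have main : ∀ Z₀, EquivSep K k 𝒯 Z Z₀ → Z₀ ⊆ B → Conforms K k 𝒯 T' Z := by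
    intro Z₀ hZ₀ hZ₀B
    have hR : K.E \ B = ∅ ∨ Strong 𝒯 (K.E \ B) := hroot.imp_right fun ⟨Q, hQ, hs, _⟩ => hs.mono hQ
    obtain ⟨Z', he, hd, hZ'⟩ := hP.conforms h hR (hZ.of_equivSep hZ₀)
      (disjoint_sdiff_left.mono_right hZ₀B)
    have hZZ' := hZ₀.trans he
    have hns := hZ.of_equivSep hZZ'
    have hZ'B : Z' ⊆ B := by
      intro x hx
      by_contra hxB
      exact hd.le_bot ⟨⟨hns.kSep.1 hx, hxB⟩, hx⟩
    rcases hZ' with hZ' | ⟨i, hi | hi⟩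
    · exact hdC hns hZZ' hZ'
    · exact hbag hZZ' i (Or.inl (subset_inter hi hZ'B))
    by_cases hiB : P i ⊆ B
    · exact hbag hZZ' i (Or.inr (subset_inter hi (hi.trans hiB)))
    -- Here `E \ Z'` lies in a petal that reaches outside `B`, which must be the root petal. No bag
    -- need contain `E \ Z'`, so the choice of `X` has to be used.
    have hij : i = j₀ := by
      by_contra hne
      refine hiB fun x hx => ?_
      by_contra hxB
      exact (hP.flower.disjoint hne).le_bot ⟨hx, hj₀ ⟨(hP.flower.kSep i).1 hx, hxB⟩⟩
    subst hij
    obtain ⟨Q, hQB, -, hQ⟩ : ∃ Q ⊆ K.E \ B, Strong 𝒯 Q ∧ fcl K k 𝒯 (K.E \ Q) ≠ K.E := by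
      refine hroot.resolve_left fun h0 => hiB ?_
      rw [sdiff_eq_empty] at h0
      exact (hP.flower.kSep i).1.trans h0
    by_cases hu : ∃ Y, TreeDisplays K k 𝒯 T Y ∧ EquivSep K k 𝒯 Z' Y
    · obtain ⟨Y, hY, heY⟩ := hu
      exact Or.inl ⟨Y, hZZ'.trans heY, hT'.displays Y hY⟩
    have hle := hmax Z' ⟨hns, hZ'B, hu⟩
    obtain ⟨X', hX', he'⟩ : ∃ X', FlowerDisplays K k P X' ∧ fcl K k 𝒯 X = fcl K k 𝒯 X' := by
      obtain ⟨-, W, hW, -, -, he | he⟩ := hP.mem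
      · exact ⟨W, hW, he.1⟩
      · exact ⟨_, hP.flower.flowerDisplays_compl hW, he.1⟩
    obtain ⟨-, I, rfl⟩ := hX'
    -- Otherwise `fcl X` would contain the root petal and with it `Q`. As `X` avoids `Q`, then `Q ⊆
    -- fcl (E \ Q)`, whence `fcl (E \ Q) = E`.
    have hiI : i ∉ I := by
      intro hiI
      refine hQ ((h.fcl_subset_ground sdiff_subset).antisymm ?_)
      have h1 : Q ⊆ fcl K k 𝒯 (K.E \ Q) := by
        refine (hQB.trans (hj₀.trans (subset_petalUnion hiI))).trans
          ((subset_fcl (K := K) (k := k) (𝒯 := 𝒯) _).trans ?_)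
        rw [← he']
        refine fcl_mono fun x hx => ⟨hX.1.kSep.1 hx, fun hxQ => (hQB hxQ).2 (hX.2.1 hx)⟩
      intro x hx
      by_cases hxQ : x ∈ Q
      · exact h1 hxQ
      · exact subset_fcl _ ⟨hx, hxQ⟩
    have hsub : petalUnion P I ⊆ Z' := by
      intro x hx
      obtain ⟨j, hj, hxj⟩ := mem_petalUnion.1 hx
      by_contra hxZ
      have hne : j ≠ i := by rintro rfl; exact hiI hj
      exact (hP.flower.disjoint hne).le_bot ⟨hxj, hi ⟨(hP.flower.kSep j).1 hxj, hxZ⟩⟩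
    have hfin : (fcl K k 𝒯 Z').Finite := K.finite_E.subset (h.fcl_subset_ground hns.kSep.1)
    -- `Z'` contains every petal but the root petal, so its closure contains that of `X`; the
    -- maximality of the latter gives equality.
    have heq : fcl K k 𝒯 X = fcl K k 𝒯 Z' :=
      eq_of_subset_of_ncard_le (he' ▸ fcl_mono hsub) hle hfin
    have hXZ := h.equivSep_of_fcl_eq hX.1 hns.kSep hns.strong heq.symm
    obtain ⟨-, W, hW, heW⟩ := hP.mem
    exact hdC hns hZZ' ⟨hns, W, hW, hXZ.symm.trans heW⟩
  rcases hT.conforms Z (h.sSep_iff.2 hZ) with ⟨Y, he, hY⟩ | ⟨Y, he, w, C, hw, hY⟩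
  · exact Or.inl ⟨Y, he, hT'.displays Y hY⟩
  · by_cases hwv : w = v
    · subst hwv
      rw [hv] at hw
      obtain rfl : B = C := by injection hw
      rcases hY with hY | hY
      · exact main Y he hY
      · exact main _ (he.trans he.2.1.equivSep_compl) hY
    · obtain ⟨w', hw'⟩ := hT'.bag w hwv C hw
      exact Or.inr ⟨Y, he, w', C, hw', hY⟩

/-- A maximal partial tree displays all non-sequential separations up to equivalence. -/
theorem IsMaximalPartialTree.exists_treeDisplays (hT : IsMaximalPartialTree K k 𝒯 T)
    (h : RobustIdeal K k 𝒯) {X : Set α} (hX : NonSeq K k 𝒯 X) :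
    ∃ Y, TreeDisplays K k 𝒯 T Y ∧ EquivSep K k 𝒯 X Y := by
  by_contra hno
  obtain ⟨hpT, hmaxT⟩ := hT
  obtain ⟨Y₀, B, v, hv, hY₀⟩ : ∃ Y B v, T.label v = .bag B ∧ Y ∈ undisplayed K k 𝒯 T B := by
    rcases hpT.conforms X (h.sSep_iff.2 hX) with ⟨Y, he, hY⟩ | ⟨Y, he, v, B, hv, hY⟩
    · exact absurd ⟨Y, hY, he⟩ hno
    · have hund : ∀ {Y}, EquivSep K k 𝒯 X Y →
          ¬ ∃ Z, TreeDisplays K k 𝒯 T Z ∧ EquivSep K k 𝒯 Y Z :=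
        fun he ⟨Z, hZ, heZ⟩ => hno ⟨Z, hZ, he.trans heZ⟩
      rcases hY with hY | hY
      · exact ⟨Y, B, v, hv, hX.of_equivSep he, hY, hund he⟩
      · have he' := he.trans he.2.1.equivSep_compl
        exact ⟨_, B, v, hv, hX.of_equivSep he', hY, hund he'⟩
  have hfin : (undisplayed K k 𝒯 T B).Finite :=
    K.finite_E.finite_subsets.subset fun Y hY => hY.1.kSep.1
  obtain ⟨X₁, hX₁, hmax⟩ := exists_max_image _ (fun Y => (fcl K k 𝒯 Y).ncard) hfin ⟨Y₀, hY₀⟩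
  have hR : K.E \ B ⊆ K.E \ X₁ := sdiff_subset_sdiff_right hX₁.2.1
  -- The flower `(X₁, E \ X₁)` shows that there are competitors, its second petal containing `E \
  -- B`.
  obtain ⟨n, P, hP⟩ := exists_optimalFlower
    (IsFlower.of_strongSep hX₁.1.strongSep h.kSep_ground) (R := K.E \ B) ⟨1, hR⟩
    (X := X₁) ⟨hX₁.1, X₁, IsFlower.displays_of_strongSep hX₁.1.kSep, hX₁.1.strongSep.equivSep⟩
  obtain ⟨j₀, hj₀⟩ := hP.root
  obtain ⟨T', hT'⟩ := exists_isExtension hpT hv h hP hR hj₀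
  have hpT' := hT'.isPartialTree fun Z hZ =>
    hT'.conforms hpT h hv hX₁ hmax hP hj₀ (h.sSep_iff.1 hZ)
  have hle := hmaxT T' hpT' fun Y hY hd =>
    ⟨Y, hY, hT'.displays Y hd, (h.sSep_iff.1 hY).strongSep.equivSep⟩
  -- The new tree displays the class of `X₁`; by maximality so does `T`, contrary to the choice of
  -- `X₁`.
  obtain ⟨-, W, hW, he⟩ := hP.mem
  obtain ⟨Y, -, hY, heY⟩ := hle W (h.sSep_iff.2 (hX₁.1.of_equivSep he))
    (hT'.displays_flower W he.2.1 hW)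
  exact hX₁.2.2 ⟨Y, hY, he.trans heY⟩

end

section

variable {K : ConnSystem α} {k : ℕ} {𝒯 : Set (Set α)}

/-! ### Existence and uniqueness of the tangle -/

/-- Induction on a member of `𝒯`, adding one element at a time. If the complement of `insert a A`
were in `𝒯'`, it would cover `E` together with `A` and `{a}`, both in `𝒯'` already. The converse
inclusion follows, as `𝒯'` contains no set together with its complement. -/
theorem RobustIdeal.eq_of_isTangle (h : RobustIdeal K k 𝒯) {𝒯' : Set (Set α)}
    (hT : IsTangle K k 𝒯') : 𝒯' = 𝒯 := by
  have hcov : ∀ A ∈ 𝒯', K.E \ A ∉ 𝒯' := by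
    intro A hA hA'
    refine hT.union_ne A hA _ hA' A hA ?_
    have := hT.subset_ground A hA
    grind
  have hmem : ∀ A ∈ 𝒯, K.E \ A ∉ 𝒯' → A ∈ 𝒯' := by
    intro A hA hA'
    have := h.lam_lt A hA
    exact (hT.mem_or_compl_mem A (h.subset_ground A hA) (by omega)).resolve_right hA'
  have key : ∀ A : Set α, A.Finite → A ∈ 𝒯 → K.E \ A ∉ 𝒯' := by
    intro A hfin
    induction A, hfin using Set.Finite.induction_on with
    | empty =>
      intro _ hE
      rw [sdiff_empty] at hE
      exact hT.union_ne _ hE _ hE _ hE (by simp)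
    | @insert a A _ _ ih =>
      intro hA hA'
      have hAE := h.subset_ground _ hA
      have h1 : A ∈ 𝒯 := h.mono _ hA _ (subset_insert a A)
      have h2 : {a} ∈ 𝒯 := h.mono _ hA _ (by simp)
      have h3 := hmem A h1 (ih h1)
      have h4 := hmem {a} h2 (hT.compl_singleton_notMem a (hAE (mem_insert a A)))
      refine hT.union_ne _ h3 _ h4 _ hA' ?_
      grind
  refine Subset.antisymm (fun A hA => ?_) fun A hA =>
    hmem A hA (key A (K.finite_E.subset (h.subset_ground A hA)) hA)
  have hlam := hT.lam_lt A hA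
  rcases h.mem_or_compl_mem A (hT.subset_ground A hA) (by omega) with h1 | h1
  · exact h1
  · exact absurd (hmem _ h1 (key _ (K.finite_E.subset sdiff_subset) h1)) (hcov A hA)

/-- A size function on the subsets of `E`, large on `E` and small on one of the sides of each
`(k-1)`-separation. -/
structure IsSize (K : ConnSystem α) (k : ℕ) (μ : Set α → ℤ) : Prop where
  two_le : 2 ≤ k
  empty_le : μ ∅ ≤ 0
  singleton_le : ∀ e, μ {e} ≤ 1
  mono : ∀ A B, A ⊆ B → B ⊆ K.E → μ A ≤ μ B
  union_le : ∀ A B, A ⊆ K.E → B ⊆ K.E → μ (A ∪ B) ≤ μ A + μ B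
  le_ground : 8 * (k : ℤ) - 15 ≤ μ K.E
  two_le_ground : 2 ≤ μ K.E
  lam_lt : ∀ A ⊆ K.E, μ A ≤ (k : ℤ) - 2 → K.lam A < k
  small : ∀ A ⊆ K.E, K.lam A ≤ (k : ℤ) - 1 → μ A ≤ (k : ℤ) - 2 ∨ μ (K.E \ A) ≤ (k : ℤ) - 2

namespace IsSize

variable {μ : Set α → ℤ} (hμ : IsSize K k μ)

include hμ in
-- Eight members have total size at most `8 * k - 16`, one less than the lower bound for `μ K.E`.
theorem robustIdeal : RobustIdeal K k {A | A ⊆ K.E ∧ μ A ≤ (k : ℤ) - 2} where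
  subset_ground A hA := hA.1
  mono A hA B hB := ⟨hB.trans hA.1, (hμ.mono B A hB hA.1).trans hA.2⟩
  empty_mem := ⟨empty_subset _, by
    have := hμ.empty_le
    have := hμ.two_le
    omega⟩
  lam_lt A hA := hμ.lam_lt A hA.1 hA.2
  mem_or_compl_mem A hA hl := by
    rcases hμ.small A hA hl with h | h
    · exact Or.inl ⟨hA, h⟩
    · exact Or.inr ⟨sdiff_subset, h⟩
  not_cover f hf hc := by
    have key : ∀ s : Finset (Fin 8), (⋃ i ∈ s, f i) ⊆ K.E ∧
        μ (⋃ i ∈ s, f i) ≤ s.card * ((k : ℤ) - 2) := by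
      intro s
      induction s using Finset.induction_on with
      | empty => simpa using hμ.empty_le
      | insert i s hi ih =>
        rw [Finset.set_biUnion_insert, Finset.card_insert_of_notMem hi]
        refine ⟨union_subset (hf i).1 ih.1, ?_⟩
        have h1 := hμ.union_le _ _ (hf i).1 ih.1
        have h2 := (hf i).2
        have h3 := ih.2
        push_cast
        linarith
    have h1 := key Finset.univ
    have h2 : (⋃ i ∈ (Finset.univ : Finset (Fin 8)), f i) = ⋃ i, f i := by simp
    rw [h2] at h1
    have h3 := (hμ.mono _ _ hc h1.1).trans h1.2
    have h4 := hμ.le_ground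
    rw [Finset.card_univ, Fintype.card_fin] at h3
    push_cast at h3
    linarith

include hμ in
theorem isTangle : IsTangle K k {A | A ⊆ K.E ∧ μ A ≤ (k : ℤ) - 2} where
  subset_ground A hA := hA.1
  lam_lt A hA := hμ.lam_lt A hA.1 hA.2
  mem_or_compl_mem := hμ.robustIdeal.mem_or_compl_mem
  union_ne A hA B hB C hC he := by
    have h1 := hμ.union_le _ _ (union_subset hA.1 hB.1) hC.1
    have h2 := hμ.union_le _ _ hA.1 hB.1
    rw [he] at h1
    have h3 := hμ.le_ground
    have h4 := hμ.two_le_ground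
    have h5 := hA.2
    have h6 := hB.2
    have h7 := hC.2
    omega
  compl_singleton_notMem e he hm := by
    -- This would give `μ K.E ≤ k - 1`. For `k = 2` the bound `8 * k - 15` equals `1` and does not
    -- exclude it, so `two_le_ground` is needed.
    have h1 := hμ.union_le (K.E \ {e}) {e} sdiff_subset (singleton_subset_iff.2 he)
    rw [sdiff_union_of_subset (singleton_subset_iff.2 he)] at h1
    have h2 := hm.2
    have h3 := hμ.singleton_le e
    have h4 := hμ.le_ground
    have h5 := hμ.two_le_ground
    omega

include hμ in
theorem exists_tangle : ∃ 𝒯 : Set (Set α), IsTangle K k 𝒯 ∧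
    (∀ 𝒯' : Set (Set α), IsTangle K k 𝒯' → 𝒯' = 𝒯) ∧
    ∀ T : LabelledTree K.E, IsMaximalPartialTree K k 𝒯 T →
      ∀ X : Set α, NonSequentialSep K k 𝒯 X →
        ∃ Y : Set α, TreeDisplays K k 𝒯 T Y ∧ EquivSep K k 𝒯 X Y :=
  ⟨_, hμ.isTangle, fun _ => hμ.robustIdeal.eq_of_isTangle, fun _ hT _ hX =>
    hT.exists_treeDisplays hμ.robustIdeal (hμ.robustIdeal.nonSeq_iff_nonSequentialSep.1 hX)⟩

end IsSize

/-! ### Rank and cardinality as size functions -/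

section Rank

variable (M : Matroid α) [M.Finite]

theorem coe_toNat_eRk (X : Set α) : ((M.eRk X).toNat : ℕ∞) = M.eRk X :=
  ENat.natCast_toNat (Matroid.eRk_ne_top_iff.2 (Matroid.RankFinite.isRkFinite X))

theorem rank_le_rank {X Y : Set α} (hXY : X ⊆ Y) : rank M X ≤ rank M Y := by
  have h := M.eRk_mono hXY
  rw [← coe_toNat_eRk, ← coe_toNat_eRk M Y] at h
  unfold rank
  exact_mod_cast h

theorem rank_le_ncard {X : Set α} (hX : X ⊆ M.E) : rank M X ≤ X.ncard := by
  have h := M.eRk_le_encard X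
  rw [← coe_toNat_eRk, ← (M.ground_finite.subset hX).cast_ncard_eq] at h
  unfold rank
  exact_mod_cast h

theorem rank_singleton_le (e : α) : rank M {e} ≤ 1 := by
  have h := M.eRk_le_encard {e}
  rw [← coe_toNat_eRk, encard_singleton] at h
  unfold rank
  exact_mod_cast h

omit [M.Finite] in
theorem rank_empty : rank M ∅ = 0 := by simp [rank]

theorem rank_union_le (X Y : Set α) : rank M (X ∪ Y) ≤ rank M X + rank M Y := by
  have h1 := rank_submodular M X Y
  have h2 : 0 ≤ rank M (X ∩ Y) := Int.natCast_nonneg _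
  linarith

variable {M}

/-- The complement has rank at most `r(M)`, so the connectivity is at most `r(X) + 1`. -/
theorem lam_lt_of_rank_le {X : Set α} (hX : rank M X ≤ (k : ℤ) - 2) :
    (matroidConn M).lam X < k := by
  have h1 : rank M (M.E \ X) ≤ rank M M.E := rank_le_rank M sdiff_subset
  change rank M X + rank M (M.E \ X) - rank M M.E + 1 < k
  omega

theorem LooselyVerticallyConnected.isSize (hM : LooselyVerticallyConnected M k) (hk : 2 ≤ k)
    (hr : max (8 * (k : ℤ) - 15) 2 ≤ rank M M.E) : IsSize (matroidConn M) k (rank M) where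
  two_le := hk
  empty_le := (rank_empty M).le
  singleton_le := rank_singleton_le M
  mono _ _ h _ := rank_le_rank M h
  union_le A B _ _ := rank_union_le M A B
  le_ground := (le_max_left _ _).trans hr
  two_le_ground := (le_max_right _ _).trans hr
  lam_lt _ _ h := lam_lt_of_rank_le h
  small := hM

theorem StrictlyConnected.isSize (hM : StrictlyConnected M k) (hk : 2 ≤ k)
    (hr : max (8 * (k : ℤ) - 15) 2 ≤ (M.E.ncard : ℤ)) :
    IsSize (matroidConn M) k (fun A => (A.ncard : ℤ)) where
  two_le := hk
  empty_le := by simp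
  singleton_le e := by simp
  mono A B h hB := by exact_mod_cast ncard_le_ncard h (M.ground_finite.subset hB)
  union_le A B _ _ := by exact_mod_cast ncard_union_le A B
  le_ground := (le_max_left _ _).trans hr
  two_le_ground := (le_max_right _ _).trans hr
  lam_lt A hA h := lam_lt_of_rank_le ((rank_le_ncard M hA).trans h)
  small A hA hl := by
    have hc : ((k - 1 : ℕ) : ℤ) = (k : ℤ) - 1 := by omega
    -- Only the top level `l = k - 1` of strict connectivity is used; fewer than `k - 1` elements
    -- means at most `k - 2`.
    have := hM (k - 1) (by omega) (by omega) A hA (by rw [hc]; exact hl)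
    have he : ((matroidConn M).E \ A).ncard = (M.E \ A).ncard := rfl
    rw [he]
    omega

end Rank

end

end TangleTree

theorem corollary6p3 {α : Type*} (M : Matroid α) [M.Finite] (k : ℕ) (hk : 2 ≤ k)
    (hM : (TangleTree.LooselyVerticallyConnected M k ∧
        max (8 * (k : ℤ) - 15) 2 ≤ TangleTree.rank M M.E) ∨
      (TangleTree.StrictlyConnected M k ∧
        max (8 * (k : ℤ) - 15) 2 ≤ (M.E.ncard : ℤ))) :
    ∃ 𝒯 : Set (Set α),
      TangleTree.IsTangle (TangleTree.matroidConn M) k 𝒯 ∧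
      (∀ 𝒯' : Set (Set α), TangleTree.IsTangle (TangleTree.matroidConn M) k 𝒯' → 𝒯' = 𝒯) ∧
      ∀ T : TangleTree.LabelledTree (TangleTree.matroidConn M).E,
        TangleTree.IsMaximalPartialTree (TangleTree.matroidConn M) k 𝒯 T →
        ∀ X : Set α, TangleTree.NonSequentialSep (TangleTree.matroidConn M) k 𝒯 X →
          ∃ Y : Set α, TangleTree.TreeDisplays (TangleTree.matroidConn M) k 𝒯 T Y ∧
            TangleTree.EquivSep (TangleTree.matroidConn M) k 𝒯 X Y := by
  rcases hM with ⟨hM, hr⟩ | ⟨hM, hr⟩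
  · exact (hM.isSize hk hr).exists_tangle
  · exact (hM.isSize hk hr).exists_tangle
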